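/- Let $d\in\{1,2,3\}$, let $D\subset\mathbb R^d$ be a nonempty bounded convex domain, let $(\Omega,\mathcal F,\pi)$ be a probability space, and let $0<\kappa_{\min}$, $\kappa_{\max}$ and $\mathbf a_{\max}$ be real constants. Let $\kappa(\cdot,\omega):D\to\mathbb R$ and $\mathbf a(\cdot,\omega):D\to\mathbb R^d$ be such that, for almost every $\omega\in\Omega$, $$\kappa_{\min}\le\kappa(\cdot,\omega)\le\kappa_{\max},\qquad \|\kappa(\cdot,\omega)\|_{W^{1,\infty}(D)}\le\kappa_{\max},\qquad \|\mathbf a(\cdot,\omega)\|_{L^\infty(D)}\le\mathbf a_{\max},\qquad \nabla\cdot\mathbf a(\cdot,\omega)=0 \text{ in } D. \tag{1}$$ Let $V=H^1_0(D)$ be the complex-valued Sobolev space with $\|v\|_V=\|\nabla v\|_{L^2(D)}$, let $\langle u,v\rangle=\int_D u\,\overline v\,dx$, and put $$\mathcal A(\omega;u,v)=\int_D\kappa\,\nabla u\cdot\nabla\overline v\,dx,\qquad \mathcal B(\omega;u,v)=\int_D(\mathbf a\cdot\nabla u)\,\overline v\,dx .$$ For $t\in[0,1]$ consider the eigenvalue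 problem of the homotopy operator $-\nabla\cdot(\kappa\nabla u)+t\,\mathbf a\cdot\nabla u$ with zero Dirichlet conditions and its dual problem, in weak form: for all $v\in V$, $$\mathcal A(\omega;u,v)+t\,\mathcal B(\omega;u,v)=\lambda\langle u,v\rangle,\qquad \mathcal A(\omega;v,u^*)+t\,\mathcal B(\omega;v,u^*)=\overline{\lambda^*}\,\langle v,u^*\rangle ,$$ with $u,u^*\in V$ and $\|u\|_{L^2}=\|u^*\|_{L^2}=1$. Let $\lambda(\omega,t)$ denote the eigenvalue of smallest modulus, $u(\omega,t)$ a normalised eigenfunction for it, and $u^*(\omega,t)$ a normalised dual eigenfunction for $\lambda^*=\overline{\lambda(\omega,t)}$. 1. Fix $\omega$ such that (1) holds, and let $t\in[0,1]$. The eigenvalue $\lambda(\omega,t)$ of smallest modulus exists, is unique, real and positive, and $u(\omega,t)$ and $u^*(\omega,t)$ can be chosen real and nonnegative almost everywhere. Put $$C_{t,\omega}=\frac{\|\mathbf a(\cdot,\omega)\|_{L^\infty}\big(\|u(\omega,1)\|_V+\|u^*(\omega,1)\|_V\big)}{\big|\langle u(\omega,1),u^*(\omega,t)\rangle+\langle u(\omega,t),u^*(\omega,1)\rangle\big|}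 .$$ For all normalised eigenfunctions $u(\omega,1),u^*(\omega,1),u(\omega,t),u^*(\omega,t)$, of arbitrary phase, for which this denominator does not vanish, $$|\lambda(\omega,1)-\lambda(\omega,t)|\le C_{t,\omega}\,(1-t).$$ If the four eigenfunctions are nonnegative, then $\langle u(\omega,1),u^*(\omega,t)\rangle+\langle u(\omega,t),u^*(\omega,1)\rangle$ is a positive real number, so that the estimate holds and the modulus in the denominator can be omitted. 2. There is $t_0\in[0,1)$ such that for every $t\in[t_0,1]$ there is a constant $C_t<\infty$, independent of $\omega$, such that for almost every $\omega\in\Omega$ one has $C_{t,\omega}<C_t$ for nonnegative eigenfunctions. -/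

import Mathlib

open MeasureTheory Set
open scoped ENNReal

noncomputable section

namespace ConvDiff

/-- `ℝ^d` with the Euclidean norm. -/
abbrev Pt (d : ℕ) : Type := EuclideanSpace ℝ (Fin d)

/-- Smooth functions with compact support in `D`, with values in `F`. -/
structure IsTestFunction {d : ℕ} {F : Type*} [NormedAddCommGroup F] [NormedSpace ℝ F]
    (D : Set (Pt d)) (φ : Pt d → F) : Prop where
  smooth : ContDiff ℝ ((⊤ : ℕ∞) : WithTop ℕ∞) φ
  compact_support : HasCompactSupport φ
  support_subset : tsupport φ ⊆ D

/-- The `i`-th partial derivative. -/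
def partialDeriv {d : ℕ} {F : Type*} [NormedAddCommGroup F] [NormedSpace ℝ F]
    (i : Fin d) (φ : Pt d → F) (x : Pt d) : F :=
  fderiv ℝ φ x (EuclideanSpace.single i (1 : ℝ))

/-- The gradient of a complex-valued function. -/
def cgrad {d : ℕ} (φ : Pt d → ℂ) (x : Pt d) : EuclideanSpace ℂ (Fin d) :=
  WithLp.toLp 2 fun i => partialDeriv i φ x

/-- `L²(D; ℂ) × L²(D; ℂ^d)` with its Hilbert space structure. A function `u` of `H¹(D)` is
identified with the pair `(u, ∇u)`; the norm of the pair is the `H¹(D)` norm of `u`. -/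
abbrev L2Pair {d : ℕ} (D : Set (Pt d)) : Type :=
  WithLp 2 (Lp ℂ 2 (volume.restrict D) × Lp (EuclideanSpace ℂ (Fin d)) 2 (volume.restrict D))

lemma IsTestFunction.differentiable {d : ℕ} {F : Type*} [NormedAddCommGroup F] [NormedSpace ℝ F]
    {D : Set (Pt d)} {φ : Pt d → F} (h : IsTestFunction D φ) : Differentiable ℝ φ :=
  h.smooth.differentiable (by simp)

/-- The pairs `(φ, ∇φ)` with `φ ∈ C_c^∞(D; ℂ)`. -/
def testPairs {d : ℕ} (D : Set (Pt d)) : Submodule ℂ (L2Pair D) where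
  carrier := {p | ∃ φ : Pt d → ℂ, IsTestFunction D φ ∧
    p.fst =ᵐ[volume.restrict D] φ ∧ p.snd =ᵐ[volume.restrict D] cgrad φ}
  zero_mem' := by
    refine ⟨fun _ => 0, ⟨contDiff_const, HasCompactSupport.zero, ?_⟩, ?_, ?_⟩
    · simp [tsupport, Function.support]
    · exact Lp.coeFn_zero _ _ _
    · filter_upwards [Lp.coeFn_zero (EuclideanSpace ℂ (Fin d)) 2 (volume.restrict D)] with x hx
      refine hx.trans ?_
      ext i
      simp [cgrad, partialDeriv]
  add_mem' := by
    rintro p q ⟨φ, hφ, hp1, hp2⟩ ⟨ψ, hψ, hq1, hq2⟩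
    refine ⟨φ + ψ, ⟨hφ.smooth.add hψ.smooth, hφ.compact_support.add hψ.compact_support,
      (tsupport_add φ ψ).trans (union_subset hφ.support_subset hψ.support_subset)⟩, ?_, ?_⟩
    · filter_upwards [Lp.coeFn_add p.fst q.fst, hp1, hq1] with x hx h1 h2
      refine hx.trans ?_
      simp [h1, h2]
    · filter_upwards [Lp.coeFn_add p.snd q.snd, hp2, hq2] with x hx h1 h2
      refine hx.trans ?_
      ext i
      simp [h1, h2, cgrad, partialDeriv, fderiv_add (hφ.differentiable x) (hψ.differentiable x)]
  smul_mem' := by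
    rintro c p ⟨φ, hφ, hp1, hp2⟩
    refine ⟨c • φ, ⟨contDiff_const.smul hφ.smooth, hφ.compact_support.smul_left,
      (closure_mono (Function.support_const_smul_subset c φ)).trans hφ.support_subset⟩, ?_, ?_⟩
    · filter_upwards [Lp.coeFn_smul c p.fst, hp1] with x hx h1
      refine hx.trans ?_
      simp [h1]
    · filter_upwards [Lp.coeFn_smul c p.snd, hp2] with x hx h1
      refine hx.trans ?_
      ext i
      simp [h1, cgrad, partialDeriv, fderiv_const_smul (hφ.differentiable x)]

/-- `V = H¹₀(D)`, complex-valued: the closure of `C_c^∞(D; ℂ)` in the `H¹(D)` norm. -/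
def H10 {d : ℕ} (D : Set (Pt d)) : Submodule ℂ (L2Pair D) :=
  (testPairs D).topologicalClosure

variable {d : ℕ} {D : Set (Pt d)}

/-- The function `u` itself, as an element of `L²(D)`. -/
def H10.val (u : H10 D) : Lp ℂ 2 (volume.restrict D) := (u : L2Pair D).fst

/-- The (weak) gradient `∇u`, as an element of `L²(D)^d`. -/
def H10.grad (u : H10 D) : Lp (EuclideanSpace ℂ (Fin d)) 2 (volume.restrict D) :=
  (u : L2Pair D).snd

/-- `‖u‖_V = ‖∇u‖_{L²(D)}`. -/
def normV (u : H10 D) : ℝ := ‖H10.grad u‖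

/-- `⟨u, v⟩ = ∫_D u(x) conj(v(x)) dx`; Mathlib's inner product is conjugate-linear in its first
slot, so the arguments are swapped. -/
def pairing (u v : H10 D) : ℂ := inner ℂ (H10.val v) (H10.val u)

/-- `𝒜(u, v) = ∫_D κ ∇u · conj(∇v) dx`. -/
def formA (κ : Pt d → ℝ) (u v : H10 D) : ℂ :=
  ∫ x in D, (κ x : ℂ) * ∑ i, H10.grad u x i * (starRingEnd ℂ) (H10.grad v x i)

/-- `ℬ(u, v) = ∫_D (a · ∇u) conj(v) dx`. -/
def formB (a : Pt d → Pt d) (u v : H10 D) : ℂ :=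
  ∫ x in D, (∑ i, (a x i : ℂ) * H10.grad u x i) * (starRingEnd ℂ) (H10.val v x)

/-- The sesquilinear form of the homotopy operator `-∇·(κ∇u) + t a·∇u`. -/
def formH (κ : Pt d → ℝ) (a : Pt d → Pt d) (t : ℝ) (u v : H10 D) : ℂ :=
  formA κ u v + (t : ℂ) * formB a u v

/-- `(lam, u)` is an eigenpair of the homotopy problem with `‖u‖_{L²} = 1`. -/
def IsEigenpair (κ : Pt d → ℝ) (a : Pt d → Pt d) (t : ℝ) (lam : ℂ) (u : H10 D) : Prop :=
  ‖H10.val u‖ = 1 ∧ ∀ v : H10 D, formH κ a t u v = lam * pairing u v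

/-- `(lamStar, us)` is an eigenpair of the dual homotopy problem with `‖us‖_{L²} = 1`. -/
def IsDualEigenpair (κ : Pt d → ℝ) (a : Pt d → Pt d) (t : ℝ) (lamStar : ℂ) (us : H10 D) : Prop :=
  ‖H10.val us‖ = 1 ∧ ∀ v : H10 D, formH κ a t v us = (starRingEnd ℂ) lamStar * pairing v us

/-- `lam` is an eigenvalue of smallest modulus of the homotopy problem in `H¹₀(D)`. -/
def IsSmallestEigenvalue (D : Set (Pt d)) (κ : Pt d → ℝ) (a : Pt d → Pt d) (t : ℝ)
    (lam : ℂ) : Prop :=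
  (∃ u : H10 D, IsEigenpair κ a t lam u) ∧
    ∀ (μ : ℂ) (w : H10 D), IsEigenpair κ a t μ w → ‖lam‖ ≤ ‖μ‖

/-- `lam` is a smallest eigenvalue of the homotopy problem, `u` a normalised eigenfunction for it
and `us` a normalised dual eigenfunction, for the dual eigenvalue `conj(lam)`. -/
structure IsHomotopySolution (κ : Pt d → ℝ) (a : Pt d → Pt d) (t : ℝ)
    (lam : ℂ) (u us : H10 D) : Prop where
  smallest : IsSmallestEigenvalue D κ a t lam
  primal : IsEigenpair κ a t lam u
  dual : IsDualEigenpair κ a t ((starRingEnd ℂ) lam) us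

/-- `u` is real-valued and nonnegative almost everywhere in `D`. -/
def IsNonneg (u : H10 D) : Prop :=
  ∀ᵐ x ∂(volume.restrict D), 0 ≤ (H10.val u x).re ∧ (H10.val u x).im = 0

/-- `‖a‖_{L^∞(D)}`, for the Euclidean norm on `ℝ^d`. -/
def supNorm (D : Set (Pt d)) (a : Pt d → Pt d) : ℝ :=
  (eLpNorm a ⊤ (volume.restrict D)).toReal

/-- `⟨u(1), u*(t)⟩ + ⟨u(t), u*(1)⟩`. -/
def denom (u1 us1 ut ust : H10 D) : ℂ := pairing u1 ust + pairing ut us1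

/-- `‖a‖_{L^∞} (‖u(1)‖_V + ‖u*(1)‖_V) / |⟨u(1), u*(t)⟩ + ⟨u(t), u*(1)⟩|`; the modulus makes
this a real number for eigenfunctions of arbitrary phase, and does nothing when the
denominator is positive. -/
def homotopyConst (a : Pt d → Pt d) (u1 us1 ut ust : H10 D) : ℝ :=
  supNorm D a * (normV u1 + normV us1) / ‖denom u1 us1 ut ust‖

/-- `g` is the `i`-th weak partial derivative of `f` in `D`. -/
def IsWeakPartial (D : Set (Pt d)) (i : Fin d) (f g : Pt d → ℝ) : Prop :=
  ∀ φ : Pt d → ℝ, IsTestFunction D φ →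
    ∫ x in D, f x * partialDeriv i φ x = -∫ x in D, g x * φ x

/-- `κmin ≤ κ ≤ κmax` almost everywhere in `D`, and `‖κ‖_{W^{1,∞}(D)} ≤ κmax`. -/
structure IsDiffusion (D : Set (Pt d)) (κmin κmax : ℝ) (κ : Pt d → ℝ) : Prop where
  meas : AEStronglyMeasurable κ (volume.restrict D)
  bounds : ∀ᵐ x ∂(volume.restrict D), κmin ≤ κ x ∧ κ x ≤ κmax
  weak_deriv : ∀ i : Fin d, ∃ g : Pt d → ℝ, AEStronglyMeasurable g (volume.restrict D) ∧
    (∀ᵐ x ∂(volume.restrict D), |g x| ≤ κmax) ∧ IsWeakPartial D i κ g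

/-- `‖a‖_{L^∞(D)} ≤ amax` and `∇·a = 0` in `D`, in the sense of distributions. -/
structure IsConvection (D : Set (Pt d)) (amax : ℝ) (a : Pt d → Pt d) : Prop where
  meas : AEStronglyMeasurable a (volume.restrict D)
  bound : eLpNorm a ⊤ (volume.restrict D) ≤ ENNReal.ofReal amax
  div_free : ∀ φ : Pt d → ℝ, IsTestFunction D φ → ∫ x in D, fderiv ℝ φ x (a x) = 0

end ConvDiff

end

/-! Put b = t a and L = -∇·(κ∇) + b·∇. Because b is divergence free, its form is skew-Hermitian
(`IsCoeff.formB_skew`): it drops out of the energy, and the dual problem is the same problem with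
drift -b (`IsCoeff.form_conj`). The coefficient class `IsCoeff` is stable under b ↦ -b, so every
result on eigenfunctions also covers the dual ones.

Existence is a Krein–Rutman argument. Poincaré, Lax–Milgram and Rellich give a compact solution
operator T on L²(D) (`IsCoeff.exists_solution`), and the weak maximum principle `IsCoeff.re_nonneg`
makes T preserve the cone of nonnegative functions. A fixed smooth bump e satisfies L e ≤ C e for
all coefficients of the class (`exists_barrier`; the Lipschitz bound on κ enters here), hence T e ≥
e / C, and `krein_rutman` yields a nonnegative eigenfunction whose eigenvalue lies in (0, C].
Pairing with the dual eigenfunction shows that primal and dual eigenvalue coincide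
(`IsCoeff.eq_of_isEig`). Pairing the solution S of L S = |μ||w| with it shows that every other
eigenvalue μ, with eigenfunction w, has larger modulus (`IsCoeff.le_norm_of_isEig`).

For the estimate, the problem at 1 is tested with the dual eigenfunction at t and the problem at t
with the dual eigenfunction at 1. The diffusion terms cancel, and what is left is (λ(1) - λ(t))
times the denominator, equal to (1 - t) times two drift terms (`eigenvalue_sub_mul_denom`).

The uniform bound needs the denominator to stay away from zero over the whole class. Nonnegative
supersolutions u obey an interior bound on ∇ arsinh(u/ε), independent of ε and of the coefficients
(`IsCoeff.log_estimate`). With the Poincaré–Wirtinger inequality it bounds the variance of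
arsinh(u/ε) on convex compact subsets of D, and this bound survives L² limits. It forces a limit to
be positive almost everywhere or zero almost everywhere, and the normalisation excludes zero
(`pos_of_mem_closure_superStates`). By Rellich the closure of the set of candidates is compact, so
the L² pairing attains a positive minimum there (`exists_pairing_ge`). Neither a Harnack inequality
nor uniqueness of eigenfunctions up to phase is needed, and t₀ = 0 works. -/

noncomputable section

namespace ConvDiff

open Filter Topology

/-! ### A Krein–Rutman theorem through positive resolvents -/

section KreinRutman

variable {E : Type*} [NormedAddCommGroup E] [NormedSpace ℂ E]

/-- A closed convex cone which spans the space over `ℂ`, with bounds. -/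
structure IsGenCone (K : Set E) : Prop where
  closed : IsClosed K
  zero : (0 : E) ∈ K
  add : ∀ x ∈ K, ∀ y ∈ K, x + y ∈ K
  smul : ∀ c : ℝ, 0 ≤ c → ∀ x ∈ K, (c : ℂ) • x ∈ K
  salient : ∀ x ∈ K, -x ∈ K → x = 0
  gen : ∀ x : E, ∃ p q r s, p ∈ K ∧ q ∈ K ∧ r ∈ K ∧ s ∈ K ∧ ‖p‖ ≤ ‖x‖ ∧ ‖q‖ ≤ ‖x‖ ∧ ‖r‖ ≤ ‖x‖ ∧
    ‖s‖ ≤ ‖x‖ ∧ x = p - q + Complex.I • (r - s)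

/-- `T` maps the cone `K` into itself. -/
def PosOp (K : Set E) (T : E →L[ℂ] E) : Prop := ∀ x ∈ K, T x ∈ K

/-- `R` is a positive two-sided inverse of `ρ - T`. -/
structure IsPosResolvent (K : Set E) (T : E →L[ℂ] E) (ρ : ℝ) (R : E →L[ℂ] E) : Prop where
  pos : PosOp K R
  left : R * ((ρ : ℂ) • 1 - T) = 1
  right : ((ρ : ℂ) • 1 - T) * R = 1

lemma PosOp.one (K : Set E) : PosOp K (1 : E →L[ℂ] E) := fun _ hx => hx

lemma PosOp.mul {K : Set E} {S T : E →L[ℂ] E} (hS : PosOp K S) (hT : PosOp K T) :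
    PosOp K (S * T) := fun x hx => hS _ (hT x hx)

lemma PosOp.pow {K : Set E} {T : E →L[ℂ] E} (hT : PosOp K T) (n : ℕ) : PosOp K (T ^ n) := by
  induction n with
  | zero => exact PosOp.one K
  | succ n ih => rw [pow_succ]; exact ih.mul hT

lemma PosOp.smul {K : Set E} (hK : IsGenCone K) {T : E →L[ℂ] E} (hT : PosOp K T) {c : ℝ}
    (hc : 0 ≤ c) : PosOp K ((c : ℂ) • T) := fun x hx => hK.smul c hc _ (hT x hx)

variable [CompleteSpace E] in
-- The inverse is the Neumann series. Its partial sums map the cone into itself, and the cone is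
-- closed.
lemma exists_posOp_inverse_one_sub {K : Set E} (hK : IsGenCone K) {T : E →L[ℂ] E}
    (hT : PosOp K T) (h1 : ‖T‖ < 1) :
    ∃ R : E →L[ℂ] E, PosOp K R ∧ R * (1 - T) = 1 ∧ (1 - T) * R = 1 := by
  refine ⟨∑' n : ℕ, T ^ n, ?_, geom_series_mul_neg T h1, mul_neg_geom_series T h1⟩
  intro x hx
  have hs : Summable fun n : ℕ => T ^ n := summable_geometric_of_norm_lt_one h1
  have h2 : HasSum (fun n : ℕ => (T ^ n) x) ((∑' n : ℕ, T ^ n) x) :=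
    (ContinuousLinearMap.apply ℂ E x).hasSum hs.hasSum
  refine hK.closed.mem_of_tendsto h2 (Eventually.of_forall fun s => ?_)
  induction s using Finset.cons_induction with
  | empty => simpa using hK.zero
  | cons a s ha ih => rw [Finset.sum_cons]; exact hK.add _ (hT.pow a x hx) _ ih

variable [CompleteSpace E] in
lemma IsPosResolvent.of_norm_lt {K : Set E} (hK : IsGenCone K) {T : E →L[ℂ] E}
    (hT : PosOp K T) {ρ : ℝ} (h1 : ‖T‖ < ρ) : ∃ R, IsPosResolvent K T ρ R := by
  have hρ : 0 < ρ := (norm_nonneg T).trans_lt h1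
  have hρ' : (ρ : ℂ) ≠ 0 := by exact_mod_cast hρ.ne'
  obtain ⟨R, hR, hl, hr⟩ := exists_posOp_inverse_one_sub hK
    (hT.smul hK (inv_nonneg.2 hρ.le)) (by
      rw [norm_smul, Complex.norm_real, Real.norm_of_nonneg (inv_nonneg.2 hρ.le),
        inv_mul_lt_one₀ hρ]; exact h1)
  have key : (ρ : ℂ) • (1 : E →L[ℂ] E) - T = (ρ : ℂ) • (1 - ((ρ⁻¹ : ℝ) : ℂ) • T) := by
    rw [smul_sub, smul_smul]; push_cast; rw [mul_inv_cancel₀ hρ', one_smul]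
  refine ⟨((ρ⁻¹ : ℝ) : ℂ) • R, hR.smul hK (inv_nonneg.2 hρ.le), ?_, ?_⟩
  · rw [key, smul_mul_smul_comm, hl]; push_cast; rw [inv_mul_cancel₀ hρ', one_smul]
  · rw [key, smul_mul_smul_comm, hr]; push_cast; rw [mul_inv_cancel₀ hρ', one_smul]

variable [CompleteSpace E] in
-- This rests on the factorisation σ - T = (1 - (ρ - σ) R)(ρ - T). Only a downward move of the
-- parameter keeps (ρ - σ) R positive, so that the Neumann series of the first factor preserves the
-- cone.
lemma IsPosResolvent.extend {K : Set E} (hK : IsGenCone K) {T R : E →L[ℂ] E} {ρ σ : ℝ}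
    (h : IsPosResolvent K T ρ R) (hσ : σ ≤ ρ) (h1 : (ρ - σ) * ‖R‖ < 1) :
    ∃ R', IsPosResolvent K T σ R' := by
  obtain ⟨Q, hQ, hl, hr⟩ := exists_posOp_inverse_one_sub hK
    (h.pos.smul hK (sub_nonneg.2 hσ)) (by
      rwa [norm_smul, Complex.norm_real, Real.norm_of_nonneg (sub_nonneg.2 hσ)])
  have k1 : (σ : ℂ) • (1 : E →L[ℂ] E) - T
      = (1 - ((ρ - σ : ℝ) : ℂ) • R) * ((ρ : ℂ) • 1 - T) := by
    rw [sub_mul, smul_mul_assoc, h.left, one_mul]; push_cast; rw [sub_smul]; abel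
  have k2 : (σ : ℂ) • (1 : E →L[ℂ] E) - T
      = ((ρ : ℂ) • 1 - T) * (1 - ((ρ - σ : ℝ) : ℂ) • R) := by
    rw [mul_sub, mul_smul_comm, h.right, mul_one]; push_cast; rw [sub_smul]; abel
  have hl' : (R * Q) * ((σ : ℂ) • (1 : E →L[ℂ] E) - T) = 1 := by
    rw [k1, mul_assoc, ← mul_assoc Q, hl, one_mul, h.left]
  have hr' : ((σ : ℂ) • (1 : E →L[ℂ] E) - T) * (Q * R) = 1 := by
    rw [k2, mul_assoc, ← mul_assoc _ Q, hr, one_mul, h.right]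
  have e : R * Q = Q * R := left_inv_eq_right_inv hl' hr'
  exact ⟨R * Q, h.pos.mul hQ, hl', e ▸ hr'⟩

/-- Every vector splits into four cone vectors of no larger norm, so the cone sees the operator norm
up to a factor 4. -/
lemma IsGenCone.exists_norm_ge {K : Set E} (hK : IsGenCone K) {R : E →L[ℂ] E} {M : ℝ}
    (hM : 4 * M < ‖R‖) (hM0 : 0 ≤ M) : ∃ p ∈ K, ‖p‖ ≤ 1 ∧ M < ‖R p‖ := by
  by_contra! hcon
  have h1 : ∀ p ∈ K, ‖R p‖ ≤ M * ‖p‖ := by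
    intro p hp
    rcases eq_or_ne p 0 with rfl | h0
    · simp
    have hn : 0 < ‖p‖ := norm_pos_iff.2 h0
    have := hcon (((‖p‖⁻¹ : ℝ) : ℂ) • p) (hK.smul _ (inv_nonneg.2 hn.le) p hp)
      (by rw [norm_smul, Complex.norm_real, norm_inv, norm_norm, inv_mul_cancel₀ hn.ne'])
    rw [map_smul, norm_smul, Complex.norm_real, norm_inv, norm_norm, inv_mul_le_iff₀ hn] at this
    linarith
  refine absurd (R.opNorm_le_bound (by positivity : 0 ≤ 4 * M) fun x => ?_) (not_le.2 hM)
  obtain ⟨p, q, r, s, hp, hq, hr, hs, np, nq, nr, ns, e⟩ := hK.gen x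
  have hx : R x = R p - R q + Complex.I • (R r - R s) := by
    conv_lhs => rw [e]
    simp
  have a1 : ∀ y ∈ K, ‖y‖ ≤ ‖x‖ → ‖R y‖ ≤ M * ‖x‖ := fun y hy hn =>
    (h1 y hy).trans (mul_le_mul_of_nonneg_left hn hM0)
  have h2 := norm_add_le (R p - R q) (Complex.I • (R r - R s))
  rw [norm_smul, Complex.norm_I, one_mul] at h2
  have h3 := norm_sub_le (R p) (R q)
  have h4 := norm_sub_le (R r) (R s)
  rw [hx]
  linarith [a1 p hp np, a1 q hq nq, a1 r hr nr, a1 s hs ns]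

variable [CompleteSpace E] in
/-- Krein–Rutman: a compact positive operator with `c e ≤ T e` for some positive `c`, `e` has a
positive eigenvalue `r ≥ c` with a positive eigenvector. -/
theorem krein_rutman {K : Set E} (hK : IsGenCone K) {T : E →L[ℂ] E} (hT : PosOp K T)
    (hc : IsCompactOperator T) {e : E} (he : e ∈ K) (he0 : e ≠ 0) {c : ℝ} (hc0 : 0 < c)
    (hTe : T e - (c : ℂ) • e ∈ K) :
    ∃ r : ℝ, c ≤ r ∧ ∃ u ∈ K, ‖u‖ = 1 ∧ T u = (r : ℂ) • u := by
  set N : Set ℝ := {ρ | 0 ≤ ρ ∧ ¬ ∃ R, IsPosResolvent K T ρ R} with hN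
  -- Below c a positive resolvent would send the cone vector T e - ρ e to -e, against salience.
  have hlow : ∀ ρ, 0 ≤ ρ → ρ < c → ρ ∈ N := by
    refine fun ρ h0 hρ => ⟨h0, ?_⟩
    rintro ⟨R, hR⟩
    have h1 : T e - (ρ : ℂ) • e ∈ K := by
      have := hK.add _ hTe _ (hK.smul (c - ρ) (by linarith) e he)
      convert this using 1
      push_cast; rw [sub_smul]; abel
    have h2 : R (T e - (ρ : ℂ) • e) = -e := by
      have := congrArg (fun A : E →L[ℂ] E => A e) hR.left
      simp only [mul_apply_eq_comp, sub_apply, smul_apply, one_apply_eq_self] at this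
      rw [← neg_sub, map_neg, this]
    exact he0 (hK.salient e he (h2 ▸ hR.pos _ h1))
  have hbdd : BddAbove N := ⟨‖T‖, fun ρ hρ => by
    by_contra! h
    exact hρ.2 (IsPosResolvent.of_norm_lt hK hT h)⟩
  have hne : N.Nonempty := ⟨0, hlow 0 le_rfl hc0⟩
  set r := sSup N with hr
  have hcr : c ≤ r := le_of_forall_lt fun x hx => by
    refine lt_of_lt_of_le (?_ : x < max ((x + c) / 2) 0) (le_csSup hbdd (hlow _ (le_max_right _ _) ?_))
    · exact lt_max_of_lt_left (by linarith)
    · exact max_lt (by linarith) hc0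
  have habove : ∀ ρ, r < ρ → ∃ R, IsPosResolvent K T ρ R := by
    intro ρ hρ
    by_contra h
    exact absurd (le_csSup hbdd (⟨by linarith, h⟩ : ρ ∈ N)) (not_le.2 hρ)
  -- The supremum r itself has no positive resolvent: otherwise `IsPosResolvent.extend` would
  -- provide one on an interval below r too, and r would not be the least upper bound.
  have hrN : ¬ ∃ R, IsPosResolvent K T r R := by
    rintro ⟨R, hR⟩
    obtain ⟨δ, hδ, h1⟩ : ∃ δ > 0, δ * ‖R‖ < 1 := by
      refine ⟨(‖R‖ + 1)⁻¹, by positivity, ?_⟩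
      rw [inv_mul_lt_one₀ (by positivity)]; linarith
    have : r ≤ r - δ := csSup_le hne fun ρ hρ => by
      by_contra! h
      refine hρ.2 ?_
      rcases le_or_gt ρ r with h2 | h2
      · refine hR.extend hK h2 (lt_of_le_of_lt ?_ h1)
        exact mul_le_mul_of_nonneg_right (by linarith) (norm_nonneg _)
      · exact habove ρ h2
    linarith
  have hr0 : 0 < r := hc0.trans_le hcr
  have happ : ∀ n : ℕ, ∃ v ∈ K, ‖v‖ = 1 ∧ ‖(r : ℂ) • v - T v‖ ≤ 3 * ((n : ℝ) + 1)⁻¹ := by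
    intro n
    set δ : ℝ := ((n : ℝ) + 1)⁻¹ / 4 with hδ
    have hn1 : (0 : ℝ) < (n : ℝ) + 1 := by positivity
    have hδ0 : 0 < δ := by positivity
    obtain ⟨R, hR⟩ := habove (r + δ) (by linarith)
    -- The resolvent blows up at r: a smaller norm at r + δ would allow an extension down to r.
    have h1 : 1 ≤ δ * ‖R‖ := by
      by_contra! h
      exact hrN (hR.extend hK (by linarith) (by simpa using h))
    -- With y = R p one gets ‖y‖ ≥ 1/(8δ) and r y - T y = p - δ y. After normalisation the residual
    -- is at most 9δ, hence below 12δ = 3/(n+1).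
    obtain ⟨p, hp, hp1, hp2⟩ := hK.exists_norm_ge (R := R) (M := ‖R‖ / 8) (by
        have : 0 < ‖R‖ := by
          by_contra! h
          nlinarith
        linarith) (by positivity)
    have hy : 0 < ‖R p‖ := lt_of_le_of_lt (by positivity) hp2
    set y := R p with hy'
    have h3 : ((r + δ : ℝ) : ℂ) • y - T y = p := by
      have := congrArg (fun A : E →L[ℂ] E => A p) hR.right
      simpa using this
    refine ⟨((‖y‖⁻¹ : ℝ) : ℂ) • y, hK.smul _ (inv_nonneg.2 hy.le) _ (hR.pos p hp), ?_, ?_⟩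
    · rw [norm_smul, Complex.norm_real, norm_inv, norm_norm, inv_mul_cancel₀ hy.ne']
    · have h4 : (r : ℂ) • ((‖y‖⁻¹ : ℝ) : ℂ) • y - T (((‖y‖⁻¹ : ℝ) : ℂ) • y)
          = ((‖y‖⁻¹ : ℝ) : ℂ) • (p - (δ : ℂ) • y) := by
        rw [map_smul, ← h3, smul_comm, ← smul_sub]
        congr 1
        push_cast; rw [add_smul]; abel
      rw [h4, norm_smul, Complex.norm_real, norm_inv, norm_norm, inv_mul_le_iff₀ hy]
      have h5 := norm_sub_le p ((δ : ℂ) • y)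
      rw [norm_smul, Complex.norm_real, Real.norm_of_nonneg hδ0.le] at h5
      have h6 : 1 ≤ 8 * δ * ‖y‖ := by nlinarith
      have h7 : ((n : ℝ) + 1)⁻¹ = 4 * δ := by rw [hδ]; ring
      rw [h7]
      nlinarith
  choose v hvK hv1 hv2 using happ
  have hcpt := hc.isCompact_closure_image_closedBall (1 : ℝ)
  obtain ⟨w, -, φ, hφ, hw⟩ := hcpt.tendsto_subseq (x := fun n => T (v n)) fun n =>
    subset_closure ⟨v n, by simp [hv1 n], rfl⟩
  -- Compactness makes T vₙ converge along a subsequence. The residual tends to 0, so r vₙ has the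
  -- same limit, and r > 0 lets one divide.
  have hlim : Tendsto (fun n => (r : ℂ) • v (φ n)) atTop (𝓝 w) := by
    have h0 : Tendsto (fun n => (r : ℂ) • v (φ n) - T (v (φ n))) atTop (𝓝 0) := by
      refine squeeze_zero_norm (fun n => hv2 (φ n)) ?_
      have : Tendsto (fun n : ℕ => 3 * ((n : ℝ) + 1)⁻¹) atTop (𝓝 (3 * 0)) :=
        (tendsto_inv_atTop_zero.comp
          (tendsto_atTop_add_const_right _ _ tendsto_natCast_atTop_atTop)).const_mul 3
      rw [mul_zero] at this
      exact this.comp hφ.tendsto_atTop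
    simpa using h0.add hw
  have hrc : (r : ℂ) ≠ 0 := by exact_mod_cast hr0.ne'
  have hlim2 : Tendsto (fun n => v (φ n)) atTop (𝓝 ((r : ℂ)⁻¹ • w)) := by
    have := hlim.const_smul (r : ℂ)⁻¹
    refine this.congr fun n => ?_
    rw [smul_smul, inv_mul_cancel₀ hrc, one_smul]
  refine ⟨r, hcr, (r : ℂ)⁻¹ • w, hK.closed.mem_of_tendsto hlim2
    (Eventually.of_forall fun n => hvK _), ?_, ?_⟩
  · exact tendsto_nhds_unique (by simpa using hlim2.norm) (by simp [hv1])
  · rw [smul_smul, mul_inv_cancel₀ hrc, one_smul]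
    exact tendsto_nhds_unique ((T.continuous.tendsto _).comp hlim2) hw

end KreinRutman

/-! ### Convergence and multiplication operators in L² -/

section L2Tools

variable {X : Type*} [MeasurableSpace X] {μ : Measure X}
  {E F : Type*} [NormedAddCommGroup E] [NormedAddCommGroup F]

lemma norm_sq_eq_integral [InnerProductSpace ℂ E] (f : Lp E 2 μ) :
    ‖f‖ ^ 2 = ∫ x, ‖f x‖ ^ 2 ∂μ := by
  have h := L2.inner_def (𝕜 := ℂ) f f
  simp only [inner_self_eq_norm_sq_to_K] at h
  have h2 : ((‖f‖ ^ 2 : ℝ) : ℂ) = ((∫ x, ‖f x‖ ^ 2 ∂μ : ℝ) : ℂ) := by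
    rw [← integral_complex_ofReal]
    push_cast
    exact h
  exact_mod_cast h2

lemma integrable_norm_sq (f : Lp E 2 μ) : Integrable (fun x => ‖f x‖ ^ 2) μ :=
  (Lp.memLp f).integrable_norm_pow (by norm_num)

lemma tendsto_Lp_of_dominated [InnerProductSpace ℂ E] {f : ℕ → Lp E 2 μ} {g : Lp E 2 μ}
    {b : X → ℝ} (hb : MemLp b 2 μ) (hdom : ∀ n, ∀ᵐ x ∂μ, ‖f n x - g x‖ ≤ b x)
    (hlim : ∀ᵐ x ∂μ, Tendsto (fun n => f n x) atTop (𝓝 (g x))) :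
    Tendsto f atTop (𝓝 g) := by
  rw [tendsto_iff_norm_sub_tendsto_zero]
  have h1 : Tendsto (fun n => ∫ x, ‖f n x - g x‖ ^ 2 ∂μ) atTop (𝓝 (∫ _, (0 : ℝ) ∂μ)) := by
    refine tendsto_integral_of_dominated_convergence (fun x => b x ^ 2)
      (fun n => ((((Lp.memLp (f n)).sub (Lp.memLp g)).1.norm).pow 2)) hb.integrable_sq
      (fun n => ?_) ?_
    · filter_upwards [hdom n] with x hx
      rw [Real.norm_of_nonneg (by positivity)]
      exact pow_le_pow_left₀ (norm_nonneg _) hx 2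
    · filter_upwards [hlim] with x hx
      have := ((hx.sub_const (g x)).norm).pow 2
      simpa using this
  have h2 : ∀ n, ∫ x, ‖f n x - g x‖ ^ 2 ∂μ = ‖f n - g‖ ^ 2 := fun n => by
    rw [norm_sq_eq_integral]
    refine integral_congr_ae ?_
    filter_upwards [Lp.coeFn_sub (f n) g] with x hx
    rw [hx]; rfl
  simp only [h2, integral_zero] at h1
  have := h1.sqrt
  simpa [Real.sqrt_sq (norm_nonneg _)] using this

lemma memLp_field [NormedSpace ℂ E] [NormedSpace ℂ F] {L : X → E →L[ℂ] F} {C : ℝ}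
    (hm : AEStronglyMeasurable L μ) (hC : ∀ᵐ x ∂μ, ‖L x‖ ≤ C) (f : Lp E 2 μ) :
    MemLp (fun x => L x (f x)) 2 μ :=
  (Lp.memLp f).of_le_mul (c := C)
    ((ContinuousLinearMap.id ℂ (E →L[ℂ] F)).aestronglyMeasurable_comp₂ hm (Lp.memLp f).1) (by
      filter_upwards [hC] with x hx
      exact (L x).le_of_opNorm_le hx _)

/-- The operator on `L²` given by a bounded measurable field of linear maps. -/
def fieldMap [NormedSpace ℂ E] [NormedSpace ℂ F] (L : X → E →L[ℂ] F) (C : ℝ)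
    (hm : AEStronglyMeasurable L μ) (hC : ∀ᵐ x ∂μ, ‖L x‖ ≤ C) : Lp E 2 μ →L[ℂ] Lp F 2 μ :=
  have hmem := memLp_field (μ := μ) hm hC
  LinearMap.mkContinuous
    { toFun := fun f => (hmem f).toLp _
      map_add' := fun f g => by
        ext1
        filter_upwards [(hmem (f + g)).coeFn_toLp, (hmem f).coeFn_toLp, (hmem g).coeFn_toLp,
          Lp.coeFn_add f g, Lp.coeFn_add ((hmem f).toLp _) ((hmem g).toLp _)] with x h1 h2 h3 h4 h5
        rw [h1, h5, h4]; simp [h2, h3]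
      map_smul' := fun c f => by
        ext1
        filter_upwards [(hmem (c • f)).coeFn_toLp, (hmem f).coeFn_toLp,
          Lp.coeFn_smul c f, Lp.coeFn_smul c ((hmem f).toLp _)] with x h1 h2 h4 h5
        rw [h1, RingHom.id_apply, h5, h4]; simp [h2] } C fun f => by
    refine Lp.norm_le_mul_norm_of_ae_le_mul ?_
    filter_upwards [(hmem f).coeFn_toLp, hC] with x h1 h2
    simp only [LinearMap.coe_mk, AddHom.coe_mk]
    rw [h1]
    exact (L x).le_of_opNorm_le h2 _

lemma coeFn_fieldMap [NormedSpace ℂ E] [NormedSpace ℂ F] {L : X → E →L[ℂ] F} {C : ℝ}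
    (hm : AEStronglyMeasurable L μ) (hC : ∀ᵐ x ∂μ, ‖L x‖ ≤ C) (f : Lp E 2 μ) :
    fieldMap L C hm hC f =ᵐ[μ] fun x => L x (f x) := 
  (memLp_field hm hC f).coeFn_toLp

lemma exists_fieldMap [NormedSpace ℂ E] [NormedSpace ℂ F] {g : X → E → F} (L : X → E →L[ℂ] F)
    (C : ℝ) (hm : AEStronglyMeasurable L μ) (hg : ∀ x v, L x v = g x v) (hC0 : 0 ≤ C)
    (hC : ∀ᵐ x ∂μ, ∀ v, ‖g x v‖ ≤ C * ‖v‖) :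
    ∃ M : Lp E 2 μ →L[ℂ] Lp F 2 μ, ∀ f, M f =ᵐ[μ] fun x => g x (f x) := by
  have hC' : ∀ᵐ x ∂μ, ‖L x‖ ≤ C := by
    filter_upwards [hC] with x hx
    exact (L x).opNorm_le_bound hC0 fun v => by rw [hg]; exact hx v
  refine ⟨fieldMap L C hm hC', fun f => ?_⟩
  filter_upwards [coeFn_fieldMap hm hC' f] with x hx
  rw [hx, hg]

end L2Tools

/-! ### Density, chain rule and product rule in H¹₀ -/

section H10Basics

variable {d : ℕ} {D : Set (Pt d)}

/-- `H10.val` as a continuous linear map. -/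
def valL (D : Set (Pt d)) : H10 D →L[ℂ] Lp ℂ 2 (volume.restrict D) :=
  (WithLp.fstL 2 ℂ _ _).comp (H10 D).subtypeL

/-- `H10.grad` as a continuous linear map. -/
def gradL (D : Set (Pt d)) :
    H10 D →L[ℂ] Lp (EuclideanSpace ℂ (Fin d)) 2 (volume.restrict D) :=
  (WithLp.sndL 2 ℂ _ _).comp (H10 D).subtypeL

lemma continuous_val : Continuous (H10.val (D := D)) := (valL D).continuous

lemma continuous_grad : Continuous (H10.grad (D := D)) := (gradL D).continuous

instance : CompleteSpace (H10 D) :=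
  (testPairs D).isClosed_topologicalClosure.completeSpace_coe

lemma H10.norm_sq (u : H10 D) : ‖u‖ ^ 2 = ‖H10.val u‖ ^ 2 + ‖H10.grad u‖ ^ 2 :=
  WithLp.prod_norm_sq_eq_of_L2 (u : L2Pair D)

/-- Density of test functions in the form of an induction principle; it reduces closed conditions to
smooth compactly supported functions. -/
lemma H10.induction {P : H10 D → Prop} (hc : IsClosed {u | P u})
    (ht : ∀ (φ : Pt d → ℂ) (u : H10 D), IsTestFunction D φ → H10.val u =ᵐ[volume.restrict D] φ →
      H10.grad u =ᵐ[volume.restrict D] cgrad φ → P u) (u : H10 D) : P u := by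
  obtain ⟨t, htc, hte⟩ := isClosed_induced_iff.1 hc
  have h1 : (testPairs D : Set (L2Pair D)) ⊆ t := by
    rintro p ⟨φ, hφ, h1, h2⟩
    have hp : p ∈ H10 D := (testPairs D).le_topologicalClosure ⟨φ, hφ, h1, h2⟩
    have : (⟨p, hp⟩ : H10 D) ∈ (Subtype.val ⁻¹' t : Set (H10 D)) := by
      rw [hte]; exact ht φ ⟨p, hp⟩ hφ h1 h2
    exact this
  have h2 : (u : L2Pair D) ∈ t := htc.closure_subset_iff.2 h1 u.2
  have : u ∈ (Subtype.val ⁻¹' t : Set (H10 D)) := h2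
  rw [hte] at this
  exact this

lemma H10.exists_seq (u : H10 D) : ∃ (φ : ℕ → Pt d → ℂ) (w : ℕ → H10 D),
    (∀ n, IsTestFunction D (φ n)) ∧ (∀ n, H10.val (w n) =ᵐ[volume.restrict D] φ n) ∧
    (∀ n, H10.grad (w n) =ᵐ[volume.restrict D] cgrad (φ n)) ∧ Tendsto w atTop (𝓝 u) := by
  obtain ⟨x, hx, hxu⟩ := mem_closure_iff_seq_limit.1 (show (u : L2Pair D) ∈
    closure (testPairs D : Set (L2Pair D)) from u.2)
  choose φ hφ h1 h2 using hx
  refine ⟨φ, fun n => ⟨x n, (testPairs D).le_topologicalClosure ⟨φ n, hφ n, h1 n, h2 n⟩⟩, hφ, h1, h2,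
    ?_⟩
  rwa [tendsto_subtype_rng]

/-- Closedness of the gradient: to build an element of H¹₀ it suffices to find the L² limits of
functions and of gradients separately. -/
lemma H10.exists_of_tendsto {w : ℕ → H10 D} {p : Lp ℂ 2 (volume.restrict D)}
    {q : Lp (EuclideanSpace ℂ (Fin d)) 2 (volume.restrict D)}
    (hp : Tendsto (fun n => H10.val (w n)) atTop (𝓝 p))
    (hq : Tendsto (fun n => H10.grad (w n)) atTop (𝓝 q)) :
    ∃ u : H10 D, H10.val u = p ∧ H10.grad u = q := by
  have h : Tendsto (fun n => (w n : L2Pair D)) atTop (𝓝 (WithLp.toLp 2 (p, q))) :=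
    ((WithLp.prod_continuous_toLp 2 _ _).tendsto (p, q)).comp (hp.prodMk_nhds hq)
  exact ⟨⟨WithLp.toLp 2 (p, q), (testPairs D).isClosed_topologicalClosure.mem_of_tendsto h
    (Eventually.of_forall fun n => (w n).2)⟩, rfl, rfl⟩

lemma IsTestFunction.continuous_fderiv {F : Type*} [NormedAddCommGroup F] [NormedSpace ℝ F]
    {φ : Pt d → F} (h : IsTestFunction D φ) : Continuous (fderiv ℝ φ) :=
  h.smooth.continuous_fderiv (by simp)

lemma IsTestFunction.continuous_cgrad {φ : Pt d → ℂ} (h : IsTestFunction D φ) :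
    Continuous (cgrad φ) := by
  refine (PiLp.continuous_toLp 2 _).comp (continuous_pi fun i => ?_)
  exact h.continuous_fderiv.clm_apply continuous_const

lemma IsTestFunction.hasCompactSupport_cgrad {φ : Pt d → ℂ} (h : IsTestFunction D φ) :
    HasCompactSupport (cgrad φ) := by
  refine (h.compact_support.fderiv ℝ).mono fun x hx => ?_
  contrapose! hx
  rw [Function.notMem_support] at hx ⊢
  ext i
  simp [cgrad, partialDeriv, hx]

lemma IsTestFunction.memLp {φ : Pt d → ℂ} (h : IsTestFunction D φ) :
    MemLp φ 2 (volume.restrict D) :=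
  (h.smooth.continuous.memLp_of_hasCompactSupport h.compact_support).restrict D

lemma IsTestFunction.memLp_cgrad {φ : Pt d → ℂ} (h : IsTestFunction D φ) :
    MemLp (cgrad φ) 2 (volume.restrict D) :=
  (h.continuous_cgrad.memLp_of_hasCompactSupport h.hasCompactSupport_cgrad).restrict D

lemma IsTestFunction.exists_H10 {φ : Pt d → ℂ} (h : IsTestFunction D φ) :
    ∃ u : H10 D, H10.val u =ᵐ[volume.restrict D] φ ∧
      H10.grad u =ᵐ[volume.restrict D] cgrad φ :=
  ⟨⟨WithLp.toLp 2 (h.memLp.toLp φ, h.memLp_cgrad.toLp _), (testPairs D).le_topologicalClosure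
    ⟨φ, h, h.memLp.coeFn_toLp, h.memLp_cgrad.coeFn_toLp⟩⟩,
    h.memLp.coeFn_toLp, h.memLp_cgrad.coeFn_toLp⟩

/-- Apply a real-linear map of `ℂ` to all coordinates. -/
def mapVec (L : ℂ →L[ℝ] ℂ) (g : EuclideanSpace ℂ (Fin d)) : EuclideanSpace ℂ (Fin d) :=
  WithLp.toLp 2 fun i => L (g i)

@[simp] lemma mapVec_apply (L : ℂ →L[ℝ] ℂ) (g : EuclideanSpace ℂ (Fin d)) (i : Fin d) :
    mapVec L g i = L (g i) := rfl

lemma mapVec_sub (L : ℂ →L[ℝ] ℂ) (g h : EuclideanSpace ℂ (Fin d)) :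
    mapVec L (g - h) = mapVec L g - mapVec L h := by ext i; simp

lemma norm_mapVec_le (L : ℂ →L[ℝ] ℂ) (g : EuclideanSpace ℂ (Fin d)) :
    ‖mapVec L g‖ ≤ ‖L‖ * ‖g‖ := by
  rw [EuclideanSpace.norm_eq, EuclideanSpace.norm_eq, ← Real.sqrt_sq (norm_nonneg L),
    ← Real.sqrt_mul (sq_nonneg _), Finset.mul_sum]
  refine Real.sqrt_le_sqrt (Finset.sum_le_sum fun i _ => ?_)
  rw [← mul_pow]
  exact pow_le_pow_left₀ (norm_nonneg _) (L.le_opNorm _) 2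

lemma continuous_mapVec :
    Continuous fun p : (ℂ →L[ℝ] ℂ) × EuclideanSpace ℂ (Fin d) => mapVec p.1 p.2 := by
  refine (PiLp.continuous_toLp 2 _).comp (continuous_pi fun i => ?_)
  exact continuous_fst.clm_apply ((EuclideanSpace.proj i).continuous.comp continuous_snd)

lemma memLp_mapVec {G : Pt d → ℂ →L[ℝ] ℂ} {C : ℝ} {μ : Measure (Pt d)}
    (hG : AEStronglyMeasurable G μ) (hC : ∀ x, ‖G x‖ ≤ C)
    (g : Lp (EuclideanSpace ℂ (Fin d)) 2 μ) : MemLp (fun x => mapVec (G x) (g x)) 2 μ :=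
  (Lp.memLp g).of_le_mul (c := C)
    (continuous_mapVec.comp_aestronglyMeasurable (hG.prodMk (Lp.memLp g).1))
    (Eventually.of_forall fun x => (norm_mapVec_le _ _).trans
      (mul_le_mul_of_nonneg_right (hC x) (norm_nonneg _)))

lemma IsTestFunction.comp {φ : Pt d → ℂ} (h : IsTestFunction D φ) {F : ℂ → ℂ}
    (hF : ContDiff ℝ ((⊤ : ℕ∞) : WithTop ℕ∞) F) (F0 : F 0 = 0) :
    IsTestFunction D (fun x => F (φ x)) :=
  ⟨hF.comp h.smooth, h.compact_support.comp_left (g := F) F0,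
    (closure_mono (Function.support_comp_subset F0 φ)).trans h.support_subset⟩

lemma norm_comp_le {F : ℂ → ℂ} (hF : Differentiable ℝ F) {L : ℝ}
    (hL : ∀ z, ‖fderiv ℝ F z‖ ≤ L) (z w : ℂ) : ‖F z - F w‖ ≤ L * ‖z - w‖ :=
  Convex.norm_image_sub_le_of_norm_fderiv_le (𝕜 := ℝ) (s := univ) (fun x _ => hF x)
    (fun x _ => hL x) convex_univ trivial trivial

/-- Chain rule in `H¹₀`. -/
theorem H10.exists_comp (u : H10 D) {F : ℂ → ℂ} (hF : ContDiff ℝ ((⊤ : ℕ∞) : WithTop ℕ∞) F)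
    (F0 : F 0 = 0) {L : ℝ} (hL : ∀ z, ‖fderiv ℝ F z‖ ≤ L) :
    ∃ w : H10 D, H10.val w =ᵐ[volume.restrict D] (fun x => F (H10.val u x)) ∧
      H10.grad w =ᵐ[volume.restrict D]
        fun x => mapVec (fderiv ℝ F (H10.val u x)) (H10.grad u x) := by
  have hFd : Differentiable ℝ F := hF.differentiable (by simp)
  have hF' : Continuous (fderiv ℝ F) := hF.continuous_fderiv (by simp)
  have hL0 : 0 ≤ L := (norm_nonneg _).trans (hL 0)
  obtain ⟨φ, w, hφ, h1, h2, hw⟩ := H10.exists_seq u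
  have hv : Tendsto (fun n => H10.val (w n)) atTop (𝓝 (H10.val u)) :=
    (continuous_val.tendsto u).comp hw
  have hg : Tendsto (fun n => H10.grad (w n)) atTop (𝓝 (H10.grad u)) :=
    (continuous_grad.tendsto u).comp hw
  -- Almost everywhere convergence is needed because F′ is only continuous and bounded: F′(φₙ)∇u is
  -- handled by dominated convergence.
  obtain ⟨ns, hns, hae⟩ := (tendstoInMeasure_of_tendsto_Lp hv).exists_seq_tendsto_ae
  have hmem1 : MemLp (fun x => F (H10.val u x)) 2 (volume.restrict D) :=
    (Lp.memLp (H10.val u)).of_le_mul (c := L)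
      (hF.continuous.comp_aestronglyMeasurable (Lp.memLp _).1)
      (Eventually.of_forall fun x => by
        simpa [F0] using norm_comp_le hFd hL (H10.val u x) 0)
  have hmem2 := memLp_mapVec (hF'.comp_aestronglyMeasurable (Lp.memLp (H10.val u)).1)
    (fun x => hL _) (H10.grad u)
  choose v hv1 hv2 using fun n => ((hφ n).comp hF F0).exists_H10
  have hcg : ∀ n x, cgrad (fun x => F (φ n x)) x = mapVec (fderiv ℝ F (φ n x)) (cgrad (φ n) x) := by
    intro n x
    ext i
    simp only [cgrad, partialDeriv, mapVec_apply]
    have : fderiv ℝ (fun x => F (φ n x)) x = (fderiv ℝ F (φ n x)).comp (fderiv ℝ (φ n) x) :=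
      fderiv_comp x (hFd _) ((hφ n).differentiable x)
    rw [this]; rfl
  have t1 : Tendsto (fun n => H10.val (v (ns n))) atTop (𝓝 (hmem1.toLp _)) := by
    rw [tendsto_iff_norm_sub_tendsto_zero]
    have h0 := (tendsto_iff_norm_sub_tendsto_zero.1 (hv.comp hns.tendsto_atTop)).const_mul L
    rw [mul_zero] at h0
    refine squeeze_zero (fun _ => norm_nonneg _) (fun n => ?_) h0
    refine Lp.norm_le_mul_norm_of_ae_le_mul ?_
    filter_upwards [Lp.coeFn_sub (H10.val (v (ns n))) (hmem1.toLp _), hmem1.coeFn_toLp,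
      hv1 (ns n), h1 (ns n), Lp.coeFn_sub (H10.val (w (ns n))) (H10.val u)] with x e1 e2 e3 e4 e5
    simp only [Function.comp_apply]
    rw [e1, e5, Pi.sub_apply, Pi.sub_apply, e2, e3, e4]
    exact norm_comp_le hFd hL _ _
  -- F′(φₙ)∇φₙ is split as F′(φₙ)∇u + F′(φₙ)(∇φₙ - ∇u). The first part converges by dominated
  -- convergence (`t2`), the second vanishes in L² because F′ is bounded (`t3`).
  have hmem3 : ∀ n, MemLp (fun x => mapVec (fderiv ℝ F (H10.val (w (ns n)) x)) (H10.grad u x)) 2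
      (volume.restrict D) := fun n =>
    memLp_mapVec (hF'.comp_aestronglyMeasurable (Lp.memLp (H10.val (w (ns n)))).1)
      (fun x => hL _) (H10.grad u)
  have t2 : Tendsto (fun n => (hmem3 n).toLp _) atTop (𝓝 (hmem2.toLp _)) := by
    refine tendsto_Lp_of_dominated (b := fun x => (2 * L) * ‖H10.grad u x‖)
      ((Lp.memLp (H10.grad u)).norm.const_mul _) (fun n => ?_) ?_
    · filter_upwards [(hmem3 n).coeFn_toLp, hmem2.coeFn_toLp] with x e1 e2
      rw [e1, e2]
      refine (norm_sub_le _ _).trans ?_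
      have a1 := norm_mapVec_le (fderiv ℝ F (H10.val (w (ns n)) x)) (H10.grad u x)
      have a2 := norm_mapVec_le (fderiv ℝ F (H10.val u x)) (H10.grad u x)
      have b1 := mul_le_mul_of_nonneg_right (hL (H10.val (w (ns n)) x)) (norm_nonneg (H10.grad u x))
      have b2 := mul_le_mul_of_nonneg_right (hL (H10.val u x)) (norm_nonneg (H10.grad u x))
      linarith
    · filter_upwards [ae_all_iff.2 fun n => (hmem3 n).coeFn_toLp, hmem2.coeFn_toLp, hae]
        with x e1 e2 e3
      simp only [e1, e2]
      exact (continuous_mapVec.tendsto (fderiv ℝ F (H10.val u x), H10.grad u x)).comp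
        (((hF'.tendsto _).comp e3).prodMk_nhds tendsto_const_nhds)
  have t3 : Tendsto (fun n => H10.grad (v (ns n)) - (hmem3 n).toLp _) atTop (𝓝 0) := by
    have h0 := (tendsto_iff_norm_sub_tendsto_zero.1 (hg.comp hns.tendsto_atTop)).const_mul L
    rw [mul_zero] at h0
    refine squeeze_zero_norm (fun n => ?_) h0
    refine Lp.norm_le_mul_norm_of_ae_le_mul ?_
    filter_upwards [Lp.coeFn_sub (H10.grad (v (ns n))) ((hmem3 n).toLp _), (hmem3 n).coeFn_toLp,
      hv2 (ns n), h1 (ns n), h2 (ns n), Lp.coeFn_sub (H10.grad (w (ns n))) (H10.grad u)]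
      with x e1 e2 e3 e4 e5 e6
    simp only [Function.comp_apply]
    rw [e1, e6, Pi.sub_apply, Pi.sub_apply, e2, e3, hcg, e4, ← e5, ← mapVec_sub]
    exact (norm_mapVec_le _ _).trans (mul_le_mul_of_nonneg_right (hL _) (norm_nonneg _))
  have t4 : Tendsto (fun n => H10.grad (v (ns n))) atTop (𝓝 (hmem2.toLp _)) := by
    simpa using t3.add t2
  obtain ⟨y, hy1, hy2⟩ := H10.exists_of_tendsto t1 t4
  exact ⟨y, hy1 ▸ hmem1.coeFn_toLp, hy2 ▸ hmem2.coeFn_toLp⟩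

/-- Chain rule for pointwise limits of smooth functions. -/
theorem H10.exists_comp_of_tendsto (u : H10 D) {F : ℕ → ℂ → ℂ}
    (hF : ∀ n, ContDiff ℝ ((⊤ : ℕ∞) : WithTop ℕ∞) (F n)) (F0 : ∀ n, F n 0 = 0) {L : ℝ}
    (hL : ∀ n z, ‖fderiv ℝ (F n) z‖ ≤ L) {f : ℂ → ℂ} {G : ℂ → ℂ →L[ℝ] ℂ}
    (hf : ∀ z, Tendsto (fun n => F n z) atTop (𝓝 (f z)))
    (hG : ∀ z, Tendsto (fun n => fderiv ℝ (F n) z) atTop (𝓝 (G z))) :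
    ∃ w : H10 D, H10.val w =ᵐ[volume.restrict D] (fun x => f (H10.val u x)) ∧
      H10.grad w =ᵐ[volume.restrict D] fun x => mapVec (G (H10.val u x)) (H10.grad u x) := by
  have hbd : ∀ n z, ‖F n z‖ ≤ L * ‖z‖ := fun n z => by
    simpa [F0] using norm_comp_le ((hF n).differentiable (by simp)) (hL n) z 0
  have hbd' : ∀ z, ‖f z‖ ≤ L * ‖z‖ := fun z =>
    le_of_tendsto (hf z).norm (Eventually.of_forall fun n => hbd n z)
  have hGL : ∀ z, ‖G z‖ ≤ L := fun z =>
    le_of_tendsto (hG z).norm (Eventually.of_forall fun n => hL n z)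
  have hF' : ∀ n, Continuous (fderiv ℝ (F n)) := fun n => (hF n).continuous_fderiv (by simp)
  choose w hw1 hw2 using fun n => H10.exists_comp u (hF n) (F0 n) (hL n)
  have m1 : MemLp (fun x => f (H10.val u x)) 2 (volume.restrict D) :=
    (Lp.memLp (H10.val u)).of_le_mul (c := L)
      (aestronglyMeasurable_of_tendsto_ae atTop
        (fun n => (hF n).continuous.comp_aestronglyMeasurable (Lp.memLp (H10.val u)).1)
        (Eventually.of_forall fun x => hf _))
      (Eventually.of_forall fun x => hbd' _)
  have m2 := memLp_mapVec (aestronglyMeasurable_of_tendsto_ae atTop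
        (fun n => (hF' n).comp_aestronglyMeasurable (Lp.memLp (H10.val u)).1)
        (Eventually.of_forall fun x => hG _)) (fun x => hGL _) (H10.grad u)
  have t1 : Tendsto (fun n => H10.val (w n)) atTop (𝓝 (m1.toLp _)) := by
    refine tendsto_Lp_of_dominated (b := fun x => (2 * L) * ‖H10.val u x‖)
      ((Lp.memLp (H10.val u)).norm.const_mul _) (fun n => ?_) ?_
    · filter_upwards [hw1 n, m1.coeFn_toLp] with x e1 e2
      rw [e1, e2]
      refine (norm_sub_le _ _).trans ?_
      linarith [hbd n (H10.val u x), hbd' (H10.val u x)]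
    · filter_upwards [ae_all_iff.2 hw1, m1.coeFn_toLp] with x e1 e2
      simp only [e1, e2]
      exact hf _
  have t2 : Tendsto (fun n => H10.grad (w n)) atTop (𝓝 (m2.toLp _)) := by
    refine tendsto_Lp_of_dominated (b := fun x => (2 * L) * ‖H10.grad u x‖)
      ((Lp.memLp (H10.grad u)).norm.const_mul _) (fun n => ?_) ?_
    · filter_upwards [hw2 n, m2.coeFn_toLp] with x e1 e2
      rw [e1, e2]
      refine (norm_sub_le _ _).trans ?_
      have a1 := norm_mapVec_le (fderiv ℝ (F n) (H10.val u x)) (H10.grad u x)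
      have a2 := norm_mapVec_le (G (H10.val u x)) (H10.grad u x)
      have b1 := mul_le_mul_of_nonneg_right (hL n (H10.val u x)) (norm_nonneg (H10.grad u x))
      have b2 := mul_le_mul_of_nonneg_right (hGL (H10.val u x)) (norm_nonneg (H10.grad u x))
      linarith
    · filter_upwards [ae_all_iff.2 hw2, m2.coeFn_toLp] with x e1 e2
      simp only [e1, e2]
      exact (continuous_mapVec.tendsto (G (H10.val u x), H10.grad u x)).comp
        ((hG _).prodMk_nhds tendsto_const_nhds)
  obtain ⟨y, hy1, hy2⟩ := H10.exists_of_tendsto t1 t2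
  exact ⟨y, hy1 ▸ m1.coeFn_toLp, hy2 ▸ m2.coeFn_toLp⟩

/-- Product with a test function. -/
theorem H10.exists_mul (u : H10 D) {ψ : Pt d → ℂ} (hψ : IsTestFunction D ψ) :
    ∃ w : H10 D, H10.val w =ᵐ[volume.restrict D] (fun x => ψ x * H10.val u x) ∧
      H10.grad w =ᵐ[volume.restrict D]
        fun x => ψ x • H10.grad u x + H10.val u x • cgrad ψ x := by
  obtain ⟨C1, hC1⟩ := hψ.compact_support.exists_bound_of_continuous hψ.smooth.continuous
  obtain ⟨C2, hC2⟩ := hψ.hasCompactSupport_cgrad.exists_bound_of_continuous hψ.continuous_cgrad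
  obtain ⟨M1, hM1⟩ : ∃ M : Lp ℂ 2 (volume.restrict D) →L[ℂ] Lp ℂ 2 (volume.restrict D),
      ∀ f, M f =ᵐ[volume.restrict D] fun x => ψ x * f x := by
    exact exists_fieldMap (fun x => ψ x • ContinuousLinearMap.id ℂ ℂ) C1
      (hψ.smooth.continuous.smul continuous_const).aestronglyMeasurable (fun _ _ => rfl)
      ((norm_nonneg _).trans (hC1 0)) (Eventually.of_forall fun x v => by
        rw [norm_mul]; exact mul_le_mul_of_nonneg_right (hC1 x) (norm_nonneg v))
  obtain ⟨M2, hM2⟩ : ∃ M : Lp (EuclideanSpace ℂ (Fin d)) 2 (volume.restrict D) →L[ℂ]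
      Lp (EuclideanSpace ℂ (Fin d)) 2 (volume.restrict D),
      ∀ f, M f =ᵐ[volume.restrict D] fun x => ψ x • f x := by
    exact exists_fieldMap (fun x => ψ x • ContinuousLinearMap.id ℂ (EuclideanSpace ℂ (Fin d))) C1
      (hψ.smooth.continuous.smul continuous_const).aestronglyMeasurable (fun _ _ => rfl)
      ((norm_nonneg _).trans (hC1 0)) (Eventually.of_forall fun x v => by
        rw [norm_smul]; exact mul_le_mul_of_nonneg_right (hC1 x) (norm_nonneg v))
  obtain ⟨M3, hM3⟩ : ∃ M : Lp ℂ 2 (volume.restrict D) →L[ℂ]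
      Lp (EuclideanSpace ℂ (Fin d)) 2 (volume.restrict D),
      ∀ f, M f =ᵐ[volume.restrict D] fun x => f x • cgrad ψ x := by
    exact exists_fieldMap (fun x => ContinuousLinearMap.toSpanSingleton ℂ (cgrad ψ x)) C2
      ((ContinuousLinearMap.toSpanSingletonCLE (𝕜 := ℂ)
        (E := EuclideanSpace ℂ (Fin d))).continuous.comp hψ.continuous_cgrad).aestronglyMeasurable
      (fun _ _ => ContinuousLinearMap.toSpanSingleton_apply _ _ _)
      ((norm_nonneg _).trans (hC2 0)) (Eventually.of_forall fun x v => by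
        rw [norm_smul, mul_comm]; exact mul_le_mul_of_nonneg_right (hC2 x) (norm_nonneg v))
  -- Once both sides of the product rule are continuous operators on L², the rule passes from test
  -- functions to limits.
  have key : ∀ u : H10 D, ∃ w : H10 D, H10.val w = M1 (H10.val u) ∧
      H10.grad w = M2 (H10.grad u) + M3 (H10.val u) := by
    intro u
    obtain ⟨φ, v, hφ, h1, h2, hv⟩ := H10.exists_seq u
    have htest : ∀ n, IsTestFunction D (fun x => ψ x * φ n x) := fun n =>
      ⟨hψ.smooth.mul (hφ n).smooth, hψ.compact_support.mul_right,
        (tsupport_mul_subset_left).trans hψ.support_subset⟩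
    choose w hw1 hw2 using fun n => (htest n).exists_H10
    have e1 : ∀ n, H10.val (w n) = M1 (H10.val (v n)) := fun n => by
      ext1
      filter_upwards [hw1 n, h1 n, hM1 (H10.val (v n))] with x a1 a2 a3
      rw [a1, a3, a2]
    have e2 : ∀ n, H10.grad (w n) = M2 (H10.grad (v n)) + M3 (H10.val (v n)) := fun n => by
      ext1
      filter_upwards [hw2 n, h1 n, h2 n, Lp.coeFn_add (M2 (H10.grad (v n))) (M3 (H10.val (v n))),
        hM2 (H10.grad (v n)), hM3 (H10.val (v n))]
        with x a1 a2 a3 a4 a5 a6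
      rw [a1, a4, Pi.add_apply, a5, a6, a2, a3]
      ext i
      simp [cgrad, partialDeriv, fderiv_fun_mul (hψ.differentiable x) ((hφ n).differentiable x)]
    have c1 : Tendsto (fun n => H10.val (w n)) atTop (𝓝 (M1 (H10.val u))) := by
      simp only [e1]
      exact ((M1.continuous.comp continuous_val).tendsto u).comp hv
    have c2 : Tendsto (fun n => H10.grad (w n)) atTop
        (𝓝 (M2 (H10.grad u) + M3 (H10.val u))) := by
      simp only [e2]
      exact (((M2.continuous.comp continuous_grad).add
        (M3.continuous.comp continuous_val)).tendsto u).comp hv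
    exact H10.exists_of_tendsto c1 c2
  obtain ⟨w, hw1, hw2⟩ := key u
  refine ⟨w, ?_, ?_⟩
  · rw [hw1]
    filter_upwards [hM1 (H10.val u)] with x a
    rw [a]
  · rw [hw2]
    filter_upwards [Lp.coeFn_add (M2 (H10.grad u)) (M3 (H10.val u)),
      hM2 (H10.grad u), hM3 (H10.val u)] with x a4 a5 a6
    rw [a4, Pi.add_apply, a5, a6]

end H10Basics

/-! ### The Poincaré–Wirtinger inequality for smooth functions -/

section Wirtinger

variable {d : ℕ} {D : Set (Pt d)}

lemma sq_lintegral_le {X : Type*} [MeasurableSpace X] {μ : Measure X} [IsProbabilityMeasure μ]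
    {f : X → ℝ≥0∞} (hf : AEMeasurable f μ) : (∫⁻ x, f x ∂μ) ^ 2 ≤ ∫⁻ x, f x ^ 2 ∂μ := by
  have h := ENNReal.lintegral_mul_le_Lp_mul_Lq μ Real.HolderConjugate.two_two hf
    (aemeasurable_const (b := (1 : ℝ≥0∞)))
  simp only [Pi.mul_apply, mul_one, ENNReal.one_rpow, lintegral_const, measure_univ] at h
  calc (∫⁻ x, f x ∂μ) ^ 2 ≤ ((∫⁻ x, f x ^ (2 : ℝ) ∂μ) ^ (1 / 2 : ℝ)) ^ 2 := by gcongr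
    _ = ∫⁻ x, f x ^ 2 ∂μ := by
      rw [← ENNReal.rpow_natCast, ← ENNReal.rpow_mul]
      norm_num

lemma fderiv_apply_eq_sum {F : Type*} [NormedAddCommGroup F] [NormedSpace ℝ F] (φ : Pt d → F)
    (x v : Pt d) : fderiv ℝ φ x v = ∑ i, v i • partialDeriv i φ x := by
  conv_lhs => rw [← (EuclideanSpace.basisFun (Fin d) ℝ).sum_repr v]
  simp [partialDeriv, map_sum]

lemma norm_fderiv_le_cgrad (φ : Pt d → ℂ) (x v : Pt d) :
    ‖fderiv ℝ φ x v‖ ≤ ‖cgrad φ x‖ * ‖v‖ := by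
  have h := norm_inner_le_norm (𝕜 := ℂ) (WithLp.toLp 2 (fun i => (v i : ℂ)) : EuclideanSpace ℂ (Fin d))
    (cgrad φ x)
  have h1 : inner ℂ (WithLp.toLp 2 (fun i => (v i : ℂ)) : EuclideanSpace ℂ (Fin d)) (cgrad φ x)
      = fderiv ℝ φ x v := by
    rw [fderiv_apply_eq_sum, PiLp.inner_apply]
    refine Finset.sum_congr rfl fun i _ => ?_
    simp [cgrad, mul_comm]
  have h2 : ‖(WithLp.toLp 2 (fun i => (v i : ℂ)) : EuclideanSpace ℂ (Fin d))‖ = ‖v‖ := by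
    simp [EuclideanSpace.norm_eq]
  rw [h1, h2] at h
  linarith

/-- The fundamental theorem of calculus along the segment, followed by Cauchy–Schwarz on [0, 1]. -/
lemma enorm_sub_sq_le {φ : Pt d → ℂ} (hφ : Differentiable ℝ φ) (hc : Continuous (fderiv ℝ φ))
    (hg : Continuous (cgrad φ)) (x z : Pt d) :
    ‖φ (x + z) - φ x‖ₑ ^ 2 ≤
      ‖z‖ₑ ^ 2 * ∫⁻ s in Icc (0 : ℝ) 1, ‖cgrad φ (x + s • z)‖ₑ ^ 2 := by
  have hprob : IsProbabilityMeasure (volume.restrict (Icc (0 : ℝ) 1)) := ⟨by simp⟩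
  have hline : Continuous fun s : ℝ => x + s • z := by fun_prop
  have h1 : φ (x + z) - φ x = ∫ s in Icc (0 : ℝ) 1, fderiv ℝ φ (x + s • z) z := by
    rw [integral_Icc_eq_integral_Ioc, ← intervalIntegral.integral_of_le zero_le_one]
    have := intervalIntegral.integral_eq_sub_of_hasDerivAt (a := 0) (b := 1)
      (f := fun s : ℝ => φ (x + s • z)) (f' := fun s => fderiv ℝ φ (x + s • z) z)
      (fun s _ => by
        have hl : HasDerivAt (fun s : ℝ => x + s • z) z s := by
          simpa using ((hasDerivAt_id s).smul_const z).const_add x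
        exact (hφ _).hasFDerivAt.comp_hasDerivAt s hl)
      (((hc.comp hline).clm_apply continuous_const).intervalIntegrable 0 1)
    rw [this]; simp
  have hm : AEMeasurable (fun s : ℝ => ‖cgrad φ (x + s • z)‖ₑ)
      (volume.restrict (Icc (0 : ℝ) 1)) := (hg.comp hline).enorm.aemeasurable
  calc ‖φ (x + z) - φ x‖ₑ ^ 2
      ≤ (∫⁻ s in Icc (0 : ℝ) 1, ‖z‖ₑ * ‖cgrad φ (x + s • z)‖ₑ) ^ 2 := by
        rw [h1]
        gcongr
        refine (enorm_integral_le_lintegral_enorm _).trans (lintegral_mono fun s => ?_)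
        have h2 := norm_fderiv_le_cgrad φ (x + s • z) z
        rw [mul_comm] at h2
        rw [← ofReal_norm, ← ofReal_norm, ← ofReal_norm, ← ENNReal.ofReal_mul (norm_nonneg _)]
        exact ENNReal.ofReal_le_ofReal h2
    _ ≤ ‖z‖ₑ ^ 2 * ∫⁻ s in Icc (0 : ℝ) 1, ‖cgrad φ (x + s • z)‖ₑ ^ 2 := by
        rw [lintegral_const_mul' _ _ enorm_ne_top, mul_pow]
        gcongr
        exact sq_lintegral_le hm

/-- If x and x + z lie in the convex set C, so does the segment between them, and only gradient
values in C are met. Tonelli and translation invariance then remove the segment parameter. -/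
lemma lintegral_translate_le {φ : Pt d → ℂ} (hφ : Differentiable ℝ φ)
    (hc : Continuous (fderiv ℝ φ)) (hg : Continuous (cgrad φ)) {C : Set (Pt d)}
    (hC : Convex ℝ C) (hCm : MeasurableSet C) (z : Pt d) :
    ∫⁻ x in C, C.indicator (fun y => ‖φ y - φ x‖ₑ ^ 2) (x + z) ≤
      ‖z‖ₑ ^ 2 * ∫⁻ x in C, ‖cgrad φ x‖ₑ ^ 2 := by
  set g : Pt d → ℝ≥0∞ := C.indicator fun y => ‖cgrad φ y‖ₑ ^ 2 with hgdef
  have hgm : Measurable g := (hg.enorm.measurable.pow_const 2).indicator hCm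
  calc ∫⁻ x in C, C.indicator (fun y => ‖φ y - φ x‖ₑ ^ 2) (x + z)
      ≤ ∫⁻ x in C, ‖z‖ₑ ^ 2 * ∫⁻ s in Icc (0 : ℝ) 1, g (x + s • z) := by
        refine setLIntegral_mono' hCm fun x hx => ?_
        by_cases hxz : x + z ∈ C
        · rw [indicator_of_mem hxz]
          refine (enorm_sub_sq_le hφ hc hg x z).trans ?_
          gcongr ‖z‖ₑ ^ 2 * ?_
          refine setLIntegral_mono' measurableSet_Icc fun s hs => ?_
          have : x + s • z ∈ C := by
            have := hC.add_smul_mem hx hxz hs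
            exact this
          rw [hgdef, indicator_of_mem this]
        · rw [indicator_of_notMem hxz]; exact zero_le
    _ ≤ ∫⁻ x, ‖z‖ₑ ^ 2 * ∫⁻ s in Icc (0 : ℝ) 1, g (x + s • z) := setLIntegral_le_lintegral _ _
    _ = ‖z‖ₑ ^ 2 * ∫⁻ s in Icc (0 : ℝ) 1, ∫⁻ x, g (x + s • z) := by
        rw [lintegral_const_mul' _ _ (by simp), lintegral_lintegral_swap]
        refine Measurable.aemeasurable ?_
        exact hgm.comp (by fun_prop)
    _ = ‖z‖ₑ ^ 2 * ∫⁻ x in C, ‖cgrad φ x‖ₑ ^ 2 := by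
        simp only [lintegral_add_right_eq_self, lintegral_const]
        rw [hgdef, lintegral_indicator hCm]
        simp

/-- With y = x + z the inner domain becomes a range of translations z, and only |z| ≤ δ contributes.
This produces the volume of the δ-ball. -/
lemma lintegral_lintegral_sub_le {φ : Pt d → ℂ} (hφ : Differentiable ℝ φ)
    (hc : Continuous (fderiv ℝ φ)) (hg : Continuous (cgrad φ)) {C : Set (Pt d)}
    (hC : Convex ℝ C) (hCm : MeasurableSet C) {δ : ℝ}
    (hδ : ∀ x ∈ C, ∀ y ∈ C, ‖y - x‖ ≤ δ) :
    ∫⁻ x in C, ∫⁻ y in C, ‖φ y - φ x‖ₑ ^ 2 ≤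
      ENNReal.ofReal (δ ^ 2) * volume (Metric.closedBall (0 : Pt d) δ) *
        ∫⁻ x in C, ‖cgrad φ x‖ₑ ^ 2 := by
  have hm : Measurable (Function.uncurry fun (x z : Pt d) =>
      C.indicator (fun y => ‖φ y - φ x‖ₑ ^ 2) (x + z)) := by
    have : (Function.uncurry fun (x z : Pt d) => C.indicator (fun y => ‖φ y - φ x‖ₑ ^ 2) (x + z))
        = ((fun p : Pt d × Pt d => p.1 + p.2) ⁻¹' C).indicator
          fun p => ‖φ (p.1 + p.2) - φ p.1‖ₑ ^ 2 := by
      ext p; rfl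
    rw [this]
    refine Measurable.indicator ?_ (hCm.preimage (by fun_prop))
    have h1 : Continuous fun p : Pt d × Pt d => φ (p.1 + p.2) - φ p.1 :=
      (hφ.continuous.comp (by fun_prop)).sub (hφ.continuous.comp continuous_fst)
    exact h1.enorm.measurable.pow_const 2
  calc ∫⁻ x in C, ∫⁻ y in C, ‖φ y - φ x‖ₑ ^ 2
      = ∫⁻ x in C, ∫⁻ z, C.indicator (fun y => ‖φ y - φ x‖ₑ ^ 2) (x + z) := by
        refine lintegral_congr fun x => ?_
        rw [← lintegral_indicator hCm]
        exact (lintegral_add_left_eq_self _ x).symm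
    _ = ∫⁻ z, ∫⁻ x in C, C.indicator (fun y => ‖φ y - φ x‖ₑ ^ 2) (x + z) :=
        lintegral_lintegral_swap hm.aemeasurable
    _ ≤ ∫⁻ z, (Metric.closedBall (0 : Pt d) δ).indicator
          (fun _ => ENNReal.ofReal (δ ^ 2) * ∫⁻ x in C, ‖cgrad φ x‖ₑ ^ 2) z := by
        refine lintegral_mono fun z => ?_
        by_cases hz : z ∈ Metric.closedBall (0 : Pt d) δ
        · rw [indicator_of_mem hz]
          refine (lintegral_translate_le hφ hc hg hC hCm z).trans ?_
          gcongr
          rw [← ofReal_norm, ← ENNReal.ofReal_pow (norm_nonneg _)]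
          refine ENNReal.ofReal_le_ofReal (pow_le_pow_left₀ (norm_nonneg _) ?_ 2)
          simpa using hz
        · rw [indicator_of_notMem hz, nonpos_iff_eq_zero,
            setLIntegral_congr_fun (g := fun _ => 0) hCm, lintegral_zero]
          intro x hx
          dsimp only
          rw [indicator_of_notMem]
          intro hxz
          refine hz ?_
          simpa using hδ x hx (x + z) hxz
    _ = _ := by
        rw [lintegral_indicator Metric.isClosed_closedBall.measurableSet, lintegral_const]
        simp only [Measure.restrict_apply_univ]
        ring

/-- Poincaré–Wirtinger inequality on a bounded convex set, in unnormalised form. -/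
lemma wirtinger_smooth {φ : Pt d → ℂ} (hφ : Differentiable ℝ φ)
    (hc : Continuous (fderiv ℝ φ)) (hg : Continuous (cgrad φ)) {C : Set (Pt d)}
    (hC : Convex ℝ C) (hCm : MeasurableSet C) {δ : ℝ}
    (hδ : ∀ x ∈ C, ∀ y ∈ C, ‖y - x‖ ≤ δ) :
    volume.real C * (∫ x in C, ‖φ x‖ ^ 2) - ‖∫ x in C, φ x‖ ^ 2 ≤
      δ ^ 2 * volume.real (Metric.closedBall (0 : Pt d) δ) * ∫ x in C, ‖cgrad φ x‖ ^ 2 := by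
  have hbd : Bornology.IsBounded C := by
    rcases C.eq_empty_or_nonempty with rfl | ⟨x0, hx0⟩
    · exact Bornology.isBounded_empty
    · refine (Metric.isBounded_closedBall (x := x0) (r := δ)).subset fun y hy => ?_
      rw [Metric.mem_closedBall, dist_eq_norm]; exact hδ x0 hx0 y hy
  have hint : ∀ {f : Pt d → ℝ}, Continuous f → IntegrableOn f C := fun hf =>
    (hf.continuousOn.integrableOn_compact hbd.isCompact_closure).mono_set subset_closure
  have hintc : ∀ {f : Pt d → ℂ}, Continuous f → IntegrableOn f C := fun hf =>
    (hf.continuousOn.integrableOn_compact hbd.isCompact_closure).mono_set subset_closure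
  have hfin : volume C < ∞ := hbd.measure_lt_top
  have : IsFiniteMeasure (volume.restrict C) := ⟨by simpa using hfin⟩
  have hφc := hφ.continuous
  have i1 : IntegrableOn (fun x => ‖φ x‖ ^ 2) C := hint (hφc.norm.pow 2)
  have i0 : IntegrableOn φ C := hintc hφc
  set A : ℝ := ∫ x in C, ‖φ x‖ ^ 2 with hA
  set m : ℂ := ∫ x in C, φ x with hmm
  have hsq : ∀ x y, ‖φ y - φ x‖ ^ 2 = ‖φ y‖ ^ 2 + ‖φ x‖ ^ 2
      - 2 * ((φ y).re * (φ x).re + (φ y).im * (φ x).im) := by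
    intro x y
    simp only [← Complex.normSq_eq_norm_sq, Complex.normSq_apply, Complex.sub_re, Complex.sub_im]
    ring
  have hre : ∫ y in C, (φ y).re = m.re := by
    have := (Complex.reCLM).integral_comp_comm i0
    simpa using this
  have him : ∫ y in C, (φ y).im = m.im := by
    have := (Complex.imCLM).integral_comp_comm i0
    simpa using this
  have ire : IntegrableOn (fun y => (φ y).re) C := hint (Complex.continuous_re.comp hφc)
  have iim : IntegrableOn (fun y => (φ y).im) C := hint (Complex.continuous_im.comp hφc)
  have hin : ∀ x, ∫ y in C, ‖φ y - φ x‖ ^ 2 = A + volume.real C * ‖φ x‖ ^ 2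
      - 2 * (m.re * (φ x).re + m.im * (φ x).im) := by
    intro x
    simp only [hsq]
    have j1 : IntegrableOn (fun y => ‖φ y‖ ^ 2 + ‖φ x‖ ^ 2) C := i1.add (integrable_const _)
    have j2 : IntegrableOn (fun y => 2 * ((φ y).re * (φ x).re + (φ y).im * (φ x).im)) C :=
      ((ire.mul_const _).add (iim.mul_const _)).const_mul 2
    rw [integral_sub j1 j2, integral_add i1 (integrable_const _),
      integral_const_mul, integral_add (ire.mul_const _) (iim.mul_const _), integral_mul_const,
      integral_mul_const, hre, him]
    simp [hA]
  -- The double integral of |φ(y) - φ(x)|² is twice the unnormalised variance. The gain of the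
  -- factor 2 is given away at the end.
  have hout : ∫ x in C, ∫ y in C, ‖φ y - φ x‖ ^ 2 = 2 * (volume.real C * A - ‖m‖ ^ 2) := by
    simp only [hin]
    have j1 : IntegrableOn (fun x => A + volume.real C * ‖φ x‖ ^ 2) C :=
      (integrable_const _).add (i1.const_mul _)
    have j2 : IntegrableOn (fun y => 2 * (m.re * (φ y).re + m.im * (φ y).im)) C :=
      ((ire.const_mul _).add (iim.const_mul _)).const_mul 2
    rw [integral_sub j1 j2,
      integral_add (integrable_const _) (i1.const_mul _),
      integral_const_mul, integral_const_mul, integral_add (ire.const_mul _) (iim.const_mul _),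
      integral_const_mul, integral_const_mul, hre, him, ← Complex.normSq_eq_norm_sq,
      Complex.normSq_apply]
    simp; ring
  have hlin : ∀ x, ∫⁻ y in C, ‖φ y - φ x‖ₑ ^ 2 = ENNReal.ofReal (∫ y in C, ‖φ y - φ x‖ ^ 2) := by
    intro x
    have j : IntegrableOn (fun y => ‖φ y - φ x‖ ^ 2) C :=
      hint ((hφc.sub continuous_const).norm.pow 2)
    rw [ofReal_integral_eq_lintegral_ofReal j
      (Eventually.of_forall fun y => by positivity)]
    refine lintegral_congr fun y => ?_
    rw [ENNReal.ofReal_pow (norm_nonneg _), ofReal_norm]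
  have hmain := lintegral_lintegral_sub_le hφ hc hg hC hCm hδ
  simp only [hlin] at hmain
  rw [← ofReal_integral_eq_lintegral_ofReal _ (Eventually.of_forall fun x =>
    integral_nonneg fun y => by positivity), hout] at hmain
  · have hG : ∫⁻ x in C, ‖cgrad φ x‖ₑ ^ 2 = ENNReal.ofReal (∫ x in C, ‖cgrad φ x‖ ^ 2) := by
      have j : IntegrableOn (fun x => ‖cgrad φ x‖ ^ 2) C := hint (hg.norm.pow 2)
      rw [ofReal_integral_eq_lintegral_ofReal j
        (Eventually.of_forall fun y => by positivity)]
      refine lintegral_congr fun y => ?_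
      rw [ENNReal.ofReal_pow (norm_nonneg _), ofReal_norm]
    have hG0 : 0 ≤ ∫ x in C, ‖cgrad φ x‖ ^ 2 := integral_nonneg fun x => by positivity
    have hV : volume (Metric.closedBall (0 : Pt d) δ)
        = ENNReal.ofReal (volume.real (Metric.closedBall (0 : Pt d) δ)) :=
      (ENNReal.ofReal_toReal measure_closedBall_lt_top.ne).symm
    rw [hG, hV, ← ENNReal.ofReal_mul (sq_nonneg _), ← ENNReal.ofReal_mul (by positivity),
      ENNReal.ofReal_le_ofReal_iff (by positivity)] at hmain
    have : 0 ≤ δ ^ 2 * volume.real (Metric.closedBall (0 : Pt d) δ) * ∫ x in C, ‖cgrad φ x‖ ^ 2 := by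
      positivity
    linarith
  · simp only [hin]
    refine hint ?_
    have := Complex.continuous_re.comp hφc
    have := Complex.continuous_im.comp hφc
    fun_prop

end Wirtinger

/-! ### Poincaré's inequality and Rellich's theorem -/

section Rellich

variable {d : ℕ} {D : Set (Pt d)}

lemma continuous_setIntegral_norm_sq {X E : Type*} [MeasurableSpace X] {μ : Measure X}
    [NormedAddCommGroup E] [InnerProductSpace ℂ E] (C : Set X) :
    Continuous fun f : Lp E 2 μ => ∫ x in C, ‖f x‖ ^ 2 ∂μ := by
  have h : (fun f : Lp E 2 μ => ∫ x in C, ‖f x‖ ^ 2 ∂μ)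
      = fun f => ‖LpToLpRestrictCLM X E ℂ μ 2 C f‖ ^ 2 := by
    ext f
    rw [norm_sq_eq_integral]
    refine integral_congr_ae ?_
    filter_upwards [LpToLpRestrictCLM_coeFn ℂ C f] with x hx
    rw [hx]
  rw [h]
  exact ((LpToLpRestrictCLM X E ℂ μ 2 C).continuous.norm).pow 2

/-- The integral over a set as a continuous linear functional on `L²`. -/
def setIntegralL {X : Type*} [MeasurableSpace X] (μ : Measure X) [IsFiniteMeasure μ] {C : Set X}
    (hC : MeasurableSet C) : Lp ℂ 2 μ →L[ℂ] ℂ :=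
  innerSL ℂ (indicatorConstLp 2 hC (measure_ne_top μ C) (1 : ℂ))

lemma setIntegralL_apply {X : Type*} [MeasurableSpace X] (μ : Measure X) [IsFiniteMeasure μ]
    {C : Set X} (hC : MeasurableSet C) (f : Lp ℂ 2 μ) :
    setIntegralL μ hC f = ∫ x in C, f x ∂μ := by
  simp [setIntegralL, L2.inner_indicatorConstLp_one]

lemma setIntegral_restrict_of_eq_zero {F : Type*} [NormedAddCommGroup F] [NormedSpace ℝ F]
    (hD : MeasurableSet D) {C : Set (Pt d)} (hC : MeasurableSet C) {f : Pt d → F}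
    (hf : ∀ x, x ∉ D → f x = 0) : ∫ x in C, f x ∂(volume.restrict D) = ∫ x in C, f x := by
  rw [Measure.restrict_restrict hC, ← integral_indicator (hC.inter hD), ← integral_indicator hC]
  congr 1
  ext x
  by_cases hx : x ∈ D
  · by_cases hxC : x ∈ C <;> simp [indicator, hx, hxC]
  · by_cases hxC : x ∈ C <;> simp [indicator, hx, hxC, hf x hx]

lemma IsTestFunction.eq_zero {F : Type*} [NormedAddCommGroup F] [NormedSpace ℝ F]
    {φ : Pt d → F} (h : IsTestFunction D φ) {x : Pt d} (hx : x ∉ D) : φ x = 0 :=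
  image_eq_zero_of_notMem_tsupport fun hx' => hx (h.support_subset hx')

lemma IsTestFunction.fderiv_eq_zero {F : Type*} [NormedAddCommGroup F] [NormedSpace ℝ F]
    {φ : Pt d → F} (h : IsTestFunction D φ) {x : Pt d} (hx : x ∉ D) : fderiv ℝ φ x = 0 :=
  fderiv_of_notMem_tsupport ℝ (fun hx' => hx (h.support_subset hx'))

lemma IsTestFunction.cgrad_eq_zero {φ : Pt d → ℂ} (h : IsTestFunction D φ) {x : Pt d}
    (hx : x ∉ D) : cgrad φ x = 0 := by
  ext i
  simp [cgrad, partialDeriv, h.fderiv_eq_zero hx]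

/-- Poincaré–Wirtinger inequality in `H¹₀(D)`. -/
theorem H10.wirtinger (hD : IsOpen D) [IsFiniteMeasure ((volume : Measure (Pt d)).restrict D)]
    (u : H10 D) {C : Set (Pt d)} (hC : Convex ℝ C) (hCm : MeasurableSet C) {δ : ℝ}
    (hδ : ∀ x ∈ C, ∀ y ∈ C, ‖y - x‖ ≤ δ) :
    volume.real C * (∫ x in C, ‖H10.val u x‖ ^ 2 ∂(volume.restrict D)) -
        ‖∫ x in C, H10.val u x ∂(volume.restrict D)‖ ^ 2 ≤
      δ ^ 2 * volume.real (Metric.closedBall (0 : Pt d) δ) *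
        ∫ x in C, ‖H10.grad u x‖ ^ 2 ∂(volume.restrict D) := by
  induction u using H10.induction with
  | hc =>
    refine isClosed_le ?_ ?_
    · refine (continuous_const.mul ((continuous_setIntegral_norm_sq C).comp continuous_val)).sub ?_
      simp only [← setIntegralL_apply (volume.restrict D) hCm]
      exact (((setIntegralL (volume.restrict D) hCm).continuous.comp continuous_val).norm).pow 2
    · exact continuous_const.mul ((continuous_setIntegral_norm_sq C).comp continuous_grad)
  | ht φ u hφ h1 h2 =>
    -- C may stick out of D: test functions vanish outside D, so integrating over C ∩ D or over C
    -- makes no difference, although the volume on the left is that of all of C.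
    have e1 : ∫ x in C, ‖H10.val u x‖ ^ 2 ∂(volume.restrict D) = ∫ x in C, ‖φ x‖ ^ 2 := by
      rw [← setIntegral_restrict_of_eq_zero hD.measurableSet hCm
        (fun x hx => by simp [hφ.eq_zero hx])]
      refine integral_congr_ae (ae_restrict_of_ae ?_)
      filter_upwards [h1] with x hx; rw [hx]
    have e2 : ∫ x in C, H10.val u x ∂(volume.restrict D) = ∫ x in C, φ x := by
      rw [← setIntegral_restrict_of_eq_zero hD.measurableSet hCm
        (fun x hx => by simp [hφ.eq_zero hx])]
      exact integral_congr_ae (ae_restrict_of_ae h1)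
    have e3 : ∫ x in C, ‖H10.grad u x‖ ^ 2 ∂(volume.restrict D) = ∫ x in C, ‖cgrad φ x‖ ^ 2 := by
      rw [← setIntegral_restrict_of_eq_zero hD.measurableSet hCm
        (fun x hx => by simp [hφ.cgrad_eq_zero hx])]
      refine integral_congr_ae (ae_restrict_of_ae ?_)
      filter_upwards [h2] with x hx; rw [hx]
    rw [e1, e2, e3]
    exact wirtinger_smooth hφ.differentiable hφ.continuous_fderiv hφ.continuous_cgrad hC hCm hδ

lemma isFiniteMeasure_restrict (hb : Bornology.IsBounded D) :
    IsFiniteMeasure ((volume : Measure (Pt d)).restrict D) :=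
  ⟨by simpa using hb.measure_lt_top⟩

lemma norm_setIntegralL_sq_le {X : Type*} [MeasurableSpace X] (μ : Measure X) [IsFiniteMeasure μ]
    {C : Set X} (hC : MeasurableSet C) (f : Lp ℂ 2 μ) :
    ‖∫ x in C, f x ∂μ‖ ^ 2 ≤ μ.real C * ‖f‖ ^ 2 := by
  rw [← setIntegralL_apply μ hC]
  have h1 := norm_inner_le_norm (𝕜 := ℂ) (indicatorConstLp 2 hC (measure_ne_top μ C) (1 : ℂ)) f
  have h2 : ‖indicatorConstLp 2 hC (measure_ne_top μ C) (1 : ℂ)‖ ^ 2 = μ.real C := by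
    rw [norm_indicatorConstLp (by norm_num) (by norm_num), norm_one, one_mul,
      ← Real.rpow_natCast, ← Real.rpow_mul (by positivity)]
    norm_num
  rw [← h2, ← mul_pow]
  exact pow_le_pow_left₀ (norm_nonneg _) h1 2

/-- Poincaré's inequality. -/
theorem H10.exists_poincare (hd : 1 ≤ d) (hD : IsOpen D) (hb : Bornology.IsBounded D) :
    ∃ P : ℝ, 0 < P ∧ ∀ u : H10 D, ‖H10.val u‖ ^ 2 ≤ P * ‖H10.grad u‖ ^ 2 := by
  have := isFiniteMeasure_restrict hb
  have : Nonempty (Fin d) := ⟨⟨0, hd⟩⟩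
  obtain ⟨R, hR0, hR⟩ := hb.subset_ball_lt 0 0
  -- Doubling the radius at least doubles the volume, as d ≥ 1. On the large ball |∫u|² ≤ |D|‖u‖² ≤
  -- |B_R|‖u‖² then absorbs at most half of the term |C|‖u‖² in Wirtinger's inequality.
  set C : Set (Pt d) := Metric.ball 0 (2 * R) with hC
  have hDC : D ⊆ C := hR.trans (Metric.ball_subset_ball (by linarith))
  have hfr : Module.finrank ℝ (Pt d) = d := by simp
  have hpos : 0 < volume.real (Metric.ball (0 : Pt d) R) :=
    ENNReal.toReal_pos (Metric.measure_ball_pos _ _ hR0).ne' measure_ball_lt_top.ne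
  have hvol : 2 * volume.real (Metric.ball (0 : Pt d) R) ≤ volume.real C := by
    rw [measureReal_def, measureReal_def, hC, Measure.addHaar_ball_mul_of_pos _ _ two_pos,
      ENNReal.toReal_mul, ENNReal.toReal_ofReal (by positivity), hfr]
    refine mul_le_mul_of_nonneg_right ?_ ENNReal.toReal_nonneg
    exact le_self_pow₀ (by norm_num) (by omega)
  have hDvol : volume.real D ≤ volume.real (Metric.ball (0 : Pt d) R) :=
    measureReal_mono hR measure_ball_lt_top.ne
  set K : ℝ := (4 * R) ^ 2 * volume.real (Metric.closedBall (0 : Pt d) (4 * R)) with hK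
  have hK0 : 0 ≤ K := by positivity
  refine ⟨(K + 1) / volume.real (Metric.ball (0 : Pt d) R), by positivity, fun u => ?_⟩
  have h := H10.wirtinger hD u (convex_ball 0 (2 * R)) measurableSet_ball (δ := 4 * R)
    (fun x hx y hy => by
      have h1 := norm_sub_le y x
      rw [mem_ball_zero_iff] at hx hy
      linarith)
  rw [← hC, ← hK] at h
  have hr : (volume.restrict D).restrict C = (volume.restrict D : Measure (Pt d)) := by
    rw [Measure.restrict_restrict measurableSet_ball, inter_eq_right.2 hDC]
  have h2 := norm_setIntegralL_sq_le (volume.restrict D) (measurableSet_ball : MeasurableSet C)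
    (H10.val u)
  have h3 : (volume.restrict D).real C = volume.real D := by
    rw [measureReal_def, Measure.restrict_apply measurableSet_ball, inter_eq_right.2 hDC,
      measureReal_def]
  rw [h3] at h2
  rw [hr] at h h2
  rw [← norm_sq_eq_integral, ← norm_sq_eq_integral] at h
  rw [div_mul_eq_mul_div, le_div_iff₀ hpos]
  nlinarith [sq_nonneg ‖H10.val u‖, sq_nonneg ‖H10.grad u‖]

lemma exists_clm_norm_sq_eq {E ι : Type*} [NormedAddCommGroup E] [NormedSpace ℂ E] (I : Finset ι)
    (f : ι → E →L[ℂ] ℂ) :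
    ∃ (n : ℕ) (ℓ : E →L[ℂ] EuclideanSpace ℂ (Fin n)), ∀ u, ‖ℓ u‖ ^ 2 = ∑ k ∈ I, ‖f k u‖ ^ 2 := by
  let e : Fin I.card ≃ I := I.equivFin.symm
  refine ⟨I.card, (PiLp.continuousLinearEquiv 2 ℂ
    (fun _ : Fin I.card => ℂ)).symm.toContinuousLinearMap.comp
      (ContinuousLinearMap.pi fun j => f (e j)), fun u => ?_⟩
  rw [EuclideanSpace.norm_sq_eq, ← Finset.sum_coe_sort I, ← e.sum_comp]
  rfl

/-- Up to a small multiple of the norm, A is controlled by a map into a finite-dimensional space,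
where the image of the unit ball is totally bounded. An ε/4-net there lifts to an ε-net of the image
under A, because (ε/4)² + 4(ε/4)² < ε². -/
lemma isCompactOperator_of_approx {E F ι : Type*} [NormedAddCommGroup E] [NormedSpace ℂ E]
    [NormedAddCommGroup F] [NormedSpace ℂ F] [CompleteSpace F] (A : E →L[ℂ] F)
    (h : ∀ ε > 0, ∃ (I : Finset ι) (f : ι → E →L[ℂ] ℂ),
      ∀ u, ‖A u‖ ^ 2 ≤ ∑ k ∈ I, ‖f k u‖ ^ 2 + ε ^ 2 * ‖u‖ ^ 2) : IsCompactOperator A := by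
  rw [isCompactOperator_iff_exists_mem_nhds_isCompact_closure_image]
  refine ⟨Metric.ball 0 1, Metric.ball_mem_nhds 0 one_pos, ?_⟩
  refine (TotallyBounded.closure ?_).isCompact_of_isClosed isClosed_closure
  rw [Metric.totallyBounded_iff]
  intro ε hε
  obtain ⟨I, f, hf⟩ := h (ε / 4) (by positivity)
  obtain ⟨n, ℓ, hℓ'⟩ := exists_clm_norm_sq_eq I f
  have hℓ : ∀ u, ‖A u‖ ^ 2 ≤ ‖ℓ u‖ ^ 2 + (ε / 4) ^ 2 * ‖u‖ ^ 2 := fun u => hℓ' u ▸ hf u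
  have htb : TotallyBounded (ℓ '' Metric.ball 0 1) := by
    have hbd : Bornology.IsBounded (ℓ '' Metric.ball 0 1) :=
      (ℓ.lipschitz.isBounded_image Metric.isBounded_ball)
    exact hbd.isCompact_closure.totallyBounded.subset subset_closure
  obtain ⟨t, hts, htf, htc⟩ := Metric.finite_approx_of_totallyBounded htb (ε / 4) (by positivity)
  choose! g hg1 hg2 using fun y (hy : y ∈ t) => hts hy
  refine ⟨(fun y => A (g y)) '' t, htf.image _, ?_⟩
  rintro _ ⟨u, hu, rfl⟩
  obtain ⟨y, hy, hyd⟩ := mem_iUnion₂.1 (htc ⟨u, hu, rfl⟩)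
  refine mem_iUnion₂.2 ⟨A (g y), ⟨y, hy, rfl⟩, ?_⟩
  rw [Metric.mem_ball, dist_eq_norm] at hyd ⊢
  have h1 := hℓ (u - g y)
  rw [map_sub, map_sub, hg2 y hy] at h1
  have h2 : ‖u - g y‖ ≤ 2 := by
    have h3 := norm_sub_le u (g y)
    have h4 := hg1 y hy
    rw [mem_ball_zero_iff] at hu h4
    linarith
  have h5 : ‖ℓ u - y‖ ^ 2 ≤ (ε / 4) ^ 2 := pow_le_pow_left₀ (norm_nonneg _) hyd.le 2
  have h6 : ‖u - g y‖ ^ 2 ≤ 2 ^ 2 := pow_le_pow_left₀ (norm_nonneg _) h2 2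
  refine lt_of_pow_lt_pow_left₀ 2 hε.le ?_
  nlinarith [sq_nonneg ε, mul_le_mul_of_nonneg_left h6 (sq_nonneg (ε / 4)), pow_pos hε 2]

/-- The cell with index `k` of the cubic grid of mesh size `h`. -/
def gridCell {d : ℕ} (h : ℝ) (k : Fin d → ℤ) : Set (Pt d) := {x | ∀ i, ⌊x i / h⌋ = k i}

lemma mem_gridCell_iff {h : ℝ} (hh : 0 < h) {k : Fin d → ℤ} {x : Pt d} :
    x ∈ gridCell h k ↔ ∀ i, x i ∈ Ico (k i * h) ((k i + 1) * h) := by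
  simp only [gridCell, mem_ofPred_eq, Int.floor_eq_iff, mem_Ico, le_div_iff₀ hh, div_lt_iff₀ hh]

lemma gridCell_eq_preimage {h : ℝ} (hh : 0 < h) (k : Fin d → ℤ) :
    gridCell h k = (WithLp.ofLp : Pt d → Fin d → ℝ) ⁻¹'
      (Set.pi univ fun i => Ico (k i * h) ((k i + 1) * h)) := by
  ext x
  simp [mem_gridCell_iff hh]

lemma measurableSet_gridCell {h : ℝ} (hh : 0 < h) (k : Fin d → ℤ) :
    MeasurableSet (gridCell h k) := by
  rw [gridCell_eq_preimage hh]
  exact (MeasurableSet.univ_pi fun i => measurableSet_Ico).preimage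
    (PiLp.volume_preserving_ofLp (Fin d)).measurable

lemma convex_gridCell {h : ℝ} (hh : 0 < h) (k : Fin d → ℤ) : Convex ℝ (gridCell h k) := by
  intro x hx y hy a b ha hb hab
  rw [mem_gridCell_iff hh] at *
  intro i
  exact convex_Ico _ _ (hx i) (hy i) ha hb hab

lemma volume_gridCell {h : ℝ} (hh : 0 < h) (k : Fin d → ℤ) :
    volume.real (gridCell h k) = h ^ d := by
  rw [measureReal_def, gridCell_eq_preimage hh,
    (PiLp.volume_preserving_ofLp (Fin d)).measure_preimage
      (MeasurableSet.univ_pi fun i => measurableSet_Ico).nullMeasurableSet, Real.volume_pi_Ico]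
  have : ∀ i, ((k i : ℝ) + 1) * h - k i * h = h := fun i => by ring
  simp [this, hh.le]

lemma norm_sub_le_of_mem_gridCell {h : ℝ} (hh : 0 < h) {k : Fin d → ℤ} {x y : Pt d}
    (hx : x ∈ gridCell h k) (hy : y ∈ gridCell h k) : ‖y - x‖ ≤ d * h := by
  rw [mem_gridCell_iff hh] at hx hy
  have h1 : ∀ i, ‖(y - x) i‖ ≤ h := fun i => by
    have := hx i; have := hy i
    simp only [mem_Ico] at *
    rw [PiLp.sub_apply, Real.norm_eq_abs, abs_le]
    constructor <;> linarith
  have h2 : ‖y - x‖ ≤ ∑ i, ‖(y - x) i‖ := by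
    conv_lhs => rw [← (EuclideanSpace.basisFun (Fin d) ℝ).sum_repr (y - x)]
    refine (norm_sum_le _ _).trans (Finset.sum_le_sum fun i _ => ?_)
    rw [norm_smul]; simp
  refine h2.trans ((Finset.sum_le_sum fun i _ => h1 i).trans ?_)
  simp

/-- Wirtinger's inequality on a cube of side h and diameter at most d h. The δ-ball has volume
proportional to h^d, so dividing by the cell volume leaves a gradient coefficient of order h². -/
lemma H10.setIntegral_gridCell_le (hD : IsOpen D)
    [IsFiniteMeasure ((volume : Measure (Pt d)).restrict D)] {h ε : ℝ} (hh : 0 < h)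
    (hhε : (d * h) ^ 2 * ((d : ℝ) ^ d * volume.real (Metric.closedBall (0 : Pt d) 1)) ≤ ε ^ 2)
    (u : H10 D) (k : Fin d → ℤ) :
    ∫ x in gridCell h k, ‖H10.val u x‖ ^ 2 ∂(volume.restrict D) ≤
      (h ^ d)⁻¹ * ‖∫ x in gridCell h k, H10.val u x ∂(volume.restrict D)‖ ^ 2 +
        ε ^ 2 * ∫ x in gridCell h k, ‖H10.grad u x‖ ^ 2 ∂(volume.restrict D) := by
  have hfr : Module.finrank ℝ (Pt d) = d := by simp
  have h1 := H10.wirtinger hD u (convex_gridCell hh k) (measurableSet_gridCell hh k)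
    (δ := d * h) fun x hx y hy => norm_sub_le_of_mem_gridCell hh hx hy
  have h2 : volume.real (Metric.closedBall (0 : Pt d) (d * h)) =
      (d * h) ^ d * volume.real (Metric.closedBall (0 : Pt d) 1) := by
    rw [measureReal_def, Measure.addHaar_closedBall' _ _ (by positivity), ENNReal.toReal_mul,
      ENNReal.toReal_ofReal (by positivity), hfr, measureReal_def]
  rw [volume_gridCell hh, h2] at h1
  generalize volume.real (Metric.closedBall (0 : Pt d) 1) = V at *
  have hp : 0 < h ^ d := pow_pos hh d
  have hG : 0 ≤ ∫ x in gridCell h k, ‖H10.grad u x‖ ^ 2 ∂(volume.restrict D) :=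
    integral_nonneg fun x => by positivity
  generalize ∫ x in gridCell h k, ‖H10.grad u x‖ ^ 2 ∂(volume.restrict D) = G at *
  generalize ∫ x in gridCell h k, ‖H10.val u x‖ ^ 2 ∂(volume.restrict D) = A at *
  generalize ‖∫ x in gridCell h k, H10.val u x ∂(volume.restrict D)‖ = m at *
  rw [← mul_le_mul_iff_right₀ hp, mul_add, ← mul_assoc (h ^ d), mul_inv_cancel₀ hp.ne', one_mul]
  have h3 : (d * h) ^ 2 * ((d * h) ^ d * V) = h ^ d * ((d * h) ^ 2 * ((d : ℝ) ^ d * V)) := by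
    rw [mul_pow (d : ℝ) h d]; ring
  rw [h3] at h1
  have h4 := mul_le_mul_of_nonneg_right (mul_le_mul_of_nonneg_left hhε hp.le) hG
  linarith

lemma exists_grid_cover (hb : Bornology.IsBounded D) {h : ℝ} (hh : 0 < h) :
    ∃ I : Finset (Fin d → ℤ), D ⊆ ⋃ k ∈ I, gridCell h k := by
  obtain ⟨R, hR0, hR⟩ := hb.subset_ball_lt 0 0
  refine ⟨Fintype.piFinset fun _ => Finset.Icc (-(⌈R / h⌉ + 1)) (⌈R / h⌉ + 1), fun x hx => ?_⟩
  refine mem_iUnion₂.2 ⟨fun i => ⌊x i / h⌋, ?_, fun i => rfl⟩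
  rw [Fintype.mem_piFinset]
  intro i
  have h1 : |x i| ≤ R := by
    have := hR hx
    rw [mem_ball_zero_iff] at this
    exact (PiLp.norm_apply_le x i).trans this.le
  rw [abs_le] at h1
  have h2 : x i / h ≤ R / h := by gcongr; exact h1.2
  have h3 : -(R / h) ≤ x i / h := by rw [← neg_div]; gcongr; exact h1.1
  have h4 := Int.le_ceil (R / h)
  rw [Finset.mem_Icc]
  constructor
  · rw [Int.le_floor]; push_cast; linarith
  · have : (⌊x i / h⌋ : ℝ) ≤ ((⌈R / h⌉ + 1 : ℤ) : ℝ) :=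
      (Int.floor_le _).trans (by push_cast; linarith)
    exact_mod_cast this

lemma integral_eq_sum_gridCell (hD : MeasurableSet D) {h : ℝ} (hh : 0 < h)
    {I : Finset (Fin d → ℤ)} (hI : D ⊆ ⋃ k ∈ I, gridCell h k) {f : Pt d → ℝ}
    (hf : Integrable f (volume.restrict D)) :
    ∫ x, f x ∂(volume.restrict D) = ∑ k ∈ I, ∫ x in gridCell h k, f x ∂(volume.restrict D) := by
  have hdisj : Set.Pairwise (I : Set (Fin d → ℤ)) (Function.onFun Disjoint (gridCell h)) := by
    intro k _ l _ hkl
    refine Set.disjoint_left.2 fun x hx hy => hkl ?_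
    ext i
    rw [← hx i, ← hy i]
  rw [← integral_biUnion_finset I (fun k _ => measurableSet_gridCell hh k) hdisj
    (fun k _ => hf.integrableOn), Measure.restrict_eq_self_of_ae_mem
    ((ae_restrict_mem hD).mono fun x hx => hI hx)]

lemma exists_cellFunctional [IsFiniteMeasure ((volume : Measure (Pt d)).restrict D)] {h : ℝ}
    (hh : 0 < h) (k : Fin d → ℤ) : ∃ f : H10 D →L[ℂ] ℂ, ∀ u, ‖f u‖ ^ 2 =
      (h ^ d)⁻¹ * ‖∫ x in gridCell h k, H10.val u x ∂(volume.restrict D)‖ ^ 2 := by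
  refine ⟨(((√(h ^ d))⁻¹ : ℝ) : ℂ) •
    (setIntegralL (volume.restrict D) (measurableSet_gridCell hh k)).comp (valL D), fun u => ?_⟩
  rw [← setIntegralL_apply (volume.restrict D) (measurableSet_gridCell hh k)]
  change ‖(((√(h ^ d))⁻¹ : ℝ) : ℂ) * setIntegralL (volume.restrict D)
    (measurableSet_gridCell hh k) (H10.val u)‖ ^ 2 = _
  rw [norm_mul, Complex.norm_real, mul_pow, Real.norm_eq_abs, sq_abs, inv_pow,
    Real.sq_sqrt (by positivity)]

/-- Rellich's theorem: the embedding of `H¹₀(D)` into `L²(D)` is compact. -/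
theorem isCompactOperator_valL (hd : 1 ≤ d) (hD : IsOpen D) (hb : Bornology.IsBounded D) :
    IsCompactOperator (valL D) := by
  have := isFiniteMeasure_restrict hb
  refine isCompactOperator_of_approx (ι := Fin d → ℤ) _ fun ε hε => ?_
  have hd0 : (0 : ℝ) < d := by exact_mod_cast hd
  obtain ⟨h, hh, hhε⟩ : ∃ h : ℝ, 0 < h ∧ (d * h) ^ 2 *
      ((d : ℝ) ^ d * volume.real (Metric.closedBall (0 : Pt d) 1)) ≤ ε ^ 2 := by
    have hW0 : 0 ≤ (d : ℝ) ^ d * volume.real (Metric.closedBall (0 : Pt d) 1) := by positivity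
    generalize (d : ℝ) ^ d * volume.real (Metric.closedBall (0 : Pt d) 1) = W at *
    -- With this mesh d h = ε/(W + 1), so (d h)² W ≤ ε²; the added 1 keeps the denominator positive.
    refine ⟨ε / (d * (W + 1)), by positivity, ?_⟩
    have e : (d * (ε / (d * (W + 1)))) = ε / (W + 1) := by field_simp
    rw [e, div_pow, div_mul_eq_mul_div, div_le_iff₀ (by positivity)]
    exact mul_le_mul_of_nonneg_left (by nlinarith) (sq_nonneg ε)
  obtain ⟨I, hI⟩ := exists_grid_cover hb hh
  choose f hf using fun k => exists_cellFunctional (D := D) hh k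
  -- The finitely many cell integrals are the functionals; summing the cell inequalities leaves an
  -- error ε²‖∇u‖².
  refine ⟨I, f, fun u => ?_⟩
  have e3 : ‖H10.grad u‖ ^ 2 ≤ ‖u‖ ^ 2 := by
    rw [H10.norm_sq u]; linarith [sq_nonneg ‖H10.val u‖]
  have e1 := integral_eq_sum_gridCell hD.measurableSet hh hI (integrable_norm_sq (H10.val u))
  have e2 := integral_eq_sum_gridCell hD.measurableSet hh hI (integrable_norm_sq (H10.grad u))
  rw [← norm_sq_eq_integral (H10.val u)] at e1
  rw [← norm_sq_eq_integral (H10.grad u)] at e2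
  have e4 := Finset.sum_le_sum fun k (_ : k ∈ I) => H10.setIntegral_gridCell_le hD hh hhε u k
  rw [Finset.sum_add_distrib, ← e1, ← Finset.mul_sum (a := ε ^ 2), ← e2] at e4
  simp only [hf]
  exact e4.trans (add_le_add_right (mul_le_mul_of_nonneg_left e3 (sq_nonneg ε)) _)

end Rellich

/-! ### Lax–Milgram and the compact solution operator -/

section LaxMilgram

variable {H : Type*} [NormedAddCommGroup H] [InnerProductSpace ℂ H] [CompleteSpace H]

/-- The Lax–Milgram theorem for a coercive operator on a complex Hilbert space. -/
theorem exists_right_inverse_of_coercive (A : H →L[ℂ] H) {c : ℝ} (hc : 0 < c)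
    (hA : ∀ u, c * ‖u‖ ^ 2 ≤ (inner ℂ u (A u)).re) :
    ∃ B : H →L[ℂ] H, ∀ f, A (B f) = f := by
  have hlow : ∀ u, ‖u‖ ≤ c⁻¹ * ‖A u‖ := by
    intro u
    rcases eq_or_ne u 0 with rfl | hu
    · simp
    have hu' : 0 < ‖u‖ := norm_pos_iff.2 hu
    have h1 := (hA u).trans ((Complex.re_le_norm _).trans (norm_inner_le_norm u (A u)))
    rw [le_inv_mul_iff₀ hc]
    nlinarith
  have hanti : AntilipschitzWith (Real.toNNReal c⁻¹) A :=
    AddMonoidHomClass.antilipschitz_of_bound A fun u => by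
      rw [Real.coe_toNNReal _ (inv_nonneg.2 hc.le)]; exact hlow u
  have hker : A.ker = ⊥ := LinearMap.ker_eq_bot.2 hanti.injective
  have hcl : IsClosed (A.range : Set H) := hanti.isClosed_range A.uniformContinuous
  have hran : A.range = ⊤ := by
    have := hcl.completeSpace_coe
    -- The range is closed by coercivity. A vector w orthogonal to it is orthogonal to A w, so
    -- coercivity gives w = 0.
    rw [← A.range.orthogonal_orthogonal]
    rw [Submodule.eq_top_iff']
    intro v w hw
    have h1 : inner ℂ w (A w) = 0 := by
      have := hw (A w) ⟨w, rfl⟩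
      rw [← inner_conj_symm, this, map_zero]
    have h2 := hA w
    rw [h1] at h2
    have h3 : ‖w‖ = 0 := by
      have : ‖w‖ ^ 2 ≤ 0 := by
        by_contra! h4
        have := mul_pos hc h4
        simp at h2; linarith
      exact pow_eq_zero_iff two_ne_zero |>.1 (le_antisymm this (sq_nonneg _))
    rw [norm_eq_zero.1 h3, inner_zero_left]
  let e := ContinuousLinearEquiv.ofBijective A hker hran
  exact ⟨e.symm, fun f => e.apply_symm_apply f⟩

/-- The solution operator of a coercive problem, as an operator on the pivot space. -/
lemma exists_solution_of_forms {K₁ K₂ : Type*} [NormedAddCommGroup K₁] [InnerProductSpace ℂ K₁]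
    [CompleteSpace K₁] [NormedAddCommGroup K₂] [InnerProductSpace ℂ K₂] [CompleteSpace K₂]
    (V : H →L[ℂ] K₁) (G : H →L[ℂ] K₂) (T₁ : K₂ →L[ℂ] K₂) (T₂ : K₂ →L[ℂ] K₁)
    (hV : IsCompactOperator V) {c : ℝ} (hc : 0 < c)
    (hA : ∀ u, c * ‖u‖ ^ 2 ≤ (inner ℂ (G u) (T₁ (G u)) + inner ℂ (V u) (T₂ (G u))).re) :
    ∃ T : K₁ →L[ℂ] K₁, IsCompactOperator T ∧ ∀ f, ∃ u : H, V u = T f ∧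
      ∀ v, inner ℂ (G v) (T₁ (G u)) + inner ℂ (V v) (T₂ (G u)) = inner ℂ (V v) f := by
  let A : H →L[ℂ] H := (ContinuousLinearMap.adjoint G).comp (T₁.comp G) +
    (ContinuousLinearMap.adjoint V).comp (T₂.comp G)
  have hAe : ∀ u v, inner ℂ v (A u) = inner ℂ (G v) (T₁ (G u)) + inner ℂ (V v) (T₂ (G u)) := by
    intro u v
    change inner ℂ v (ContinuousLinearMap.adjoint G (T₁ (G u)) +
      ContinuousLinearMap.adjoint V (T₂ (G u))) = _
    rw [inner_add_right, ContinuousLinearMap.adjoint_inner_right,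
      ContinuousLinearMap.adjoint_inner_right]
  obtain ⟨B, hB⟩ := exists_right_inverse_of_coercive A hc fun u => by rw [hAe]; exact hA u
  -- V* f represents the functional v ↦ ⟨V v, f⟩ up to conjugation, and the outer factor V supplies
  -- the compactness.
  refine ⟨V.comp (B.comp (ContinuousLinearMap.adjoint V)), hV.comp_clm _, fun f =>
    ⟨B (ContinuousLinearMap.adjoint V f), rfl, fun v => ?_⟩⟩
  rw [← hAe, hB, ContinuousLinearMap.adjoint_inner_right]

end LaxMilgram

/-! ### The sesquilinear forms: boundedness, skewness, coercivity -/

section Forms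

variable {d : ℕ} {D : Set (Pt d)}

/-- The coefficients `κ`, `b` of an operator `-∇·(κ∇u) + b·∇u` with `b` divergence free. -/
structure IsCoeff (D : Set (Pt d)) (κmin κmax M : ℝ) (κ : Pt d → ℝ) (b : Pt d → Pt d) : Prop where
  pos : 0 < κmin
  diff : IsDiffusion D κmin κmax κ
  nonneg : 0 ≤ M
  meas : AEStronglyMeasurable b (volume.restrict D)
  bound : ∀ᵐ x ∂(volume.restrict D), ‖b x‖ ≤ M
  div_free : ∀ φ : Pt d → ℝ, IsTestFunction D φ → ∫ x in D, fderiv ℝ φ x (b x) = 0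

/-- The sesquilinear form of `-∇·(κ∇u) + b·∇u`. -/
def form (κ : Pt d → ℝ) (b : Pt d → Pt d) (u v : H10 D) : ℂ := formA κ u v + formB b u v

variable {κmin κmax M : ℝ} {κ : Pt d → ℝ} {b : Pt d → Pt d}

lemma norm_sum_mul_le (v : Pt d) (g : EuclideanSpace ℂ (Fin d)) :
    ‖∑ i, (v i : ℂ) * g i‖ ≤ ‖v‖ * ‖g‖ := by
  have h := norm_inner_le_norm (𝕜 := ℂ)
    (WithLp.toLp 2 (fun i => (v i : ℂ)) : EuclideanSpace ℂ (Fin d)) g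
  have h1 : inner ℂ (WithLp.toLp 2 (fun i => (v i : ℂ)) : EuclideanSpace ℂ (Fin d)) g
      = ∑ i, (v i : ℂ) * g i := by
    rw [PiLp.inner_apply]
    refine Finset.sum_congr rfl fun i _ => ?_
    simp [mul_comm]
  have h2 : ‖(WithLp.toLp 2 (fun i => (v i : ℂ)) : EuclideanSpace ℂ (Fin d))‖ = ‖v‖ := by
    simp [EuclideanSpace.norm_eq]
  rwa [h1, h2] at h

lemma IsCoeff.exists_mulκ (h : IsCoeff D κmin κmax M κ b) :
    ∃ T : Lp (EuclideanSpace ℂ (Fin d)) 2 (volume.restrict D) →L[ℂ]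
      Lp (EuclideanSpace ℂ (Fin d)) 2 (volume.restrict D),
      ∀ f, T f =ᵐ[volume.restrict D] fun x => (κ x : ℂ) • f x := by
  refine exists_fieldMap
    (fun x => (κ x : ℂ) • ContinuousLinearMap.id ℂ (EuclideanSpace ℂ (Fin d))) |κmax|
    ((Complex.continuous_ofReal.comp_aestronglyMeasurable h.diff.meas).smul
      aestronglyMeasurable_const) (fun _ _ => rfl) (abs_nonneg _) ?_
  filter_upwards [h.diff.bounds] with x hx v
  rw [norm_smul, Complex.norm_real, Real.norm_eq_abs]
  have hp := h.pos
  exact mul_le_mul_of_nonneg_right (abs_le_abs_of_nonneg (by linarith) hx.2) (norm_nonneg _)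

/-- The bilinear pairing with a real vector. -/
def dotL (v : Pt d) : EuclideanSpace ℂ (Fin d) →L[ℂ] ℂ :=
  innerSL ℂ (WithLp.toLp 2 (fun i => (v i : ℂ)) : EuclideanSpace ℂ (Fin d))

lemma dotL_apply (v : Pt d) (g : EuclideanSpace ℂ (Fin d)) : dotL v g = ∑ i, (v i : ℂ) * g i := by
  rw [dotL, innerSL_apply_apply, PiLp.inner_apply]
  refine Finset.sum_congr rfl fun i _ => ?_
  simp [mul_comm]

lemma continuous_dotL : Continuous (dotL (d := d)) := by
  refine (innerSL ℂ).continuous.comp ((PiLp.continuous_toLp 2 _).comp (continuous_pi fun i => ?_))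
  exact Complex.continuous_ofReal.comp (EuclideanSpace.proj (𝕜 := ℝ) i).continuous

lemma IsCoeff.exists_dot (h : IsCoeff D κmin κmax M κ b) :
    ∃ T : Lp (EuclideanSpace ℂ (Fin d)) 2 (volume.restrict D) →L[ℂ] Lp ℂ 2 (volume.restrict D),
      ∀ f, T f =ᵐ[volume.restrict D] fun x => ∑ i, (b x i : ℂ) * f x i := by
  have hm : AEStronglyMeasurable (fun x => dotL (b x)) (volume.restrict D) :=
    continuous_dotL.comp_aestronglyMeasurable h.meas
  refine exists_fieldMap (E := EuclideanSpace ℂ (Fin d)) (F := ℂ)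
    (g := fun x v => ∑ i, (b x i : ℂ) * v i) (fun x => dotL (b x)) M hm
    (fun x v => dotL_apply _ _) h.nonneg ?_
  filter_upwards [h.bound] with x hx v
  exact (norm_sum_mul_le _ _).trans (mul_le_mul_of_nonneg_right hx (norm_nonneg _))

lemma formA_eq_inner {T : Lp (EuclideanSpace ℂ (Fin d)) 2 (volume.restrict D) →L[ℂ]
      Lp (EuclideanSpace ℂ (Fin d)) 2 (volume.restrict D)}
    (hT : ∀ f, T f =ᵐ[volume.restrict D] fun x => (κ x : ℂ) • f x) (u v : H10 D) :
    formA κ u v = inner ℂ (H10.grad v) (T (H10.grad u)) := by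
  rw [L2.inner_def, formA]
  refine integral_congr_ae ?_
  filter_upwards [hT (H10.grad u)] with x hx
  rw [hx, PiLp.inner_apply, Finset.mul_sum]
  refine Finset.sum_congr rfl fun i _ => ?_
  simp [mul_assoc]

lemma formB_eq_inner {T : Lp (EuclideanSpace ℂ (Fin d)) 2 (volume.restrict D) →L[ℂ]
      Lp ℂ 2 (volume.restrict D)}
    (hT : ∀ f, T f =ᵐ[volume.restrict D] fun x => ∑ i, (b x i : ℂ) * f x i) (u v : H10 D) :
    formB b u v = inner ℂ (H10.val v) (T (H10.grad u)) := by
  rw [L2.inner_def, formB]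
  refine integral_congr_ae ?_
  filter_upwards [hT (H10.grad u)] with x hx
  rw [hx]
  simp

lemma IsTestFunction.clm_comp {F G : Type*} [NormedAddCommGroup F] [NormedSpace ℝ F]
    [NormedAddCommGroup G] [NormedSpace ℝ G] {φ : Pt d → F} (h : IsTestFunction D φ)
    (L : F →L[ℝ] G) : IsTestFunction D (fun x => L (φ x)) :=
  ⟨L.contDiff.comp h.smooth, h.compact_support.comp_left (g := L) (map_zero L),
    (closure_mono (Function.support_comp_subset (map_zero L) φ)).trans h.support_subset⟩

lemma IsTestFunction.fderiv_clm_comp {F G : Type*} [NormedAddCommGroup F] [NormedSpace ℝ F]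
    [NormedAddCommGroup G] [NormedSpace ℝ G] {φ : Pt d → F} (h : IsTestFunction D φ)
    (L : F →L[ℝ] G) (x v : Pt d) : fderiv ℝ (fun x => L (φ x)) x v = L (fderiv ℝ φ x v) := by
  have := (L.hasFDerivAt.comp x (h.differentiable x).hasFDerivAt).fderiv
  change fderiv ℝ (L ∘ φ) x v = _
  rw [this]; rfl

lemma IsCoeff.integral_fderiv_eq_zero (h : IsCoeff D κmin κmax M κ b) {χ : Pt d → ℂ}
    (hχ : IsTestFunction D χ) (hi : Integrable (fun x => fderiv ℝ χ x (b x)) (volume.restrict D)) :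
    ∫ x in D, fderiv ℝ χ x (b x) = 0 := by
  apply Complex.ext
  · have h1 := Complex.reCLM.integral_comp_comm hi
    have h2 := h.div_free _ (hχ.clm_comp Complex.reCLM)
    simp only [hχ.fderiv_clm_comp Complex.reCLM] at h2
    rw [h2] at h1
    exact h1.symm
  · have h1 := Complex.imCLM.integral_comp_comm hi
    have h2 := h.div_free _ (hχ.clm_comp Complex.imCLM)
    simp only [hχ.fderiv_clm_comp Complex.imCLM] at h2
    rw [h2] at h1
    exact h1.symm

lemma IsTestFunction.mul {φ ψ : Pt d → ℂ} (hφ : IsTestFunction D φ) (hψ : IsTestFunction D ψ) :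
    IsTestFunction D (fun x => φ x * ψ x) :=
  ⟨hφ.smooth.mul hψ.smooth, hφ.compact_support.mul_right,
    tsupport_mul_subset_left.trans hφ.support_subset⟩

/-- For test functions the two sides differ by the integral of b·∇(u v̄), which vanishes because b
is divergence free. Continuity in each argument separately extends this to H¹₀. -/
lemma IsCoeff.formB_skew (h : IsCoeff D κmin κmax M κ b) (u v : H10 D) :
    formB b u v = -(starRingEnd ℂ) (formB b v u) := by
  obtain ⟨T, hT⟩ := h.exists_dot
  have cont1 : ∀ v : H10 D, Continuous fun u => formB b u v := fun v => by
    simp only [formB_eq_inner hT]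
    exact continuous_const.inner (T.continuous.comp continuous_grad)
  have cont2 : ∀ u : H10 D, Continuous fun v => formB b u v := fun u => by
    simp only [formB_eq_inner hT]
    exact continuous_val.inner continuous_const
  induction u using H10.induction with
  | hc => exact isClosed_eq (cont1 v) (Complex.continuous_conj.comp (cont2 v)).neg
  | ht φ u hφ h1 h2 =>
  induction v using H10.induction with
  | hc => exact isClosed_eq (cont2 u) (Complex.continuous_conj.comp (cont1 u)).neg
  | ht ψ v hψ h3 h4 =>
    have hχ := hφ.mul (hψ.clm_comp Complex.conjCLE.toContinuousLinearMap)
    set χ : Pt d → ℂ := fun x => φ x * Complex.conjCLE.toContinuousLinearMap (ψ x) with hχdef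
    have i1 := L2.integrable_inner (𝕜 := ℂ) (H10.val v) (T (H10.grad u))
    have i2 := L2.integrable_inner (𝕜 := ℂ) (T (H10.grad v)) (H10.val u)
    have hpt : ∀ᵐ x ∂(volume.restrict D), fderiv ℝ χ x (b x) =
        inner ℂ (H10.val v x) (T (H10.grad u) x) + inner ℂ (T (H10.grad v) x) (H10.val u x) := by
      filter_upwards [h1, h2, h3, h4, hT (H10.grad u), hT (H10.grad v)] with x e1 e2 e3 e4 e5 e6
      rw [e1, e3, e5, e6, e2, e4, hχdef, fderiv_fun_mul (hφ.differentiable x)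
        ((hψ.clm_comp Complex.conjCLE.toContinuousLinearMap).differentiable x)]
      simp only [add_apply, smul_apply, smul_eq_mul]
      rw [hψ.fderiv_clm_comp, fderiv_apply_eq_sum, fderiv_apply_eq_sum]
      simp only [cgrad, RCLike.inner_apply, map_sum, map_mul, Complex.conj_ofReal,
        Complex.real_smul]
      simp
      ring
    have hi : Integrable (fun x => fderiv ℝ χ x (b x)) (volume.restrict D) :=
      (i1.add i2).congr (hpt.mono fun x hx => hx.symm)
    have h0 := h.integral_fderiv_eq_zero hχ hi
    rw [integral_congr_ae hpt, integral_add i1 i2, ← L2.inner_def, ← L2.inner_def] at h0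
    rw [formB_eq_inner hT, formB_eq_inner hT, inner_conj_symm]
    exact eq_neg_of_add_eq_zero_left h0

lemma IsCoeff.re_formB_self (h : IsCoeff D κmin κmax M κ b) (u : H10 D) :
    (formB b u u).re = 0 := by
  have := congrArg Complex.re (h.formB_skew u u)
  simp at this
  linarith

lemma IsCoeff.norm_formB_le (h : IsCoeff D κmin κmax M κ b) (u v : H10 D) :
    ‖formB b u v‖ ≤ M * ‖H10.grad u‖ * ‖H10.val v‖ := by
  obtain ⟨T, hT⟩ := h.exists_dot
  rw [formB_eq_inner hT]
  refine (norm_inner_le_norm _ _).trans ?_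
  rw [mul_comm]
  refine mul_le_mul_of_nonneg_right (Lp.norm_le_mul_norm_of_ae_le_mul ?_) (norm_nonneg _)
  filter_upwards [hT (H10.grad u), h.bound] with x e1 e2
  rw [e1]
  exact (norm_sum_mul_le _ _).trans (mul_le_mul_of_nonneg_right e2 (norm_nonneg _))

lemma formA_conj (κ : Pt d → ℝ) (u v : H10 D) :
    formA κ u v = (starRingEnd ℂ) (formA κ v u) := by
  rw [formA, formA, ← integral_conj]
  refine integral_congr_ae (Eventually.of_forall fun x => ?_)
  simp only [map_mul, map_sum, Complex.conj_ofReal, Complex.conj_conj]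
  simp only [mul_comm]

/-- The integrand of the real part of the form. -/
def formDensity (κ : Pt d → ℝ) (b : Pt d → Pt d) (u v : H10 D) (x : Pt d) : ℝ :=
  κ x * (inner ℂ (H10.grad v x) (H10.grad u x) : ℂ).re +
    ((∑ i, (b x i : ℂ) * H10.grad u x i) * (starRingEnd ℂ) (H10.val v x)).re

lemma IsCoeff.integrable_formDensity (h : IsCoeff D κmin κmax M κ b) (u v : H10 D) :
    Integrable (formDensity κ b u v) (volume.restrict D) ∧
      (form κ b u v).re = ∫ x in D, formDensity κ b u v x := by
  obtain ⟨T1, hT1⟩ := h.exists_mulκ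
  obtain ⟨T2, hT2⟩ := h.exists_dot
  have i1 := L2.integrable_inner (𝕜 := ℂ) (H10.grad v) (T1 (H10.grad u))
  have i2 := L2.integrable_inner (𝕜 := ℂ) (H10.val v) (T2 (H10.grad u))
  have hpt : ∀ᵐ x ∂(volume.restrict D), (inner ℂ (H10.grad v x) (T1 (H10.grad u) x) +
      inner ℂ (H10.val v x) (T2 (H10.grad u) x) : ℂ).re = formDensity κ b u v x := by
    filter_upwards [hT1 (H10.grad u), hT2 (H10.grad u)] with x e1 e2
    rw [e1, e2, inner_smul_right, Complex.add_re, Complex.re_ofReal_mul, formDensity,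
      RCLike.inner_apply]
  refine ⟨(i1.add i2).re.congr hpt, ?_⟩
  rw [form, formA_eq_inner hT1, formB_eq_inner hT2, L2.inner_def, L2.inner_def,
    ← integral_add i1 i2, ← integral_congr_ae hpt]
  exact (Complex.reCLM.integral_comp_comm (i1.add i2)).symm

lemma IsCoeff.form_self_ge (h : IsCoeff D κmin κmax M κ b) (u : H10 D) :
    κmin * ‖H10.grad u‖ ^ 2 ≤ (formA κ u u).re := by
  obtain ⟨T1, hT1⟩ := h.exists_mulκ
  have i1 := L2.integrable_inner (𝕜 := ℂ) (H10.grad u) (T1 (H10.grad u))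
  have e := (Complex.reCLM.integral_comp_comm i1)
  rw [formA_eq_inner hT1, L2.inner_def, norm_sq_eq_integral, ← integral_const_mul]
  refine le_trans (integral_mono_ae ((integrable_norm_sq _).const_mul _) i1.re ?_) e.le
  filter_upwards [hT1 (H10.grad u), h.diff.bounds] with x e1 e2
  rw [e1, inner_smul_right, inner_self_eq_norm_sq_to_K]
  have : (RCLike.re ((κ x : ℂ) * ((‖H10.grad u x‖ : ℝ) : ℂ) ^ 2)) = κ x * ‖H10.grad u x‖ ^ 2 := by
    rw [← Complex.ofReal_pow, ← Complex.ofReal_mul]; rfl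
  exact (mul_le_mul_of_nonneg_right e2.1 (sq_nonneg _)).trans this.ge

/-- The solution operator of the source problem. -/
theorem IsCoeff.exists_solution (h : IsCoeff D κmin κmax M κ b) (hd : 1 ≤ d) (hD : IsOpen D)
    (hb : Bornology.IsBounded D) :
    ∃ T : Lp ℂ 2 (volume.restrict D) →L[ℂ] Lp ℂ 2 (volume.restrict D), IsCompactOperator T ∧
      ∀ f, ∃ u : H10 D, H10.val u = T f ∧ ∀ v, form κ b u v = inner ℂ (H10.val v) f := by
  obtain ⟨T1, hT1⟩ := h.exists_mulκ
  obtain ⟨T2, hT2⟩ := h.exists_dot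
  obtain ⟨P, hP0, hP⟩ := H10.exists_poincare hd hD hb
  have hk := h.pos
  have hform : ∀ u v : H10 D, form κ b u v = inner ℂ (gradL D v) (T1 (gradL D u)) +
      inner ℂ (valL D v) (T2 (gradL D u)) := fun u v => by
    rw [form, formA_eq_inner hT1, formB_eq_inner hT2]; rfl
  simp only [hform]
  -- The drift has no real part on the diagonal, so coercivity comes from κ alone; Poincaré turns
  -- the gradient norm into the H¹ norm at the cost of the factor P + 1.
  exact exists_solution_of_forms (valL D) (gradL D) T1 T2 (isCompactOperator_valL hd hD hb)
    (c := κmin / (P + 1)) (by positivity) (fun u => by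
      rw [← hform, form, Complex.add_re, h.re_formB_self, add_zero]
      refine le_trans ?_ (h.form_self_ge u)
      rw [H10.norm_sq, div_mul_eq_mul_div, div_le_iff₀ (by positivity), mul_assoc]
      refine mul_le_mul_of_nonneg_left ?_ hk.le
      linarith [hP u])

end Forms

/-! ### The cone of nonnegative functions in L² -/

section Cone

variable {X : Type*} [MeasurableSpace X] {μ : Measure X}

/-- The cone of nonnegative functions in `L²`. -/
def posCone (μ : Measure X) : Set (Lp ℂ 2 μ) := {f | ∀ᵐ x ∂μ, 0 ≤ (f x).re ∧ (f x).im = 0}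

lemma exists_toLp_of_norm_le {f : Lp ℂ 2 μ} {g : ℂ → ℂ} (hg : Continuous g)
    (h : ∀ z, ‖g z‖ ≤ ‖z‖) : ∃ p : Lp ℂ 2 μ, (p =ᵐ[μ] fun x => g (f x)) ∧ ‖p‖ ≤ ‖f‖ := by
  have hm : MemLp (fun x => g (f x)) 2 μ := (Lp.memLp f).of_le
    (hg.comp_aestronglyMeasurable (Lp.memLp f).1) (Eventually.of_forall fun x => h _)
  refine ⟨hm.toLp _, hm.coeFn_toLp, Lp.norm_le_norm_of_ae_le ?_⟩
  filter_upwards [hm.coeFn_toLp] with x hx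
  rw [hx]; exact h _

lemma isClosed_posCone : IsClosed (posCone μ) := by
  refine IsSeqClosed.isClosed fun f g hf hg => ?_
  obtain ⟨ns, -, hae⟩ := (tendstoInMeasure_of_tendsto_Lp hg).exists_seq_tendsto_ae
  filter_upwards [hae, ae_all_iff.2 hf] with x h1 h2
  exact ⟨ge_of_tendsto ((Complex.continuous_re.tendsto _).comp h1)
    (Eventually.of_forall fun n => (h2 (ns n)).1),
    tendsto_nhds_unique ((Complex.continuous_im.tendsto _).comp h1)
      (tendsto_const_nhds.congr fun n => ((h2 (ns n)).2).symm)⟩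

lemma isGenCone_posCone : IsGenCone (posCone μ) where
  closed := isClosed_posCone
  zero := by
    filter_upwards [Lp.coeFn_zero ℂ 2 μ] with x hx
    rw [hx]; simp
  add f hf g hg := by
    change ∀ᵐ x ∂μ, 0 ≤ ((f + g : Lp ℂ 2 μ) x).re ∧ ((f + g : Lp ℂ 2 μ) x).im = 0
    filter_upwards [Lp.coeFn_add f g, hf, hg] with x hx h1 h2
    rw [hx]
    simp only [Pi.add_apply, Complex.add_re, Complex.add_im]
    exact ⟨add_nonneg h1.1 h2.1, by rw [h1.2, h2.2, add_zero]⟩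
  smul c hc f hf := by
    change ∀ᵐ x ∂μ, 0 ≤ (((c : ℂ) • f : Lp ℂ 2 μ) x).re ∧ (((c : ℂ) • f : Lp ℂ 2 μ) x).im = 0
    filter_upwards [Lp.coeFn_smul (c : ℂ) f, hf] with x hx h1
    rw [hx]
    simp only [Pi.smul_apply, smul_eq_mul, Complex.re_ofReal_mul, Complex.im_ofReal_mul]
    exact ⟨mul_nonneg hc h1.1, by rw [h1.2, mul_zero]⟩
  salient f hf hf' := by
    ext1
    filter_upwards [Lp.coeFn_neg f, Lp.coeFn_zero ℂ 2 μ, hf, hf'] with x hx h0 h1 h2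
    rw [h0]
    rw [hx] at h2
    simp only [Pi.neg_apply, Complex.neg_re, Complex.neg_im] at h2
    exact Complex.ext (by simp; linarith [h1.1, h2.1]) h1.2
  gen f := by
    -- The four generators are the positive and negative parts of the real and the imaginary part.
    have hmax : ∀ (t : ℂ → ℝ), Continuous t → (∀ z, |t z| ≤ ‖z‖) →
        ∃ p : Lp ℂ 2 μ, (p =ᵐ[μ] fun x => ((max (t (f x)) 0 : ℝ) : ℂ)) ∧ ‖p‖ ≤ ‖f‖ := by
      intro t ht hn
      refine exists_toLp_of_norm_le (g := fun z => ((max (t z) 0 : ℝ) : ℂ))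
        (Complex.continuous_ofReal.comp (ht.max continuous_const)) fun z => ?_
      rw [Complex.norm_real, Real.norm_eq_abs]
      refine le_trans ?_ (hn z)
      rw [abs_of_nonneg (le_max_right _ _)]
      exact max_le (le_abs_self _) (abs_nonneg _)
    obtain ⟨p, hp, np⟩ := hmax _ Complex.continuous_re Complex.abs_re_le_norm
    obtain ⟨q, hq, nq⟩ := hmax (fun z => -z.re) Complex.continuous_re.neg
      (fun z => by rw [abs_neg]; exact Complex.abs_re_le_norm z)
    obtain ⟨r, hr, nr⟩ := hmax _ Complex.continuous_im Complex.abs_im_le_norm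
    obtain ⟨s, hs, ns⟩ := hmax (fun z => -z.im) Complex.continuous_im.neg
      (fun z => by rw [abs_neg]; exact Complex.abs_im_le_norm z)
    have hmem : ∀ {g : Lp ℂ 2 μ} {t : X → ℝ}, (g =ᵐ[μ] fun x => ((max (t x) 0 : ℝ) : ℂ)) →
        g ∈ posCone μ := fun h => by
      filter_upwards [h] with x hx
      rw [hx]; simp
    refine ⟨p, q, r, s, hmem hp, hmem hq, hmem hr, hmem hs, np, nq, nr, ns, ?_⟩
    ext1
    filter_upwards [Lp.coeFn_add (p - q) (Complex.I • (r - s)), Lp.coeFn_sub p q,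
      Lp.coeFn_sub r s, Lp.coeFn_smul Complex.I (r - s), hp, hq, hr, hs]
      with x e1 e2 e3 e4 e5 e6 e7 e8
    rw [e1, Pi.add_apply, e2, e4, Pi.sub_apply, Pi.smul_apply, e3, Pi.sub_apply, e5, e6, e7, e8]
    have key : ∀ y : ℝ, max y 0 - max (-y) 0 = y := fun y => by
      rcases le_total 0 y with h | h
      · rw [max_eq_left h, max_eq_right (by linarith)]; ring
      · rw [max_eq_right h, max_eq_left (by linarith)]; ring
    apply Complex.ext
    · simp [key]
    · simp [key]

end Cone

/-! ### Negative part, modulus and the weak maximum principle -/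

section Lattice

variable {d : ℕ} {D : Set (Pt d)}

/-- The real part, as a real-linear map into `ℂ`. -/
def reProj : ℂ →L[ℝ] ℂ := Complex.ofRealCLM.comp Complex.reCLM

@[simp] lemma reProj_apply (z : ℂ) : reProj z = (z.re : ℂ) := rfl

lemma norm_reProj_le : ‖reProj‖ ≤ 1 :=
  reProj.opNorm_le_bound zero_le_one fun z => by
    rw [reProj_apply, Complex.norm_real, one_mul]; exact Complex.abs_re_le_norm z

lemma contDiff_comp_re {g : ℝ → ℝ} (hg : ContDiff ℝ ((⊤ : ℕ∞) : WithTop ℕ∞) g) :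
    ContDiff ℝ ((⊤ : ℕ∞) : WithTop ℕ∞) fun z : ℂ => (g z.re : ℂ) :=
  Complex.ofRealCLM.contDiff.comp (hg.comp Complex.reCLM.contDiff)

lemma fderiv_comp_re {g : ℝ → ℝ} {z : ℂ} {g' : ℝ} (hg : HasDerivAt g g' z.re) :
    fderiv ℝ (fun z : ℂ => (g z.re : ℂ)) z = g' • reProj := by
  have h1 := Complex.ofRealCLM.hasFDerivAt.comp z
    (hg.hasFDerivAt.comp z Complex.reCLM.hasFDerivAt)
  refine (HasFDerivAt.fderiv (f := fun z : ℂ => (g z.re : ℂ)) h1).trans ?_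
  ext; simp [mul_comm]

lemma norm_fderiv_comp_re_le {g : ℝ → ℝ} {L : ℝ} {z : ℂ} {g' : ℝ} (hg : HasDerivAt g g' z.re)
    (hL : |g'| ≤ L) : ‖fderiv ℝ (fun z : ℂ => (g z.re : ℂ)) z‖ ≤ L := by
  rw [fderiv_comp_re hg, norm_smul, Real.norm_eq_abs]
  exact (mul_le_of_le_one_right (abs_nonneg _) norm_reProj_le).trans hL

/-- The componentwise real part. -/
def reVec (g : EuclideanSpace ℂ (Fin d)) : Pt d := WithLp.toLp 2 fun i => (g i).re

@[simp] lemma reVec_apply (g : EuclideanSpace ℂ (Fin d)) (i : Fin d) : reVec g i = (g i).re := rfl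

/-- The inclusion of `ℝ^d` in `ℂ^d`. -/
def ofRealVec (p : Pt d) : EuclideanSpace ℂ (Fin d) := WithLp.toLp 2 fun i => (p i : ℂ)

@[simp] lemma ofRealVec_apply (p : Pt d) (i : Fin d) : ofRealVec p i = (p i : ℂ) := rfl

lemma norm_ofRealVec (p : Pt d) : ‖ofRealVec p‖ = ‖p‖ := by
  simp [EuclideanSpace.norm_eq]

lemma re_inner_ofRealVec (p : Pt d) (g : EuclideanSpace ℂ (Fin d)) :
    (inner ℂ (ofRealVec p) g : ℂ).re = inner ℝ p (reVec g) := by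
  simp [PiLp.inner_apply, mul_comm]

lemma re_sum_mul (v : Pt d) (g : EuclideanSpace ℂ (Fin d)) :
    (∑ i, (v i : ℂ) * g i).re = inner ℝ v (reVec g) := by
  simp [PiLp.inner_apply, mul_comm]

lemma reVec_ofRealVec (p : Pt d) : reVec (ofRealVec p) = p := by ext i; simp

lemma mapVec_smul_reProj (c : ℝ) (g : EuclideanSpace ℂ (Fin d)) :
    mapVec (c • reProj) g = ofRealVec (c • reVec g) := by
  ext i; simp

/-- Composition of the real part with a smooth real function. -/
theorem H10.exists_comp_re (u : H10 D) {g g' : ℝ → ℝ}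
    (hg : ContDiff ℝ ((⊤ : ℕ∞) : WithTop ℕ∞) g) (hg' : ∀ x, HasDerivAt g (g' x) x)
    (g0 : g 0 = 0) {L : ℝ} (hL : ∀ x, |g' x| ≤ L) :
    ∃ w : H10 D, H10.val w =ᵐ[volume.restrict D] (fun x => (g (H10.val u x).re : ℂ)) ∧
      H10.grad w =ᵐ[volume.restrict D]
        fun x => ofRealVec (g' (H10.val u x).re • reVec (H10.grad u x)) := by
  obtain ⟨w, h1, h2⟩ := H10.exists_comp u (contDiff_comp_re hg) (by simp [g0])
    (L := L) (fun z => norm_fderiv_comp_re_le (hg' _) (hL _))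
  refine ⟨w, h1, h2.trans (Eventually.of_forall fun x => ?_)⟩
  dsimp only
  rw [fderiv_comp_re (hg' _), mapVec_smul_reProj]

lemma hasDerivAt_sqrt_add {ε : ℝ} (hε : 0 < ε) (x : ℝ) :
    HasDerivAt (fun x => √(x ^ 2 + ε ^ 2)) (x / √(x ^ 2 + ε ^ 2)) x := by
  have h : HasDerivAt (fun x : ℝ => x ^ 2 + ε ^ 2) (2 * x) x := by
    simpa using (hasDerivAt_pow 2 x).add_const (ε ^ 2)
  have hp : x ^ 2 + ε ^ 2 ≠ 0 := by positivity
  convert h.sqrt hp using 1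
  field_simp

lemma contDiff_sqrt_add {ε : ℝ} (hε : 0 < ε) :
    ContDiff ℝ ((⊤ : ℕ∞) : WithTop ℕ∞) (fun x : ℝ => √(x ^ 2 + ε ^ 2)) :=
  ContDiff.sqrt (by fun_prop) fun x => by positivity

lemma tendsto_sqrt_add (y : ℝ) :
    Tendsto (fun n : ℕ => √(y ^ 2 + ((n : ℝ) + 1)⁻¹ ^ 2)) atTop (𝓝 |y|) := by
  have h0 : Tendsto (fun n : ℕ => ((n : ℝ) + 1)⁻¹) atTop (𝓝 0) :=
    tendsto_inv_atTop_zero.comp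
      (tendsto_atTop_add_const_right _ _ tendsto_natCast_atTop_atTop)
  have := ((h0.pow 2).const_add (y ^ 2)).sqrt
  simpa [Real.sqrt_sq_eq_abs] using this

lemma tendsto_div_sqrt_add (y : ℝ) :
    Tendsto (fun n : ℕ => y / √(y ^ 2 + ((n : ℝ) + 1)⁻¹ ^ 2)) atTop (𝓝 (y / |y|)) := by
  rcases eq_or_ne y 0 with rfl | hy
  · simp
  · exact tendsto_const_nhds.div (tendsto_sqrt_add y) (abs_ne_zero.2 hy)

lemma abs_div_sqrt_add_le (x ε : ℝ) : |x / √(x ^ 2 + ε ^ 2)| ≤ 1 := by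
  rw [abs_div, abs_of_nonneg (Real.sqrt_nonneg _)]
  refine div_le_one_of_le₀ ?_ (Real.sqrt_nonneg _)
  exact Real.abs_le_sqrt (by nlinarith [sq_nonneg ε])

/-- The negative part of the real part. -/
theorem H10.exists_negPart (u : H10 D) :
    ∃ w : H10 D, H10.val w =ᵐ[volume.restrict D]
        (fun x => (((|(H10.val u x).re| - (H10.val u x).re) / 2 : ℝ) : ℂ)) ∧
      H10.grad w =ᵐ[volume.restrict D] fun x => ofRealVec
        ((((H10.val u x).re / |(H10.val u x).re| - 1) / 2) • reVec (H10.grad u x)) := by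
  set g : ℕ → ℝ → ℝ := fun n x => (√(x ^ 2 + ((n : ℝ) + 1)⁻¹ ^ 2) - ((n : ℝ) + 1)⁻¹ - x) / 2
  have hn : ∀ n : ℕ, 0 < ((n : ℝ) + 1)⁻¹ := fun n => by positivity
  have hg' : ∀ n x, HasDerivAt (g n) ((x / √(x ^ 2 + ((n : ℝ) + 1)⁻¹ ^ 2) - 1) / 2) x := fun n x =>
    (((hasDerivAt_sqrt_add (hn n) x).sub_const _).sub (hasDerivAt_id x)).div_const 2
  -- Smoothing |y| by √(y² + η²) - η keeps the value 0 at 0. Where y = 0 the limiting derivative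
  -- comes out as -1/2, matching the convention y / |y| = 0; that ∇u vanishes there almost
  -- everywhere is never used.
  obtain ⟨w, h1, h2⟩ := H10.exists_comp_of_tendsto u (F := fun n z => (g n z.re : ℂ))
    (f := fun z => (((|z.re| - z.re) / 2 : ℝ) : ℂ))
    (G := fun z => ((z.re / |z.re| - 1) / 2) • reProj) (L := 1)
    (fun n => contDiff_comp_re
      ((((contDiff_sqrt_add (hn n)).sub contDiff_const).sub contDiff_id).div_const 2))
    (fun n => by
      simp only [g, Complex.zero_re]
      rw [zero_pow two_ne_zero, zero_add, Real.sqrt_sq (hn n).le]; simp)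
    (fun n z => norm_fderiv_comp_re_le (hg' n _) (by
      have := abs_le.1 (abs_div_sqrt_add_le z.re ((n : ℝ) + 1)⁻¹)
      rw [abs_le]; constructor <;> linarith))
    (fun z => by
      have h0 : Tendsto (fun n : ℕ => ((n : ℝ) + 1)⁻¹) atTop (𝓝 0) :=
        tendsto_inv_atTop_zero.comp
          (tendsto_atTop_add_const_right _ _ tendsto_natCast_atTop_atTop)
      have h3 := (((tendsto_sqrt_add z.re).sub h0).sub_const z.re).div_const 2
      rw [sub_zero] at h3
      exact (Complex.continuous_ofReal.tendsto _).comp h3)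
    (fun z => by
      simp only [fun n => fderiv_comp_re (hg' n z.re)]
      exact (((tendsto_div_sqrt_add z.re).sub_const 1).div_const 2).smul_const reProj)
  refine ⟨w, h1, h2.trans (Eventually.of_forall fun x => ?_)⟩
  dsimp only
  rw [mapVec_smul_reProj]

/-- The modulus. -/
theorem H10.exists_abs (u : H10 D) :
    ∃ w : H10 D, H10.val w =ᵐ[volume.restrict D] (fun x => (‖H10.val u x‖ : ℂ)) ∧
      ∀ᵐ x ∂(volume.restrict D), ‖H10.grad w x‖ ≤ ‖H10.grad u x‖ := by
  have hn : ∀ n : ℕ, 0 < ((n : ℝ) + 1)⁻¹ := fun n => by positivity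
  set Λ : ℂ → ℂ →L[ℝ] ℂ := fun z => Complex.ofRealCLM.comp (innerSL ℝ z) with hΛ
  have hΛn : ∀ z, ‖Λ z‖ ≤ ‖z‖ := fun z => by
    refine (Λ z).opNorm_le_bound (norm_nonneg _) fun w => ?_
    simp only [hΛ, ContinuousLinearMap.comp_apply, Complex.ofRealCLM_apply, Complex.norm_real]
    exact norm_inner_le_norm z w
  set F : ℕ → ℂ → ℂ := fun n z =>
    ((√(‖z‖ ^ 2 + ((n : ℝ) + 1)⁻¹ ^ 2) - ((n : ℝ) + 1)⁻¹ : ℝ) : ℂ) with hF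
  have hF' : ∀ n z, fderiv ℝ (F n) z = (1 / √(‖z‖ ^ 2 + ((n : ℝ) + 1)⁻¹ ^ 2)) • Λ z := by
    intro n z
    have h1 : HasFDerivAt (fun z : ℂ => ‖z‖ ^ 2 + ((n : ℝ) + 1)⁻¹ ^ 2) (2 • innerSL ℝ z) z :=
      ((hasStrictFDerivAt_norm_sq z).hasFDerivAt).add_const _
    have hp : ‖z‖ ^ 2 + ((n : ℝ) + 1)⁻¹ ^ 2 ≠ 0 := by have := hn n; positivity
    have h2 := (h1.sqrt hp).sub_const (((n : ℝ) + 1)⁻¹)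
    have h3 := Complex.ofRealCLM.hasFDerivAt.comp z h2
    refine (HasFDerivAt.fderiv (f := F n) h3).trans ?_
    have e : ∀ w, (Complex.ofRealCLM.comp ((1 / (2 * √(‖z‖ ^ 2 + ((n : ℝ) + 1)⁻¹ ^ 2))) •
        2 • innerSL ℝ z)) w = ((1 / √(‖z‖ ^ 2 + ((n : ℝ) + 1)⁻¹ ^ 2)) • Λ z) w := by
      intro w
      simp [hΛ]
      ring
    exact ContinuousLinearMap.ext e
  have hbound : ∀ (r : ℝ) (z : ℂ), ‖z‖ ≤ r → ‖(1 / r) • Λ z‖ ≤ 1 := by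
    intro r z hr
    have hr0 : 0 ≤ r := (norm_nonneg z).trans hr
    rw [norm_smul, Real.norm_of_nonneg (by positivity), one_div, ← div_eq_inv_mul]
    exact div_le_one_of_le₀ ((hΛn z).trans hr) hr0
  obtain ⟨w, h1, h2⟩ := H10.exists_comp_of_tendsto u (F := F) (f := fun z => (‖z‖ : ℂ))
    (G := fun z => (1 / ‖z‖) • Λ z) (L := 1)
    (fun n => Complex.ofRealCLM.contDiff.comp
      ((ContDiff.sqrt ((contDiff_norm_sq ℝ).add contDiff_const) fun z => by
        have := hn n; positivity).sub contDiff_const))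
    (fun n => by
      simp only [F, norm_zero]
      rw [zero_pow two_ne_zero, zero_add, Real.sqrt_sq (hn n).le]; simp)
    (fun n z => by
      rw [hF']
      exact hbound _ _ (Real.le_sqrt_of_sq_le (by nlinarith [sq_nonneg ((n : ℝ) + 1)⁻¹])))
    (fun z => by
      have h0 : Tendsto (fun n : ℕ => ((n : ℝ) + 1)⁻¹) atTop (𝓝 0) :=
        tendsto_inv_atTop_zero.comp
          (tendsto_atTop_add_const_right _ _ tendsto_natCast_atTop_atTop)
      have h3 := (tendsto_sqrt_add ‖z‖).sub h0
      rw [sub_zero, abs_norm] at h3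
      exact (Complex.continuous_ofReal.tendsto _).comp h3)
    (fun z => by
      simp only [hF']
      rcases eq_or_ne z 0 with rfl | hz
      · have h4 : ∀ c : ℝ, c • Λ 0 = 0 := fun c => by
          refine ContinuousLinearMap.ext fun w => ?_
          simp [hΛ]
        simp only [h4]
        exact tendsto_const_nhds
      · have h3 := tendsto_sqrt_add ‖z‖
        rw [abs_norm] at h3
        exact ((tendsto_const_nhds (x := (1 : ℝ))).div h3 (norm_ne_zero_iff.2 hz)).smul_const _)
  refine ⟨w, h1, ?_⟩
  filter_upwards [h2] with x hx
  rw [hx]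
  refine (norm_mapVec_le _ _).trans (mul_le_of_le_one_left (norm_nonneg _) ?_)
  exact hbound _ _ le_rfl

variable {κmin κmax M : ℝ} {κ : Pt d → ℝ} {b : Pt d → Pt d}

/-- The weak maximum principle. -/
theorem IsCoeff.re_nonneg (h : IsCoeff D κmin κmax M κ b) (hd : 1 ≤ d) (hD : IsOpen D)
    (hb : Bornology.IsBounded D) {u : H10 D}
    (hu : ∀ v : H10 D, IsNonneg v → 0 ≤ (form κ b u v).re) :
    ∀ᵐ x ∂(volume.restrict D), 0 ≤ (H10.val u x).re := by
  obtain ⟨P, hP0, hP⟩ := H10.exists_poincare hd hD hb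
  obtain ⟨v, hv1, hv2⟩ := H10.exists_negPart u
  have hvn : IsNonneg v := by
    filter_upwards [hv1] with x hx
    rw [hx, Complex.ofReal_re, Complex.ofReal_im]
    exact ⟨by linarith [le_abs_self (H10.val u x).re], rfl⟩
  obtain ⟨i1, e1⟩ := h.integrable_formDensity u v
  obtain ⟨i2, e2⟩ := h.integrable_formDensity v v
  -- With v the negative part of Re u, the two densities are opposite where Re u < 0, and both
  -- vanish where Re u > 0. Where Re u = 0 the drift terms vanish and the gradient of v is -½∇Re u,
  -- so the claim reads -κq/2 ≤ -κq/4.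
  have hle : (form κ b u v).re ≤ -(form κ b v v).re := by
    rw [e1, e2, ← integral_neg]
    refine integral_mono_ae i1 i2.neg ?_
    filter_upwards [hv1, hv2, h.diff.bounds] with x h1 h2 h3
    have hκ := h.pos
    simp only [formDensity]
    rw [h1, h2, re_inner_ofRealVec, re_inner_ofRealVec, reVec_ofRealVec, Complex.conj_ofReal,
      Complex.re_mul_ofReal, Complex.re_mul_ofReal, re_sum_mul, re_sum_mul, reVec_ofRealVec]
    set y := (H10.val u x).re
    set p := reVec (H10.grad u x)
    rw [inner_smul_left, inner_smul_right, inner_smul_left, inner_smul_right]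
    simp only [conj_trivial]
    have hp : 0 ≤ inner ℝ p p := real_inner_self_nonneg
    generalize inner ℝ p p = q at *
    generalize inner ℝ (b x) p = s at *
    have hq : 0 ≤ κ x * q := mul_nonneg (by linarith) hp
    rcases lt_trichotomy y 0 with hy | hy | hy
    · rw [abs_of_neg hy, div_neg, div_self hy.ne]
      nlinarith
    · rw [hy]; norm_num; nlinarith
    · rw [abs_of_pos hy, div_self hy.ne']
      simp
  have h3 := h.form_self_ge v
  have h4 : (form κ b v v).re = (formA κ v v).re := by
    rw [form, Complex.add_re, h.re_formB_self, add_zero]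
  have h5 := hu v hvn
  have h6 : ‖H10.grad v‖ ^ 2 ≤ 0 := by
    have hκ := h.pos
    by_contra! h7
    nlinarith [mul_pos hκ h7]
  have h7 : ‖H10.val v‖ ^ 2 ≤ 0 := (hP v).trans (mul_nonpos_of_nonneg_of_nonpos hP0.le h6)
  have h8 : H10.val v = 0 :=
    norm_eq_zero.1 (pow_eq_zero_iff two_ne_zero |>.1 (le_antisymm h7 (sq_nonneg _)))
  rw [h8] at hv1
  filter_upwards [hv1, Lp.coeFn_zero ℂ 2 (volume.restrict D)] with x h1 h2
  rw [h1, Pi.zero_apply] at h2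
  have h9 : (|(H10.val u x).re| - (H10.val u x).re) / 2 = 0 := by exact_mod_cast h2
  have : |(H10.val u x).re| = (H10.val u x).re := by linarith
  exact abs_eq_self.1 this

end Lattice

/-! ### A subsolution common to all coefficients -/

section Barrier

variable {d : ℕ} {D : Set (Pt d)} {κmin κmax M : ℝ} {κ : Pt d → ℝ} {b : Pt d → Pt d}

lemma IsTestFunction.partialDeriv {F : Type*} [NormedAddCommGroup F] [NormedSpace ℝ F]
    {φ : Pt d → F} (h : IsTestFunction D φ) (i : Fin d) :
    IsTestFunction D (ConvDiff.partialDeriv i φ) := by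
  have hs : Function.support (ConvDiff.partialDeriv i φ) ⊆ tsupport φ := fun x hx => by
    by_contra h'
    exact hx (by simp [ConvDiff.partialDeriv, fderiv_of_notMem_tsupport ℝ h'])
  exact ⟨(h.smooth.fderiv_right (m := ((⊤ : ℕ∞) : WithTop ℕ∞)) (by simp)).clm_apply contDiff_const,
    h.compact_support.mono' hs,
    (closure_minimal hs (isClosed_tsupport φ)).trans h.support_subset⟩

lemma IsTestFunction.exists_bound {F : Type*} [NormedAddCommGroup F] [NormedSpace ℝ F]
    {φ : Pt d → F} (h : IsTestFunction D φ) : ∃ C, ∀ x, ‖φ x‖ ≤ C :=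
  h.compact_support.exists_bound_of_continuous h.smooth.continuous

lemma IsTestFunction.integrable {F : Type*} [NormedAddCommGroup F] [NormedSpace ℝ F]
    {φ : Pt d → F} (h : IsTestFunction D φ) : Integrable φ (volume.restrict D) :=
  (h.smooth.continuous.integrable_of_hasCompactSupport h.compact_support).restrict

lemma partialDeriv_mul {φ ψ : Pt d → ℝ} {x : Pt d} (hφ : DifferentiableAt ℝ φ x)
    (hψ : DifferentiableAt ℝ ψ x) (i : Fin d) :
    partialDeriv i (fun x => φ x * ψ x) x =
      φ x * partialDeriv i ψ x + partialDeriv i φ x * ψ x := by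
  simp [partialDeriv, fderiv_fun_mul hφ hψ, mul_comm]

lemma IsTestFunction.mul_real {φ ψ : Pt d → ℝ} (hφ : IsTestFunction D φ)
    (hψ : IsTestFunction D ψ) : IsTestFunction D (fun x => φ x * ψ x) :=
  ⟨hφ.smooth.mul hψ.smooth, hφ.compact_support.mul_right,
    tsupport_mul_subset_left.trans hφ.support_subset⟩

/-- The strong form of the operator applied to a smooth function; `g` is the gradient of `κ`. -/
def strongOp (κ : Pt d → ℝ) (g : Fin d → Pt d → ℝ) (b : Pt d → Pt d) (φ : Pt d → ℝ) (x : Pt d) : ℝ :=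
  ∑ i, (b x i * partialDeriv i φ x - g i x * partialDeriv i φ x -
    κ x * partialDeriv i (partialDeriv i φ) x)

/-- Pointwise integration by parts: the first sum on the right is the combination whose integral
vanishes when g is the weak gradient of κ. -/
lemma re_form_density_eq {φ : Pt d → ℝ} {ψ : Pt d → ℂ} (hφ : IsTestFunction D φ)
    (hψ : IsTestFunction D ψ) (κ : Pt d → ℝ) (g : Fin d → Pt d → ℝ) (b : Pt d → Pt d) (x : Pt d) :
    κ x * (inner ℂ (cgrad ψ x) (cgrad (fun x => (φ x : ℂ)) x) : ℂ).re +
        ((∑ i, (b x i : ℂ) * cgrad (fun x => (φ x : ℂ)) x i) * (starRingEnd ℂ) (ψ x)).re =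
      ∑ i, (κ x * partialDeriv i (fun x => partialDeriv i φ x * (ψ x).re) x +
          g i x * (partialDeriv i φ x * (ψ x).re)) + strongOp κ g b φ x * (ψ x).re := by
  have hρ := hψ.clm_comp Complex.reCLM
  have hre : ∀ i, (partialDeriv i ψ x).re = partialDeriv i (fun x => (ψ x).re) x := fun i =>
    (hψ.fderiv_clm_comp Complex.reCLM x _).symm
  have hcr : ∀ i, cgrad (fun x => (φ x : ℂ)) x i = ((partialDeriv i φ x : ℝ) : ℂ) := fun i =>
    hφ.fderiv_clm_comp Complex.ofRealCLM x _
  have a1 : (inner ℂ (cgrad ψ x) (cgrad (fun x => (φ x : ℂ)) x) : ℂ).re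
      = ∑ i, partialDeriv i φ x * partialDeriv i (fun x => (ψ x).re) x := by
    rw [PiLp.inner_apply, Complex.re_sum]
    refine Finset.sum_congr rfl fun i _ => ?_
    rw [hcr, ← hre]
    simp [cgrad]
  have a2 : ((∑ i, (b x i : ℂ) * cgrad (fun x => (φ x : ℂ)) x i) * (starRingEnd ℂ) (ψ x)).re
      = ∑ i, b x i * partialDeriv i φ x * (ψ x).re := by
    simp only [hcr, Complex.re_sum, Finset.sum_mul, ← Complex.ofReal_mul, Complex.re_ofReal_mul,
      Complex.conj_re]
  rw [a1, a2, strongOp, Finset.mul_sum, Finset.sum_mul, ← Finset.sum_add_distrib,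
    ← Finset.sum_add_distrib]
  refine Finset.sum_congr rfl fun i _ => ?_
  have := partialDeriv_mul ((hφ.partialDeriv i).differentiable x) (hρ.differentiable x) i
  simp only [Complex.reCLM_apply] at this
  rw [this]
  ring

/-- The weak derivative of κ is tested with ∂ᵢφ · Re ψ. Since the strong form of the operator
applied to φ is bounded, both sides are continuous in v and density of test functions finishes. -/
lemma IsCoeff.re_form_eq (h : IsCoeff D κmin κmax M κ b) [IsFiniteMeasure (volume.restrict D)]
    {g : Fin d → Pt d → ℝ}
    (hgm : ∀ i, AEStronglyMeasurable (g i) (volume.restrict D))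
    (hgb : ∀ i, ∀ᵐ x ∂(volume.restrict D), |g i x| ≤ κmax)
    (hg : ∀ i, IsWeakPartial D i κ (g i)) {φ : Pt d → ℝ} (hφ : IsTestFunction D φ) {e : H10 D}
    (he : H10.val e =ᵐ[volume.restrict D] fun x => (φ x : ℂ))
    (he' : H10.grad e =ᵐ[volume.restrict D] cgrad fun x => (φ x : ℂ)) (v : H10 D) :
    Integrable (fun x => strongOp κ g b φ x * (H10.val v x).re) (volume.restrict D) ∧
      (form κ b e v).re = ∫ x in D, strongOp κ g b φ x * (H10.val v x).re := by
  have hκb : ∀ᵐ x ∂(volume.restrict D), ‖κ x‖ ≤ |κmax| := by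
    filter_upwards [h.diff.bounds] with x hx
    exact abs_le_abs_of_nonneg (by linarith [h.pos]) hx.2
  have hgb' : ∀ i, ∀ᵐ x ∂(volume.restrict D), ‖g i x‖ ≤ κmax := hgb
  have hbm : ∀ i, AEStronglyMeasurable (fun x => b x i) (volume.restrict D) := fun i =>
    (EuclideanSpace.proj (𝕜 := ℝ) i).continuous.comp_aestronglyMeasurable h.meas
  have hbb : ∀ i, ∀ᵐ x ∂(volume.restrict D), ‖b x i‖ ≤ M := fun i => by
    filter_upwards [h.bound] with x hx
    exact (PiLp.norm_apply_le _ _).trans hx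
  have hqm : AEStronglyMeasurable (strongOp κ g b φ) (volume.restrict D) := by
    refine Finset.aestronglyMeasurable_fun_sum _ fun i _ => ?_
    have c1 := (hφ.partialDeriv i).smooth.continuous.aestronglyMeasurable
      (μ := volume.restrict D)
    have c2 := ((hφ.partialDeriv i).partialDeriv i).smooth.continuous.aestronglyMeasurable
      (μ := volume.restrict D)
    exact (((hbm i).mul c1).sub ((hgm i).mul c1)).sub (h.diff.meas.mul c2)
  choose C1 hC1 using fun i => (hφ.partialDeriv i).exists_bound
  choose C2 hC2 using fun i => ((hφ.partialDeriv i).partialDeriv i).exists_bound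
  have hqb : ∀ᵐ x ∂(volume.restrict D), ‖strongOp κ g b φ x‖ ≤
      ∑ i, (M * C1 i + κmax * C1 i + |κmax| * C2 i) := by
    filter_upwards [hκb, ae_all_iff.2 hgb', ae_all_iff.2 hbb] with x e1 e2 e3
    refine (norm_sum_le _ _).trans (Finset.sum_le_sum fun i _ => ?_)
    refine (norm_sub_le _ _).trans (add_le_add ((norm_sub_le _ _).trans (add_le_add ?_ ?_)) ?_)
    · rw [norm_mul]
      exact mul_le_mul (e3 i) (hC1 i x) (norm_nonneg _) h.nonneg
    · rw [norm_mul]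
      exact mul_le_mul (e2 i) (hC1 i x) (norm_nonneg _) ((norm_nonneg _).trans (e2 i))
    · rw [norm_mul]
      exact mul_le_mul e1 (hC2 i x) (norm_nonneg _) (abs_nonneg _)
  have hQ : MemLp (fun x => (strongOp κ g b φ x : ℂ)) 2 (volume.restrict D) :=
    MemLp.of_bound (Complex.continuous_ofReal.comp_aestronglyMeasurable hqm) _ (by
      filter_upwards [hqb] with x hx
      rw [Complex.norm_real]; exact hx)
  set Q := hQ.toLp _ with hQdef
  have hpt : ∀ v : H10 D, ∀ᵐ x ∂(volume.restrict D), (inner ℂ (H10.val v x) (Q x) : ℂ).re =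
      strongOp κ g b φ x * (H10.val v x).re := fun v => by
    filter_upwards [hQ.coeFn_toLp] with x hx
    rw [hQdef, hx]; simp
  have hi : ∀ v : H10 D,
      Integrable (fun x => strongOp κ g b φ x * (H10.val v x).re) (volume.restrict D) := fun v =>
    (L2.integrable_inner (𝕜 := ℂ) (H10.val v) Q).re.congr (hpt v)
  have hR : ∀ v : H10 D, ∫ x in D, strongOp κ g b φ x * (H10.val v x).re =
      (inner ℂ (H10.val v) Q : ℂ).re := fun v => by
    rw [L2.inner_def, ← integral_congr_ae (hpt v)]
    exact Complex.reCLM.integral_comp_comm (L2.integrable_inner (𝕜 := ℂ) (H10.val v) Q)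
  refine ⟨hi v, ?_⟩
  obtain ⟨T1, hT1⟩ := h.exists_mulκ
  obtain ⟨T2, hT2⟩ := h.exists_dot
  induction v using H10.induction with
  | hc =>
    simp only [hR, form, formA_eq_inner hT1, formB_eq_inner hT2]
    refine isClosed_eq (Complex.continuous_re.comp ((continuous_grad.inner continuous_const).add
      (continuous_val.inner continuous_const)))
      (Complex.continuous_re.comp (continuous_val.inner continuous_const))
  | ht ψ v hψ h1 h2 =>
    have hρ := hψ.clm_comp Complex.reCLM
    set ρ : Pt d → ℝ := fun x => Complex.reCLM (ψ x) with hρdef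
    have hprod := fun i => (hφ.partialDeriv i).mul_real hρ
    have j1 : ∀ i, Integrable (fun x => κ x * partialDeriv i (fun x => partialDeriv i φ x * ρ x) x)
        (volume.restrict D) := fun i =>
      ((hprod i).partialDeriv i).integrable.bdd_mul h.diff.meas hκb
    have j2 : ∀ i, Integrable (fun x => g i x * (partialDeriv i φ x * ρ x))
        (volume.restrict D) := fun i => (hprod i).integrable.bdd_mul (hgm i) (hgb' i)
    have hpt2 : ∀ᵐ x ∂(volume.restrict D), formDensity κ b e v x =
        ∑ i, (κ x * partialDeriv i (fun x => partialDeriv i φ x * ρ x) x +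
          g i x * (partialDeriv i φ x * ρ x)) + strongOp κ g b φ x * (H10.val v x).re := by
      filter_upwards [he, he', h1, h2] with x e1 e2 e3 e4
      rw [formDensity, e2, e3, e4]
      exact re_form_density_eq hφ hψ κ g b x
    have j3 : ∀ i, Integrable (fun x => κ x * partialDeriv i (fun x => partialDeriv i φ x * ρ x) x +
        g i x * (partialDeriv i φ x * ρ x)) (volume.restrict D) := fun i => (j1 i).add (j2 i)
    rw [(h.integrable_formDensity e v).2, integral_congr_ae hpt2,
      integral_add (integrable_finsetSum _ fun i _ => j3 i) (hi v),
      integral_finsetSum _ fun i _ => j3 i]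
    have : ∀ i, ∫ x in D, (κ x * partialDeriv i (fun x => partialDeriv i φ x * ρ x) x +
          g i x * (partialDeriv i φ x * ρ x)) = 0 := fun i => by
      rw [integral_add (j1 i) (j2 i), hg i _ (hprod i)]; ring
    simp [this]

/-- A smooth radial bump supported in the ball of radius `R` around `x₀`. -/
def bump (x₀ : Pt d) (R : ℝ) (x : Pt d) : ℝ := expNegInvGlue (R ^ 2 - ‖x - x₀‖ ^ 2)

lemma contDiff_bump (x₀ : Pt d) (R : ℝ) : ContDiff ℝ ((⊤ : ℕ∞) : WithTop ℕ∞) (bump x₀ R) :=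
  expNegInvGlue.contDiff.comp (contDiff_const.sub ((contDiff_id.sub contDiff_const).norm_sq ℝ))

lemma bump_nonneg (x₀ : Pt d) (R : ℝ) (x : Pt d) : 0 ≤ bump x₀ R x := expNegInvGlue.nonneg _

lemma isTestFunction_bump {x₀ : Pt d} {R : ℝ} (hR : 0 ≤ R) (h : Metric.closedBall x₀ R ⊆ D) :
    IsTestFunction D (bump x₀ R) := by
  have hs : Function.support (bump x₀ R) ⊆ Metric.closedBall x₀ R := fun x hx => by
    rw [Metric.mem_closedBall, dist_eq_norm]
    by_contra h'
    refine hx (expNegInvGlue.zero_of_nonpos ?_)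
    nlinarith [norm_nonneg (x - x₀)]
  have hs' := closure_minimal hs Metric.isClosed_closedBall
  exact ⟨contDiff_bump x₀ R, (isCompact_closedBall x₀ R).of_isClosed_subset isClosed_closure hs',
    hs'.trans h⟩

lemma partialDeriv_radial {G : ℝ → ℝ} {G' : ℝ} {x₀ x : Pt d} {R : ℝ}
    (hG : HasDerivAt G G' (R ^ 2 - ‖x - x₀‖ ^ 2)) (i : Fin d) :
    partialDeriv i (fun x => G (R ^ 2 - ‖x - x₀‖ ^ 2)) x = -2 * (x i - x₀ i) * G' := by
  have h1 : HasFDerivAt (fun x : Pt d => R ^ 2 - ‖x - x₀‖ ^ 2) (-(2 • (innerSL ℝ) (x - x₀))) x := by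
    simpa using (((hasFDerivAt_id x).sub_const x₀).norm_sq).const_sub (R ^ 2)
  have h2 : HasFDerivAt (fun x => G (R ^ 2 - ‖x - x₀‖ ^ 2)) _ x := hG.comp_hasFDerivAt x h1
  rw [partialDeriv, h2.fderiv]
  simp [EuclideanSpace.inner_single_right]
  ring

lemma partialDeriv_bump (x₀ : Pt d) (R : ℝ) (i : Fin d) (x : Pt d) :
    partialDeriv i (bump x₀ R) x = -2 * (x i - x₀ i) *
      ((R ^ 2 - ‖x - x₀‖ ^ 2)⁻¹ ^ 2 * bump x₀ R x) := by
  have := expNegInvGlue.hasDerivAt_polynomial_eval_inv_mul 1 (R ^ 2 - ‖x - x₀‖ ^ 2)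
  simp only [Polynomial.eval_one, one_mul, Polynomial.derivative_one, sub_zero, mul_one,
    Polynomial.eval_pow, Polynomial.eval_X] at this
  exact partialDeriv_radial this i

lemma partialDeriv_partialDeriv_bump (x₀ : Pt d) (R : ℝ) (i : Fin d) (x : Pt d) :
    partialDeriv i (partialDeriv i (bump x₀ R)) x =
      -2 * ((R ^ 2 - ‖x - x₀‖ ^ 2)⁻¹ ^ 2 * bump x₀ R x) + 4 * (x i - x₀ i) ^ 2 *
      (((R ^ 2 - ‖x - x₀‖ ^ 2)⁻¹ ^ 4 - 2 * (R ^ 2 - ‖x - x₀‖ ^ 2)⁻¹ ^ 3) * bump x₀ R x) := by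
  have h0 := expNegInvGlue.hasDerivAt_polynomial_eval_inv_mul (Polynomial.X ^ 2)
    (R ^ 2 - ‖x - x₀‖ ^ 2)
  simp only [Polynomial.eval_pow, Polynomial.eval_X, Polynomial.derivative_X_pow,
    Polynomial.eval_mul, Polynomial.eval_sub, Polynomial.eval_C] at h0
  have h1 := partialDeriv_radial h0 i
  have h2 : HasFDerivAt (fun x : Pt d => -2 * (x i - x₀ i))
      ((-2 : ℝ) • (EuclideanSpace.proj (𝕜 := ℝ) i : Pt d →L[ℝ] ℝ)) x :=
    ((EuclideanSpace.proj (𝕜 := ℝ) i).hasFDerivAt.sub_const (x₀ i)).const_mul (-2)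
  have h3 : HasFDerivAt (fun x : Pt d => R ^ 2 - ‖x - x₀‖ ^ 2) (-(2 • (innerSL ℝ) (x - x₀))) x := by
    simpa using (((hasFDerivAt_id x).sub_const x₀).norm_sq).const_sub (R ^ 2)
  have h4 : partialDeriv i (fun x : Pt d => -2 * (x i - x₀ i)) x = -2 := by
    rw [partialDeriv, h2.fderiv]; simp
  rw [funext (partialDeriv_bump x₀ R i)]
  have := partialDeriv_mul h2.differentiableAt (h0.comp_hasFDerivAt x h3).differentiableAt i
  simp only [Function.comp_def] at this
  refine this.trans ?_
  rw [h1, h4]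
  simp only [bump]
  generalize (R ^ 2 - ‖x - x₀‖ ^ 2)⁻¹ = r
  push_cast
  simp only [pow_one]
  ring

/-- Put s = R² - |x - x₀|² and r = 1/s. Lower order terms grow like r², while the second derivatives
contribute a negative term of order |x - x₀|² r⁴. Near the sphere s = 0 the latter wins; where s ≥
s₀ the former are bounded by a constant multiple of the bump. -/
lemma strongOp_bump_le {κ₀ κ₁ s₀ R : ℝ} {g : Fin d → Pt d → ℝ} {x₀ x : Pt d}
    (hκ₀ : 0 < κ₀) (hM : 0 ≤ M) (hR : 0 < R) (hR2 : R ≤ 1 / 2) (hκ : κ₀ ≤ κ x) (hκ' : κ x ≤ κ₁)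
    (hb : ‖b x‖ ≤ M) (hg : ∀ i, |g i x| ≤ κ₁) (hs : 0 < s₀) (hs1 : s₀ ≤ R ^ 2 / 2)
    (hs2 : s₀ * (d * (M + κ₁) + 2 * d * κ₁) ≤ κ₀ * R ^ 2) :
    strongOp κ g b (bump x₀ R) x ≤ ((d * (M + κ₁) + 2 * d * κ₁) / s₀ ^ 2) * bump x₀ R x := by
  set K : ℝ := d * (M + κ₁) + 2 * d * κ₁ with hK
  have hκ₁ : 0 ≤ κ₁ := by linarith
  have hK0 : 0 ≤ K := by positivity
  set s := R ^ 2 - ‖x - x₀‖ ^ 2 with hsdef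
  rcases le_or_gt s 0 with h0 | h0
  · have hb0 : bump x₀ R x = 0 := expNegInvGlue.zero_of_nonpos h0
    simp [strongOp, partialDeriv_bump, partialDeriv_partialDeriv_bump, hb0]
  have hbp := bump_nonneg x₀ R x
  have hy : ‖x - x₀‖ ^ 2 = ∑ i, (x i - x₀ i) ^ 2 := by
    simp [EuclideanSpace.norm_sq_eq]
  have hyR : ‖x - x₀‖ ≤ R := by
    by_contra h'; nlinarith [norm_nonneg (x - x₀)]
  have hyi : ∀ i, |x i - x₀ i| ≤ R := fun i => (PiLp.norm_apply_le (x - x₀) i).trans hyR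
  have hbi : ∀ i, |b x i| ≤ M := fun i => (PiLp.norm_apply_le (b x) i).trans hb
  set r := s⁻¹ with hr
  have hr0 : 0 < r := inv_pos.2 h0
  have hrs : r * s = 1 := inv_mul_cancel₀ h0.ne'
  have hsR : s ≤ 1 / 4 := by nlinarith [sq_nonneg ‖x - x₀‖]
  -- R ≤ 1/2 serves to get r ≥ 4, and thus r⁴ - 2r³ ≥ r⁴/2 below.
  have hr4 : 4 ≤ r := by nlinarith
  have e1 : strongOp κ g b (bump x₀ R) x = (∑ i, (-2 * (b x i - g i x) * (x i - x₀ i) * r ^ 2 +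
      2 * κ x * r ^ 2 - 4 * κ x * (x i - x₀ i) ^ 2 * (r ^ 4 - 2 * r ^ 3))) * bump x₀ R x := by
    rw [strongOp, Finset.sum_mul]
    refine Finset.sum_congr rfl fun i _ => ?_
    rw [partialDeriv_bump, partialDeriv_partialDeriv_bump]
    ring
  rw [e1]
  refine mul_le_mul_of_nonneg_right ?_ hbp
  have e2 : ∑ i, (-2 * (b x i - g i x) * (x i - x₀ i) * r ^ 2 +
      2 * κ x * r ^ 2 - 4 * κ x * (x i - x₀ i) ^ 2 * (r ^ 4 - 2 * r ^ 3)) ≤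
      K * r ^ 2 - 2 * κ₀ * ‖x - x₀‖ ^ 2 * r ^ 4 := by
    have : K * r ^ 2 - 2 * κ₀ * ‖x - x₀‖ ^ 2 * r ^ 4 =
        ∑ i : Fin d, (((M + κ₁) + 2 * κ₁) * r ^ 2 - 2 * κ₀ * (x i - x₀ i) ^ 2 * r ^ 4) := by
      rw [hy, Finset.sum_sub_distrib, Finset.sum_const, Finset.card_univ, Fintype.card_fin,
        Finset.mul_sum, Finset.sum_mul, nsmul_eq_mul, hK]
      ring
    rw [this]
    refine Finset.sum_le_sum fun i _ => ?_
    have f1 : -2 * (b x i - g i x) * (x i - x₀ i) ≤ M + κ₁ := by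
      have t1 : |(b x i - g i x) * (x i - x₀ i)| ≤ (M + κ₁) * (1 / 2) := by
        rw [abs_mul]
        exact mul_le_mul ((abs_sub _ _).trans (add_le_add (hbi i) (hg i))) ((hyi i).trans hR2)
          (abs_nonneg _) (by linarith)
      have := (abs_le.1 t1).1
      linarith
    have f2 : r ^ 4 / 2 ≤ r ^ 4 - 2 * r ^ 3 := by
      have : 0 ≤ r ^ 3 * (r - 4) := by
        have := sub_nonneg.2 hr4
        positivity
      nlinarith
    have f3 : κ₀ * (x i - x₀ i) ^ 2 * (r ^ 4 / 2) ≤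
        κ x * (x i - x₀ i) ^ 2 * (r ^ 4 - 2 * r ^ 3) :=
      mul_le_mul (mul_le_mul_of_nonneg_right hκ (sq_nonneg _)) f2 (by positivity)
        (mul_nonneg (by linarith) (sq_nonneg _))
    have f4 := mul_le_mul_of_nonneg_right f1 (sq_nonneg r)
    have f5 := mul_le_mul_of_nonneg_right hκ' (sq_nonneg r)
    linarith
  refine e2.trans ?_
  rcases le_or_gt s₀ s with h1 | h1
  · have : r ≤ s₀⁻¹ := inv_anti₀ hs h1
    have h2 : r ^ 2 ≤ (s₀ ^ 2)⁻¹ := by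
      rw [← inv_pow]; exact pow_le_pow_left₀ hr0.le this 2
    have h3 : 0 ≤ 2 * κ₀ * ‖x - x₀‖ ^ 2 * r ^ 4 := by positivity
    have h4 := mul_le_mul_of_nonneg_left h2 hK0
    rw [div_eq_mul_inv]
    linarith
  · have h2 : R ^ 2 / 2 ≤ ‖x - x₀‖ ^ 2 := by linarith
    have h3 : K * r ^ 2 ≤ κ₀ * R ^ 2 * r ^ 4 := by
      have h5 : s * K ≤ κ₀ * R ^ 2 := (mul_le_mul_of_nonneg_right h1.le hK0).trans hs2
      have h6 : K ≤ κ₀ * R ^ 2 * r := by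
        have := mul_le_mul_of_nonneg_left h5 hr0.le
        rw [← mul_assoc, hrs] at this
        linarith
      have h7 : κ₀ * R ^ 2 * r ≤ κ₀ * R ^ 2 * r ^ 2 := by
        refine mul_le_mul_of_nonneg_left ?_ (by positivity)
        nlinarith
      have := mul_le_mul_of_nonneg_right (h6.trans h7) (sq_nonneg r)
      linarith
    have h4 : 2 * κ₀ * (R ^ 2 / 2) * r ^ 4 ≤ 2 * κ₀ * ‖x - x₀‖ ^ 2 * r ^ 4 := by gcongr
    have : 0 ≤ K / s₀ ^ 2 := by positivity
    linarith

/-- The order of quantifiers is the point: e and C precede the coefficients, which makes C an upper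
bound for principal eigenvalues over the whole class. -/
lemma exists_barrier [IsFiniteMeasure (volume.restrict D)] (hD : IsOpen D) (hne : D.Nonempty)
    (κ₀ κ₁ M : ℝ) (hκ₀ : 0 < κ₀) :
    ∃ C : ℝ, 0 < C ∧ ∃ e : H10 D, IsNonneg e ∧ H10.val e ≠ 0 ∧
      ∀ κ b, IsCoeff D κ₀ κ₁ M κ b → ∀ v : H10 D, IsNonneg v →
        (form κ b e v).re ≤ C * (inner ℂ (H10.val v) (H10.val e) : ℂ).re := by
  obtain ⟨x₀, hx₀⟩ := hne
  obtain ⟨R₀, hR₀, hball⟩ := Metric.isOpen_iff.1 hD x₀ hx₀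
  set R := min (R₀ / 2) (1 / 2) with hRdef
  have hR : 0 < R := by positivity
  have hRD : Metric.closedBall x₀ R ⊆ D :=
    (Metric.closedBall_subset_ball ((min_le_left _ _).trans_lt (by linarith))).trans hball
  have hφ := isTestFunction_bump hR.le hRD
  have hφc : IsTestFunction D (fun x => (bump x₀ R x : ℂ)) := hφ.clm_comp Complex.ofRealCLM
  obtain ⟨e, he, he'⟩ := hφc.exists_H10
  -- Absolute values appear because K and s₀ are fixed before any coefficients are known to exist,
  -- so no sign of M or κ₁ is available.
  set K : ℝ := d * (|M| + |κ₁|) + 2 * d * |κ₁| with hK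
  have hK0 : 0 ≤ K := by positivity
  set s₀ := min (R ^ 2 / 2) (κ₀ * R ^ 2 / (K + 1)) with hs₀
  have hs : 0 < s₀ := by positivity
  refine ⟨K / s₀ ^ 2 + 1, by positivity, e, ?_, ?_, fun κ b h v hv => ?_⟩
  · filter_upwards [he] with x hx
    rw [hx]; exact ⟨bump_nonneg x₀ R x, Complex.ofReal_im _⟩
  · intro h0
    have h1 : ∀ᵐ x ∂(volume.restrict D), x ∉ Metric.ball x₀ R := by
      filter_upwards [he, Lp.coeFn_zero ℂ 2 (volume.restrict D)] with x h2 h3 h4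
      rw [h0, h3, Pi.zero_apply] at h2
      have h5 : bump x₀ R x = 0 := by exact_mod_cast h2.symm
      refine (expNegInvGlue.pos_of_pos ?_).ne' h5
      rw [Metric.mem_ball, dist_eq_norm] at h4
      nlinarith [norm_nonneg (x - x₀)]
    rw [ae_restrict_iff' hD.measurableSet] at h1
    have h2 : volume (Metric.ball x₀ R) = 0 := by
      refine measure_mono_null (fun x hx => ?_) h1
      simpa using ⟨hRD (Metric.ball_subset_closedBall hx), hx⟩
    exact (Metric.measure_ball_pos volume x₀ hR).ne' h2
  · choose g hgm hgb hg using h.diff.weak_deriv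
    obtain ⟨hi, hre⟩ := h.re_form_eq hgm hgb hg hφ he he' v
    have hpt : ∀ᵐ x ∂(volume.restrict D), (inner ℂ (H10.val v x) (H10.val e x) : ℂ).re =
        bump x₀ R x * (H10.val v x).re := by
      filter_upwards [he] with x hx
      rw [hx]; simp
    have hin := L2.integrable_inner (𝕜 := ℂ) (H10.val v) (H10.val e)
    have hR' : (inner ℂ (H10.val v) (H10.val e) : ℂ).re =
        ∫ x in D, bump x₀ R x * (H10.val v x).re := by
      rw [L2.inner_def, ← integral_congr_ae hpt]
      exact (Complex.reCLM.integral_comp_comm hin).symm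
    rw [hre, hR', ← integral_const_mul]
    refine integral_mono_ae hi ((hin.re.congr hpt).const_mul _) ?_
    filter_upwards [hv, h.diff.bounds, ae_all_iff.2 hgb, h.bound] with x hx hκx hgx hbx
    have hle : κ₁ ≤ |κ₁| := le_abs_self _
    have := strongOp_bump_le (x₀ := x₀) hκ₀ (abs_nonneg M) hR (min_le_right _ _) hκx.1
      (hκx.2.trans hle) (hbx.trans (le_abs_self M)) (fun i => (hgx i).trans hle) hs
      (min_le_left _ _) (by
        have h1 : s₀ ≤ κ₀ * R ^ 2 / (K + 1) := min_le_right _ _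
        rw [le_div_iff₀ (by positivity)] at h1
        rw [← hK]
        linarith)
    have hb0 := bump_nonneg x₀ R x
    change strongOp κ g b (bump x₀ R) x * (H10.val v x).re ≤ _
    rw [← mul_assoc]
    refine mul_le_mul_of_nonneg_right (this.trans ?_) hx.1
    rw [← hK]
    linarith

end Barrier

/-! ### The logarithmic gradient estimate for supersolutions -/

section LogEstimate

variable {d : ℕ} {D : Set (Pt d)} {κmin κmax M : ℝ} {κ : Pt d → ℝ} {b : Pt d → Pt d}

/-- A smooth substitute for `1 / z`, decreasing on all of `ℝ`. -/
def recipFun (ε z : ℝ) : ℝ := (Real.pi / 2 - Real.arctan (z / ε)) / ε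

lemma sq_add_sq_pos {ε : ℝ} (hε : 0 < ε) (z : ℝ) : 0 < ε ^ 2 + z ^ 2 := by positivity

lemma recipFun_nonneg {ε : ℝ} (hε : 0 < ε) (z : ℝ) : 0 ≤ recipFun ε z :=
  div_nonneg (by linarith [Real.arctan_lt_pi_div_two (z / ε)]) hε.le

/-- Jordan's inequality sin x ≥ 2x/π at x = π/2 - arctan(z/ε), an angle in [0, π/2] for z ≥ 0, whose
sine is 1/√(1 + (z/ε)²). -/
lemma recipFun_le {ε z : ℝ} (hε : 0 < ε) (hz : 0 ≤ z) :
    recipFun ε z ≤ Real.pi / 2 / √(ε ^ 2 + z ^ 2) := by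
  have h1 := Real.mul_le_sin (x := Real.pi / 2 - Real.arctan (z / ε))
    (by linarith [Real.arctan_lt_pi_div_two (z / ε)])
    (by linarith [Real.arctan_nonneg.2 (div_nonneg hz hε.le)])
  rw [Real.sin_pi_div_two_sub, Real.cos_arctan] at h1
  have h2 : √(ε ^ 2 + z ^ 2) = ε * √(1 + (z / ε) ^ 2) := by
    rw [show ε ^ 2 + z ^ 2 = ε ^ 2 * (1 + (z / ε) ^ 2) by field_simp, Real.sqrt_mul (by positivity),
      Real.sqrt_sq hε.le]
  have hs : 0 < √(1 + (z / ε) ^ 2) := Real.sqrt_pos.2 (by positivity)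
  rw [h2, recipFun, div_le_div_iff₀ hε (by positivity)]
  rw [le_div_iff₀ hs, div_mul_eq_mul_div, div_mul_eq_mul_div, div_le_one Real.pi_pos] at h1
  nlinarith

lemma hasDerivAt_recipFun {ε : ℝ} (hε : 0 < ε) (z : ℝ) :
    HasDerivAt (recipFun ε) (-(ε ^ 2 + z ^ 2)⁻¹) z := by
  have h := ((((hasDerivAt_id z).div_const ε).arctan).const_sub (Real.pi / 2)).div_const ε
  refine h.congr_deriv ?_
  simp only [id]
  field_simp

lemma contDiff_recipFun (ε : ℝ) : ContDiff ℝ ((⊤ : ℕ∞) : WithTop ℕ∞) (recipFun ε) :=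
  (contDiff_const.sub (Real.contDiff_arctan.comp (contDiff_id.div_const ε))).div_const ε

/-- Young's inequality: the cutoff term and the drift term each take a quarter of κ₀φ²(‖p‖/s)², and
half of it remains. The bound F‖p‖ ≤ (π/2)‖p‖/s makes this possible without any dependence on s. -/
lemma log_density_le {κ₀ κ₁ M k φ s F : ℝ} {p q c : Pt d} (hκ₀ : 0 < κ₀) (hM : 0 ≤ M)
    (hk : κ₀ ≤ k) (hk' : k ≤ κ₁) (hc : ‖c‖ ≤ M) (hs : 0 < s) (hF : 0 ≤ F)
    (hF' : F ≤ Real.pi / 2 / s) :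
    k * inner ℝ ((-(φ ^ 2 * (s ^ 2)⁻¹)) • p + (2 * φ * F) • q) p + inner ℝ c p * (φ ^ 2 * F) ≤
      -(κ₀ / 2 * (φ ^ 2 * (‖p‖ / s) ^ 2)) + (Real.pi ^ 2 * κ₁ ^ 2 / κ₀ * ‖q‖ ^ 2 +
        Real.pi ^ 2 * M ^ 2 / (4 * κ₀) * φ ^ 2) := by
  set W := ‖p‖ / s with hW
  have hW0 : 0 ≤ W := by positivity
  have hFp : F * ‖p‖ ≤ Real.pi / 2 * W := by
    refine (mul_le_mul_of_nonneg_right hF' (norm_nonneg p)).trans (le_of_eq ?_)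
    rw [hW]; ring
  have e1 : inner ℝ ((-(φ ^ 2 * (s ^ 2)⁻¹)) • p + (2 * φ * F) • q) p =
      -(φ ^ 2 * W ^ 2) + 2 * φ * F * inner ℝ q p := by
    rw [inner_add_left, real_inner_smul_left, real_inner_smul_left, real_inner_self_eq_norm_sq, hW]
    field_simp
  have e2 : 2 * φ * F * inner ℝ q p ≤ Real.pi * |φ| * W * ‖q‖ := by
    have h1 : φ * inner ℝ q p ≤ |φ| * (‖q‖ * ‖p‖) := by
      refine (le_abs_self _).trans ?_
      rw [abs_mul]
      exact mul_le_mul_of_nonneg_left (abs_real_inner_le_norm q p) (abs_nonneg _)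
    have h2 := mul_le_mul_of_nonneg_left h1 (mul_nonneg zero_le_two hF)
    have h3 := mul_le_mul_of_nonneg_left hFp (mul_nonneg (mul_nonneg zero_le_two (abs_nonneg φ))
      (norm_nonneg q))
    linarith
  have e3 : inner ℝ c p * (φ ^ 2 * F) ≤ M * (Real.pi / 2 * W) * φ ^ 2 := by
    have h1 : inner ℝ c p ≤ M * ‖p‖ :=
      (real_inner_le_norm c p).trans (mul_le_mul_of_nonneg_right hc (norm_nonneg p))
    have h2 := mul_le_mul_of_nonneg_right h1 (mul_nonneg (sq_nonneg φ) hF)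
    have h3 := mul_le_mul_of_nonneg_left hFp (mul_nonneg hM (sq_nonneg φ))
    linarith
  have hk0 : 0 ≤ k := hκ₀.le.trans hk
  have e4 : k * (2 * φ * F * inner ℝ q p) ≤ κ₁ * (Real.pi * |φ| * W * ‖q‖) :=
    (mul_le_mul_of_nonneg_left e2 hk0).trans (mul_le_mul_of_nonneg_right hk' (by positivity))
  have e5 : κ₀ * (φ ^ 2 * W ^ 2) ≤ k * (φ ^ 2 * W ^ 2) :=
    mul_le_mul_of_nonneg_right hk (by positivity)
  have e6 : κ₁ * (Real.pi * |φ| * W * ‖q‖) ≤ κ₀ / 4 * (φ ^ 2 * W ^ 2) +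
      Real.pi ^ 2 * κ₁ ^ 2 / κ₀ * ‖q‖ ^ 2 := by
    have h1 : 0 ≤ (κ₀ / 2 * (|φ| * W) - Real.pi * κ₁ * ‖q‖) ^ 2 / κ₀ := by positivity
    have h2 : (κ₀ / 2 * (|φ| * W) - Real.pi * κ₁ * ‖q‖) ^ 2 / κ₀ = κ₀ / 4 * (|φ| ^ 2 * W ^ 2) +
      Real.pi ^ 2 * κ₁ ^ 2 / κ₀ * ‖q‖ ^ 2 - κ₁ * (Real.pi * |φ| * W * ‖q‖) := by
      field_simp; ring
    rw [h2, sq_abs] at h1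
    linarith
  have e7 : M * (Real.pi / 2 * W) * φ ^ 2 ≤ κ₀ / 4 * (φ ^ 2 * W ^ 2) +
      Real.pi ^ 2 * M ^ 2 / (4 * κ₀) * φ ^ 2 := by
    have h1 : 0 ≤ (κ₀ / 2 * W - Real.pi / 2 * M) ^ 2 / κ₀ * φ ^ 2 := by positivity
    have h2 : (κ₀ / 2 * W - Real.pi / 2 * M) ^ 2 / κ₀ * φ ^ 2 = κ₀ / 4 * (φ ^ 2 * W ^ 2) +
      Real.pi ^ 2 * M ^ 2 / (4 * κ₀) * φ ^ 2 - M * (Real.pi / 2 * W) * φ ^ 2 := by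
      field_simp; ring
    rw [h2] at h1
    linarith
  rw [e1, mul_add, mul_neg]
  linarith

lemma cgrad_ofReal {φ : Pt d → ℝ} (hφ : IsTestFunction D φ) (x : Pt d) :
    cgrad (fun x => (φ x : ℂ)) x = ofRealVec (WithLp.toLp 2 fun i => partialDeriv i φ x) := by
  ext i
  exact hφ.fderiv_clm_comp Complex.ofRealCLM x _

lemma H10.exists_recip (u : H10 D) {ε : ℝ} (hε : 0 < ε) {φ : Pt d → ℝ} (hφ : IsTestFunction D φ) :
    ∃ v : H10 D, H10.val v =ᵐ[volume.restrict D]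
        (fun x => ((φ x ^ 2 * recipFun ε (H10.val u x).re : ℝ) : ℂ)) ∧
      H10.grad v =ᵐ[volume.restrict D] fun x => ofRealVec
        ((-(φ x ^ 2 * (ε ^ 2 + (H10.val u x).re ^ 2)⁻¹)) • reVec (H10.grad u x) +
          (2 * φ x * recipFun ε (H10.val u x).re) •
            WithLp.toLp 2 fun i => partialDeriv i φ x) := by
  have hφ2 := hφ.mul_real hφ
  have hψ : IsTestFunction D (fun x => ((φ x * φ x : ℝ) : ℂ)) := hφ2.clm_comp Complex.ofRealCLM
  obtain ⟨w1, a1, a2⟩ := H10.exists_comp_re u (g := fun z => recipFun ε z - recipFun ε 0)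
    (g' := fun z => -(ε ^ 2 + z ^ 2)⁻¹) (L := (ε ^ 2)⁻¹) ((contDiff_recipFun ε).sub contDiff_const)
    (fun z => (hasDerivAt_recipFun hε z).sub_const _) (sub_self _) (fun z => by
      rw [abs_neg, abs_of_pos (inv_pos.2 (sq_add_sq_pos hε z))]
      exact inv_anti₀ (by positivity) (by nlinarith [sq_nonneg z]))
  obtain ⟨w2, b1, b2⟩ := H10.exists_mul w1 hψ
  obtain ⟨w3, c1, c2⟩ := hψ.exists_H10
  -- The chain rule requires a function vanishing at 0, so `recipFun` is shifted by its value there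
  -- and the constant is returned as a multiple of φ².
  refine ⟨w2 + (recipFun ε 0 : ℂ) • w3, ?_, ?_⟩
  · filter_upwards [a1, b1, c1, Lp.coeFn_add (H10.val w2) ((recipFun ε 0 : ℂ) • H10.val w3),
      Lp.coeFn_smul (recipFun ε 0 : ℂ) (H10.val w3)] with x h1 h2 h3 h4 h5
    refine h4.trans ?_
    rw [Pi.add_apply, h5, Pi.smul_apply, h2, h3, h1, smul_eq_mul]
    push_cast
    ring
  · filter_upwards [a1, a2, b2, c2, Lp.coeFn_add (H10.grad w2) ((recipFun ε 0 : ℂ) • H10.grad w3),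
      Lp.coeFn_smul (recipFun ε 0 : ℂ) (H10.grad w3)] with x h0 h1 h2 h3 h4 h5
    refine h4.trans ?_
    rw [Pi.add_apply, h5, Pi.smul_apply, h2, h3, h1, h0, cgrad_ofReal hφ2]
    ext i
    have := partialDeriv_mul (hφ.differentiable x) (hφ.differentiable x) i
    simp [this]
    ring

/-- The classical test function φ²/u is regularised to φ² `recipFun ε u`. The derivative -1/(ε² +
u²) of `recipFun` is minus the square of the derivative of arsinh(u/ε), so the energy of the latter
appears; the right-hand side depends on neither u nor ε. -/
theorem IsCoeff.log_estimate (h : IsCoeff D κmin κmax M κ b) {u : H10 D} (hu0 : IsNonneg u)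
    (hu : ∀ v : H10 D, IsNonneg v → 0 ≤ (form κ b u v).re) {ε : ℝ} (hε : 0 < ε)
    {φ : Pt d → ℝ} (hφ : IsTestFunction D φ) :
    ∃ w : H10 D, H10.val w =ᵐ[volume.restrict D]
        (fun x => (Real.arsinh ((H10.val u x).re / ε) : ℂ)) ∧
      Integrable (fun x => φ x ^ 2 * ‖H10.grad w x‖ ^ 2) (volume.restrict D) ∧
      κmin / 2 * ∫ x in D, φ x ^ 2 * ‖H10.grad w x‖ ^ 2 ≤
        ∫ x in D, (Real.pi ^ 2 * κmax ^ 2 / κmin *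
            ‖(WithLp.toLp 2 fun i => partialDeriv i φ x : Pt d)‖ ^ 2 +
          Real.pi ^ 2 * M ^ 2 / (4 * κmin) * φ x ^ 2) := by
  obtain ⟨v, hv1, hv2⟩ := H10.exists_recip u hε hφ
  have hsq : ∀ z : ℝ, √(ε ^ 2 + z ^ 2) ^ 2 = ε ^ 2 + z ^ 2 := fun z =>
    Real.sq_sqrt (sq_add_sq_pos hε z).le
  have hs : ∀ z : ℝ, 0 < √(ε ^ 2 + z ^ 2) := fun z => Real.sqrt_pos.2 (sq_add_sq_pos hε z)
  have hdv : ∀ z : ℝ, HasDerivAt (fun z => Real.arsinh (z / ε)) (√(ε ^ 2 + z ^ 2))⁻¹ z := fun z => by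
    refine ((hasDerivAt_id z).div_const ε).arsinh.congr_deriv ?_
    have h2 : √(ε ^ 2 + z ^ 2) = ε * √(1 + (z / ε) ^ 2) := by
      rw [show ε ^ 2 + z ^ 2 = ε ^ 2 * (1 + (z / ε) ^ 2) by field_simp,
        Real.sqrt_mul (by positivity), Real.sqrt_sq hε.le]
    rw [h2, id, smul_eq_mul, mul_inv]
    ring
  obtain ⟨w, hw1, hw2⟩ := H10.exists_comp_re u (g := fun z => Real.arsinh (z / ε))
    (g' := fun z => (√(ε ^ 2 + z ^ 2))⁻¹) (L := ε⁻¹)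
    (Real.contDiff_arsinh.comp (contDiff_id.div_const ε)) hdv (by simp) (fun z => by
      rw [abs_of_pos (inv_pos.2 (hs z))]
      refine inv_anti₀ hε (Real.le_sqrt_of_sq_le ?_)
      nlinarith [sq_nonneg z])
  obtain ⟨C, hC⟩ := hφ.exists_bound
  have i1 : Integrable (fun x => φ x ^ 2 * ‖H10.grad w x‖ ^ 2) (volume.restrict D) :=
    (integrable_norm_sq (H10.grad w)).bdd_mul (c := C ^ 2)
      (hφ.smooth.continuous.pow 2).aestronglyMeasurable (ae_of_all _ fun x => by
        rw [norm_pow]; exact pow_le_pow_left₀ (norm_nonneg _) (hC x) 2)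
  refine ⟨w, hw1, i1, ?_⟩
  have i2 : Integrable (fun x => Real.pi ^ 2 * κmax ^ 2 / κmin *
      ‖(WithLp.toLp 2 fun i => partialDeriv i φ x : Pt d)‖ ^ 2 +
      Real.pi ^ 2 * M ^ 2 / (4 * κmin) * φ x ^ 2) (volume.restrict D) := by
    refine Integrable.add (Integrable.const_mul ?_ _) (Integrable.const_mul ?_ _)
    · simp only [EuclideanSpace.norm_sq_eq, Real.norm_eq_abs, sq_abs]
      refine integrable_finsetSum _ fun i _ => ?_
      simpa only [sq] using ((hφ.partialDeriv i).mul_real (hφ.partialDeriv i)).integrable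
    · simpa only [sq] using (hφ.mul_real hφ).integrable
  have hv : IsNonneg v := by
    filter_upwards [hv1] with x hx
    rw [hx]
    exact ⟨mul_nonneg (sq_nonneg _) (recipFun_nonneg hε _), Complex.ofReal_im _⟩
  have h0 := hu v hv
  obtain ⟨i3, hi3⟩ := h.integrable_formDensity u v
  rw [hi3] at h0
  have key : ∫ x in D, formDensity κ b u v x ≤ ∫ x in D, (-(κmin / 2 * (φ x ^ 2 *
      ‖H10.grad w x‖ ^ 2)) + (Real.pi ^ 2 * κmax ^ 2 / κmin *
      ‖(WithLp.toLp 2 fun i => partialDeriv i φ x : Pt d)‖ ^ 2 +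
      Real.pi ^ 2 * M ^ 2 / (4 * κmin) * φ x ^ 2)) := by
    refine integral_mono_ae i3 ((i1.const_mul _).neg.add i2) ?_
    filter_upwards [hv1, hv2, hw2, hu0, h.diff.bounds, h.bound] with x e1 e2 e3 e4 e5 e6
    have e7 : ‖H10.grad w x‖ = ‖reVec (H10.grad u x)‖ / √(ε ^ 2 + (H10.val u x).re ^ 2) := by
      rw [e3, norm_ofRealVec, norm_smul, norm_inv, Real.norm_of_nonneg (Real.sqrt_nonneg _),
        div_eq_inv_mul]
    rw [formDensity, e1, e2, e7, re_inner_ofRealVec, Complex.conj_ofReal, Complex.re_mul_ofReal,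
      re_sum_mul]
    have := log_density_le (φ := φ x) (p := reVec (H10.grad u x))
      (q := WithLp.toLp 2 fun i => partialDeriv i φ x) h.pos h.nonneg e5.1 e5.2 e6
      (hs (H10.val u x).re) (recipFun_nonneg hε (H10.val u x).re) (recipFun_le hε e4.1)
    rwa [hsq] at this
  have i4 : Integrable (fun x => -(κmin / 2 * (φ x ^ 2 * ‖H10.grad w x‖ ^ 2)))
    (volume.restrict D) := (i1.const_mul _).neg
  rw [integral_add i4 i2, integral_neg, integral_const_mul] at key
  linarith

end LogEstimate

/-! ### Positive or zero: a criterion stable under L² limits -/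

section LogDefect

variable {X : Type*} [MeasurableSpace X] (ν : Measure X)

/-- `z ↦ arsinh (Re z / ε)`. -/
def logMap (ε : ℝ) (z : ℂ) : ℂ := (Real.arsinh (z.re / ε) : ℂ)

lemma lipschitzWith_arsinh : LipschitzWith 1 Real.arsinh := by
  refine lipschitzWith_of_nnnorm_deriv_le Real.differentiable_arsinh fun x => ?_
  rw [(Real.hasDerivAt_arsinh x).deriv, ← NNReal.coe_le_coe, coe_nnnorm, norm_inv,
    Real.norm_of_nonneg (Real.sqrt_nonneg _)]
  exact inv_le_one_of_one_le₀ (Real.one_le_sqrt.2 (by nlinarith [sq_nonneg x]))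

lemma lipschitzWith_logMap {ε : ℝ} (hε : 0 < ε) : LipschitzWith (Real.toNNReal ε⁻¹) (logMap ε) := by
  refine LipschitzWith.of_dist_le_mul fun z w => ?_
  rw [Real.coe_toNNReal _ (inv_pos.2 hε).le, dist_eq_norm, logMap, logMap, ← Complex.ofReal_sub,
    Complex.norm_real]
  have h1 := lipschitzWith_arsinh.dist_le_mul (z.re / ε) (w.re / ε)
  rw [NNReal.coe_one, one_mul, dist_eq_norm, dist_eq_norm, ← sub_div, norm_div,
    Real.norm_of_nonneg hε.le] at h1
  refine h1.trans ?_
  rw [div_eq_inv_mul, dist_eq_norm, ← Complex.sub_re]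
  exact mul_le_mul_of_nonneg_left (Complex.abs_re_le_norm _) (inv_pos.2 hε).le

lemma logMap_zero (ε : ℝ) : logMap ε 0 = 0 := by simp [logMap]

/-- Superposition with `logMap` on `L²`. -/
def logL {ε : ℝ} (hε : 0 < ε) (f : Lp ℂ 2 ν) : Lp ℂ 2 ν :=
  (lipschitzWith_logMap hε).compLp (logMap_zero ε) f

variable {ν}

lemma logL_apply {ε : ℝ} (hε : 0 < ε) (f : Lp ℂ 2 ν) :
    logL ν hε f =ᵐ[ν] fun x => logMap ε (f x) :=
  (lipschitzWith_logMap hε).coeFn_compLp (logMap_zero ε) f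

variable [IsFiniteMeasure ν]

/-- The (unnormalised) variance of `logL f`. -/
def logDefect {ε : ℝ} (hε : 0 < ε) (f : Lp ℂ 2 ν) : ℝ :=
  ν.real univ * ‖logL ν hε f‖ ^ 2 - ‖∫ x, logL ν hε f x ∂ν‖ ^ 2

/-- For fixed ε, z ↦ arsinh(Re z/ε) is Lipschitz and acts continuously on L². This lets the bounds
pass to limits before ε is sent to 0. -/
lemma continuous_logDefect {ε : ℝ} (hε : 0 < ε) :
    Continuous fun f : Lp ℂ 2 ν => logDefect hε f := by
  have h1 : Continuous (logL ν hε) := (lipschitzWith_logMap hε).continuous_compLp (logMap_zero ε)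
  have h2 : (fun f : Lp ℂ 2 ν => ∫ x, logL ν hε f x ∂ν) =
      fun f => setIntegralL ν MeasurableSet.univ (logL ν hε f) := by
    ext f
    rw [setIntegralL_apply, Measure.restrict_univ]
  refine (continuous_const.mul (h1.norm.pow 2)).sub (Continuous.pow (Continuous.norm ?_) 2)
  rw [h2]
  exact (setIntegralL ν MeasurableSet.univ).continuous.comp h1

/-- A nonnegative function with bounded logarithmic defects either is positive almost everywhere
or vanishes almost everywhere. -/
lemma pos_or_zero_of_logDefect_le {f : Lp ℂ 2 ν} (hf : f ∈ posCone ν) {B : ℝ}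
    (hB : ∀ ε (hε : 0 < ε), logDefect hε f ≤ B) :
    (∀ᵐ x ∂ν, 0 < (f x).re) ∨ ∀ᵐ x ∂ν, (f x).re = 0 := by
  have hfm : Measurable fun x => (f x).re :=
    Complex.measurable_re.comp (Lp.stronglyMeasurable f).measurable
  set Z : Set X := {x | (f x).re ≤ 0} with hZ
  have hZm : MeasurableSet Z := hfm measurableSet_Iic
  rcases eq_or_ne (ν Z) 0 with h0 | h0
  · left
    filter_upwards [measure_eq_zero_iff_ae_notMem.1 h0] with x hx
    simpa [hZ] using hx
  right
  have hz : 0 < ν.real Z := ENNReal.toReal_pos h0 (measure_ne_top _ _)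
  -- The logarithm vanishes on the zero set Z, so Cauchy–Schwarz on the complement leaves ν(Z)‖·‖²
  -- in the variance.
  have hdef : ∀ ε (hε : 0 < ε), ν.real Z * ‖logL ν hε f‖ ^ 2 ≤ B := fun ε hε => by
    have h1 : ∫ x, logL ν hε f x ∂ν = ∫ x in Zᶜ, logL ν hε f x ∂ν := by
      refine (setIntegral_eq_integral_of_ae_compl_eq_zero ?_).symm
      filter_upwards [hf, logL_apply hε f] with x h1 h2 h3
      have h4 : (f x).re = 0 := le_antisymm (by simpa [hZ] using h3) h1.1
      rw [h2, logMap, h4]; simp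
    have h2 := norm_setIntegralL_sq_le ν hZm.compl (logL ν hε f)
    have h3 := hB ε hε
    have h4 := measureReal_compl (μ := ν) hZm
    rw [logDefect, h1] at h3
    rw [h4] at h2
    linarith
  have hS : ∀ n : ℕ, ∀ᵐ x ∂ν, (f x).re < ((n : ℝ) + 1)⁻¹ := fun n => by
    set η : ℝ := ((n : ℝ) + 1)⁻¹ with hη
    have hη0 : 0 < η := by positivity
    set S : Set X := {x | η ≤ (f x).re} with hS
    have hSm : MeasurableSet S := hfm measurableSet_Ici
    have hS0 : ν.real S = 0 := by
      by_contra hne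
      have hs : 0 < ν.real S := lt_of_le_of_ne measureReal_nonneg (Ne.symm hne)
      -- With ε = η / sinh L the logarithm is at least L on S, and L is chosen so that ν(Z) ν(S) L²
      -- exceeds B.
      set L : ℝ := (|B| + 1) / (ν.real Z * ν.real S) + 1 with hL
      have hL1 : 1 ≤ L := le_add_of_nonneg_left (by positivity)
      have hsL : 0 < Real.sinh L := Real.sinh_pos_iff.2 (by linarith)
      have hε : 0 < η / Real.sinh L := by positivity
      have h1 : ν.real S * L ^ 2 ≤ ‖logL ν hε f‖ ^ 2 := by
        rw [norm_sq_eq_integral]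
        have h2 : ∫ x in S, L ^ 2 ∂ν ≤ ∫ x in S, ‖logL ν hε f x‖ ^ 2 ∂ν := by
          refine setIntegral_mono_on_ae integrableOn_const (integrable_norm_sq _).integrableOn hSm ?_
          filter_upwards [logL_apply hε f] with x h2 h3
          have h4 : η ≤ (f x).re := h3
          have h5 : L ≤ Real.arsinh ((f x).re / (η / Real.sinh L)) := by
            rw [← Real.arsinh_sinh L, Real.arsinh_le_arsinh, Real.arsinh_sinh, div_div_eq_mul_div,
              le_div_iff₀ hη0]
            nlinarith
          rw [h2, logMap, Complex.norm_real, Real.norm_eq_abs, sq_abs]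
          exact pow_le_pow_left₀ (by linarith) h5 2
        rw [setIntegral_const, smul_eq_mul] at h2
        exact h2.trans (setIntegral_le_integral (integrable_norm_sq _)
          (Eventually.of_forall fun x => sq_nonneg _))
      have h2 := hdef _ hε
      have h3 := mul_le_mul_of_nonneg_left h1 hz.le
      have h4 : (ν.real Z * ν.real S) * L = |B| + 1 + ν.real Z * ν.real S := by
        rw [hL]; field_simp
      have h5 : (ν.real Z * ν.real S) * L ≤ (ν.real Z * ν.real S) * L ^ 2 := by
        refine mul_le_mul_of_nonneg_left ?_ (by positivity)
        nlinarith
      have h6 : 0 < ν.real Z * ν.real S := by positivity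
      linarith [le_abs_self B]
    rw [measureReal_eq_zero_iff] at hS0
    filter_upwards [measure_eq_zero_iff_ae_notMem.1 hS0] with x hx
    simpa [hS] using hx
  filter_upwards [hf, ae_all_iff.2 hS] with x h1 h2
  refine le_antisymm ?_ h1.1
  refine ge_of_tendsto' (tendsto_one_div_add_atTop_nhds_zero_nat (𝕜 := ℝ)) fun n => ?_
  rw [one_div]
  exact (h2 n).le

end LogDefect

/-! ### Convex exhaustion and cutoff functions -/

section Exhaustion

variable {d : ℕ} {D : Set (Pt d)}

lemma exists_convex_exhaustion (hd : 1 ≤ d) (hD : IsOpen D) (hconv : Convex ℝ D)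
    (hb : Bornology.IsBounded D) :
    ∃ C : ℕ → Set (Pt d), (∀ n, IsCompact (C n)) ∧ (∀ n, Convex ℝ (C n)) ∧ (∀ n, C n ⊆ D) ∧
      Monotone C ∧ ⋃ n, C n = D := by
  have hne : (Dᶜ).Nonempty := by
    rw [nonempty_compl]
    rintro rfl
    have : Nonempty (Fin d) := ⟨⟨0, hd⟩⟩
    exact NormedSpace.unbounded_univ ℝ (Pt d) hb
  have hsub : ∀ n : ℕ, {x | ((n : ℝ) + 1)⁻¹ ≤ Metric.infDist x Dᶜ} ⊆ D := fun n x hx => by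
    by_contra h
    have h1 : ((n : ℝ) + 1)⁻¹ ≤ Metric.infDist x Dᶜ := hx
    rw [Metric.infDist_zero_of_mem h] at h1
    have : 0 < ((n : ℝ) + 1)⁻¹ := by positivity
    linarith
  refine ⟨fun n => {x | ((n : ℝ) + 1)⁻¹ ≤ Metric.infDist x Dᶜ}, fun n => ?_, fun n => ?_, hsub,
    fun m n hmn x hx => ?_, Subset.antisymm (iUnion_subset hsub) fun x hx => ?_⟩
  · exact Metric.isCompact_of_isClosed_isBounded
      (isClosed_le continuous_const (Metric.continuous_infDist_pt _)) (hb.subset (hsub n))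
  · intro x hx y hy α β hα hβ hαβ
    have hx' := (Metric.le_infDist hne).1 hx
    have hy' := (Metric.le_infDist hne).1 hy
    refine (Metric.le_infDist hne).2 fun q hq => ?_
    by_contra! h
    -- If q outside D were too close to αx + βy, translating x and y by q - (αx + βy) would keep
    -- both in D, and q is the convex combination of the translates.
    have key : ∀ p : Pt d, (∀ ⦃y⦄, y ∈ Dᶜ → ((n : ℝ) + 1)⁻¹ ≤ dist p y) →
        p + (q - (α • x + β • y)) ∈ D := fun p hp => by
      by_contra h'
      have h1 := hp h'
      rw [dist_self_add_right, ← dist_eq_norm, dist_comm] at h1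
      linarith
    refine hq ?_
    have := hconv (key x hx') (key y hy') hα hβ hαβ
    rw [smul_add, smul_add, add_add_add_comm, ← add_smul, hαβ, one_smul, add_sub_cancel] at this
    exact this
  · have h1 : ((m : ℝ) + 1)⁻¹ ≤ Metric.infDist x Dᶜ := hx
    refine le_trans (inv_anti₀ (by positivity) ?_) h1
    have : (m : ℝ) ≤ n := by exact_mod_cast hmn
    linarith
  · have h1 : 0 < Metric.infDist x Dᶜ :=
      (hD.isClosed_compl.notMem_iff_infDist_pos hne).1 (by simpa using hx)
    obtain ⟨n, hn⟩ := exists_nat_one_div_lt h1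
    rw [one_div] at hn
    exact mem_iUnion.2 ⟨n, hn.le⟩

open scoped Manifold in
lemma exists_cutoff (hD : IsOpen D) {K : Set (Pt d)} (hK : IsCompact K) (hKD : K ⊆ D) :
    ∃ φ : Pt d → ℝ, IsTestFunction D φ ∧ ∀ x ∈ K, φ x = 1 := by
  obtain ⟨L, hL, hKL, hLD⟩ := exists_compact_between hK hD hKD
  obtain ⟨f, hf0, hf1, -⟩ := exists_contMDiffMap_zero_one_of_isClosed (n := (⊤ : ℕ∞)) 𝓘(ℝ, Pt d)
    isOpen_interior.isClosed_compl hK.isClosed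
    (disjoint_left.2 fun x hx hx' => hx (hKL hx'))
  have hs : tsupport f ⊆ L := by
    refine closure_minimal (fun x hx => ?_) hL.isClosed
    by_contra h
    exact hx (hf0 fun h' => h (interior_subset h'))
  exact ⟨f, ⟨contMDiff_iff_contDiff.1 f.contMDiff,
    hL.of_isClosed_subset (isClosed_tsupport _) hs, hs.trans hLD⟩, fun x hx => hf1 hx⟩

end Exhaustion

/-! ### Uniform positivity of supersolutions -/

section Compactness

variable {d : ℕ} {D : Set (Pt d)}

/-- The restriction operator `L²(D) → L²(C)`. -/
abbrev restrictL (D C : Set (Pt d)) :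
    Lp ℂ 2 (volume.restrict D) →L[ℂ] Lp ℂ 2 ((volume.restrict D).restrict C) :=
  LpToLpRestrictCLM (Pt d) ℂ ℂ (volume.restrict D) 2 C

/-- Wirtinger's inequality on C applied to arsinh(u/ε), with its gradient controlled through a
cutoff equal to 1 on C. The cutoff depends on C and D alone, hence the uniformity of B. -/
lemma exists_logDefect_le [IsFiniteMeasure (volume.restrict D)] (hD : IsOpen D)
    (κmin κmax M : ℝ) (hκ : 0 < κmin) {C : Set (Pt d)} (hC : IsCompact C)
    (hCc : Convex ℝ C) (hCD : C ⊆ D) :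
    ∃ B, ∀ κ b (u : H10 D), IsCoeff D κmin κmax M κ b → IsNonneg u →
      (∀ v : H10 D, IsNonneg v → 0 ≤ (form κ b u v).re) → ∀ ε (hε : 0 < ε),
        logDefect hε (restrictL D C (H10.val u)) ≤ B := by
  obtain ⟨φ, hφ, hφ1⟩ := exists_cutoff hD hC hCD
  obtain ⟨δ, hδ⟩ := Metric.isBounded_iff.1 hC.isBounded
  refine ⟨δ ^ 2 * volume.real (Metric.closedBall (0 : Pt d) δ) * (2 / κmin *
    ∫ x in D, (Real.pi ^ 2 * κmax ^ 2 / κmin *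
            ‖(WithLp.toLp 2 fun i => partialDeriv i φ x : Pt d)‖ ^ 2 +
          Real.pi ^ 2 * M ^ 2 / (4 * κmin) * φ x ^ 2)), fun κ b u h hu0 hu ε hε => ?_⟩
  obtain ⟨w, hw, hi, hle⟩ := h.log_estimate hu0 hu hε hφ
  have hCm := hC.measurableSet
  have h1 := H10.wirtinger hD w hCc hCm (δ := δ) fun x hx y hy => by
    rw [← dist_eq_norm]; exact hδ hy hx
  have h2 : ∫ x in C, ‖H10.grad w x‖ ^ 2 ∂(volume.restrict D) ≤
      ∫ x in D, φ x ^ 2 * ‖H10.grad w x‖ ^ 2 := by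
    rw [setIntegral_congr_fun (g := fun x => φ x ^ 2 * ‖H10.grad w x‖ ^ 2) hCm fun x hx => by
      simp [hφ1 x hx]]
    exact setIntegral_le_integral hi (Eventually.of_forall fun x => by positivity)
  have h3 : ∫ x in C, ‖H10.grad w x‖ ^ 2 ∂(volume.restrict D) ≤ 2 / κmin *
      ∫ x in D, (Real.pi ^ 2 * κmax ^ 2 / κmin *
            ‖(WithLp.toLp 2 fun i => partialDeriv i φ x : Pt d)‖ ^ 2 +
          Real.pi ^ 2 * M ^ 2 / (4 * κmin) * φ x ^ 2) := by
    rw [div_mul_eq_mul_div, le_div_iff₀ hκ]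
    have := mul_le_mul_of_nonneg_right h2 hκ.le
    linarith
  have h4 : logL _ hε (restrictL D C (H10.val u)) =ᵐ[(volume.restrict D).restrict C]
      H10.val w := by
    filter_upwards [logL_apply hε (restrictL D C (H10.val u)),
      LpToLpRestrictCLM_coeFn ℂ C (H10.val u), ae_restrict_of_ae hw] with x e1 e2 e3
    rw [e1, e2, e3, logMap]
  have h5 : ((volume.restrict D).restrict C).real univ = volume.real C := by
    rw [measureReal_restrict_apply_univ, measureReal_restrict_apply hCm, inter_eq_left.2 hCD]
  have h6 : ∫ x, ‖logL _ hε (restrictL D C (H10.val u)) x‖ ^ 2 ∂((volume.restrict D).restrict C) =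
      ∫ x in C, ‖H10.val w x‖ ^ 2 ∂(volume.restrict D) :=
    integral_congr_ae (by filter_upwards [h4] with x hx; rw [hx])
  rw [logDefect, norm_sq_eq_integral, h6, integral_congr_ae h4, h5]
  refine h1.trans (mul_le_mul_of_nonneg_left h3 (by positivity))

/-- The normalised nonnegative supersolutions with energy bound `Λ`, for all coefficients in the
class. -/
def superStates (D : Set (Pt d)) (κmin κmax M Λ : ℝ) : Set (Lp ℂ 2 (volume.restrict D)) :=
  {f | ∃ κ b, ∃ u : H10 D, IsCoeff D κmin κmax M κ b ∧ IsNonneg u ∧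
    (∀ v : H10 D, IsNonneg v → 0 ≤ (form κ b u v).re) ∧ ‖H10.val u‖ = 1 ∧ ‖H10.grad u‖ ≤ Λ ∧
    H10.val u = f}

/-- Norm, sign and variance bounds are closed conditions, so they hold on the closure, and on each
set of the convex exhaustion the limit is positive or zero. If positivity fails on one set it fails
on all larger ones; then f = 0, against norm 1. -/
lemma pos_of_mem_closure_superStates (hd : 1 ≤ d) (hD : IsOpen D) (hconv : Convex ℝ D)
    (hb : Bornology.IsBounded D) {κmin κmax M Λ : ℝ} (hκ : 0 < κmin)
    {f : Lp ℂ 2 (volume.restrict D)} (hf : f ∈ closure (superStates D κmin κmax M Λ)) :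
    ‖f‖ = 1 ∧ f ∈ posCone (volume.restrict D) ∧ ∀ᵐ x ∂(volume.restrict D), 0 < (f x).re := by
  have := isFiniteMeasure_restrict hb
  have hclosed : ∀ {s : Set (Lp ℂ 2 (volume.restrict D))}, IsClosed s →
      superStates D κmin κmax M Λ ⊆ s → f ∈ s := fun hs h => closure_minimal h hs hf
  have hf1 : ‖f‖ = 1 := hclosed (s := {f | ‖f‖ = 1}) (isClosed_eq continuous_norm continuous_const)
    fun g ⟨κ, b, u, h1, h2, h3, h4, h5, h6⟩ => h6 ▸ h4
  have hf2 : f ∈ posCone (volume.restrict D) := hclosed isClosed_posCone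
    fun g ⟨κ, b, u, h1, h2, h3, h4, h5, h6⟩ => h6 ▸ h2
  refine ⟨hf1, hf2, ?_⟩
  obtain ⟨C, hC, hCc, hCD, hCm, hCU⟩ := exists_convex_exhaustion hd hD hconv hb
  have hdich : ∀ n, (∀ᵐ x ∂((volume.restrict D).restrict (C n)), 0 < (f x).re) ∨
      ∀ᵐ x ∂((volume.restrict D).restrict (C n)), (f x).re = 0 := fun n => by
    obtain ⟨B, hB⟩ := exists_logDefect_le hD κmin κmax M hκ (hC n) (hCc n) (hCD n)
    have hr := LpToLpRestrictCLM_coeFn ℂ (C n) f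
    have h1 : restrictL D (C n) f ∈ posCone ((volume.restrict D).restrict (C n)) := by
      filter_upwards [hr, ae_restrict_of_ae hf2] with x e1 e2
      rw [e1]; exact e2
    refine (pos_or_zero_of_logDefect_le h1 (B := B) fun ε hε => ?_).imp (fun h => ?_) fun h => ?_
    · exact hclosed (s := {f | logDefect hε (restrictL D (C n) f) ≤ B})
        (isClosed_le ((continuous_logDefect hε).comp (restrictL D (C n)).continuous)
          continuous_const) fun g ⟨κ, b, u, h1, h2, h3, h4, h5, h6⟩ => h6 ▸ hB κ b u h1 h2 h3 ε hε
    · filter_upwards [hr, h] with x e1 e2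
      rwa [e1] at e2
    · filter_upwards [hr, h] with x e1 e2
      rwa [e1] at e2
  have hUn : ∀ {p : Pt d → Prop}, (∀ n, ∀ᵐ x ∂((volume.restrict D).restrict (C n)), p x) →
      ∀ᵐ x ∂(volume.restrict D), p x := fun h => by
    have h1 := (ae_restrict_iUnion_iff (μ := volume.restrict D) C _).2 h
    rwa [hCU, Measure.restrict_restrict hD.measurableSet, inter_self] at h1
  by_contra hcon
  have hmono : ∀ {p : Pt d → Prop} {m n : ℕ}, m ≤ n →
      (∀ᵐ x ∂((volume.restrict D).restrict (C n)), p x) →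
        ∀ᵐ x ∂((volume.restrict D).restrict (C m)), p x := fun hmn h =>
    ae_restrict_of_ae_restrict_of_subset (hCm hmn) h
  obtain ⟨m, hm⟩ : ∃ m, ¬ ∀ᵐ x ∂((volume.restrict D).restrict (C m)), 0 < (f x).re := by
    by_contra! h
    exact hcon (hUn h)
  have hz : ∀ n, m ≤ n → ∀ᵐ x ∂((volume.restrict D).restrict (C n)), (f x).re = 0 := fun n hn =>
    (hdich n).resolve_left fun h => hm (hmono hn h)
  have h0 : ∀ᵐ x ∂(volume.restrict D), (f x).re = 0 :=
    hUn fun n => hmono (le_max_right m n) (hz _ (le_max_left m n))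
  have h1 : f = 0 := by
    refine Lp.ext ?_
    filter_upwards [h0, hf2, Lp.coeFn_zero ℂ 2 (volume.restrict D)] with x e1 e2 e3
    rw [e3]
    exact Complex.ext e1 e2.2
  rw [h1, norm_zero] at hf1
  exact zero_ne_one hf1

lemma re_inner_pos {X : Type*} [MeasurableSpace X] {μ : Measure X} {f g : Lp ℂ 2 μ} (hg0 : g ≠ 0)
    (hf : ∀ᵐ x ∂μ, 0 < (f x).re) (hf' : f ∈ posCone μ) (hg : g ∈ posCone μ) :
    0 < (inner ℂ f g : ℂ).re ∧ (inner ℂ f g : ℂ).im = 0 := by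
  have hi := L2.integrable_inner (𝕜 := ℂ) f g
  have hpt : ∀ᵐ x ∂μ, (inner ℂ (f x) (g x) : ℂ) = (((f x).re * (g x).re : ℝ) : ℂ) := by
    filter_upwards [hf', hg] with x h1 h2
    rw [RCLike.inner_apply]
    refine Complex.ext ?_ ?_ <;> simp [h1.2, h2.2, mul_comm]
  have hi' : Integrable (fun x => (f x).re * (g x).re) μ := by
    refine hi.re.congr ?_
    filter_upwards [hpt] with x hx
    change RCLike.re (inner ℂ (f x) (g x) : ℂ) = _
    rw [hx]
    exact Complex.ofReal_re _
  have he : (inner ℂ f g : ℂ) = ((∫ x, (f x).re * (g x).re ∂μ : ℝ) : ℂ) := by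
    rw [L2.inner_def, integral_congr_ae hpt, integral_complex_ofReal]
  rw [he, Complex.ofReal_re, Complex.ofReal_im]
  have h0 : 0 ≤ᵐ[μ] fun x => (f x).re * (g x).re := by
    filter_upwards [hf, hg] with x h1 h2
    exact mul_nonneg h1.le h2.1
  refine ⟨lt_of_le_of_ne (integral_nonneg_of_ae h0) fun h => hg0 ?_, rfl⟩
  have h1 := (integral_eq_zero_iff_of_nonneg_ae h0 hi').1 h.symm
  refine Lp.ext ?_
  filter_upwards [h1, hf, hg, Lp.coeFn_zero ℂ 2 μ] with x e1 e2 e3 e4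
  rw [e4]
  exact Complex.ext ((mul_eq_zero.1 e1).resolve_left e2.ne') e3.2

/-- By Rellich the closure of the states is compact, so the pairing attains its minimum there, at
two functions that are positive almost everywhere. The states f and g may belong to different
coefficients. -/
theorem exists_pairing_ge (hd : 1 ≤ d) (hD : IsOpen D) (hconv : Convex ℝ D)
    (hb : Bornology.IsBounded D) {κmin : ℝ} (κmax M Λ : ℝ) (hκ : 0 < κmin) :
    ∃ δ : ℝ, 0 < δ ∧ ∀ f ∈ superStates D κmin κmax M Λ, ∀ g ∈ superStates D κmin κmax M Λ,
      δ ≤ (inner ℂ f g : ℂ).re := by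
  have hK : IsCompact (closure (superStates D κmin κmax M Λ)) := by
    have h1 := (isCompactOperator_valL hd hD hb).isCompact_closure_image_closedBall
      (f := (valL D).toLinearMap) (1 + Λ ^ 2)
    refine h1.of_isClosed_subset isClosed_closure (closure_mono ?_)
    rintro f ⟨κ, b, u, h1, h2, h3, h4, h5, h6⟩
    refine ⟨u, ?_, h6⟩
    rw [mem_closedBall_zero_iff]
    have h7 := H10.norm_sq u
    rw [h4] at h7
    have h8 : ‖H10.grad u‖ ^ 2 ≤ Λ ^ 2 := pow_le_pow_left₀ (norm_nonneg _) h5 2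
    nlinarith [norm_nonneg u, sq_nonneg Λ]
  rcases (closure (superStates D κmin κmax M Λ)).eq_empty_or_nonempty with he | hne
  · refine ⟨1, one_pos, fun f hf => ?_⟩
    have := subset_closure hf
    rw [he] at this
    exact this.elim
  obtain ⟨⟨f, g⟩, ⟨hf, hg⟩, hmin⟩ := (hK.prod hK).exists_isMinOn (hne.prod hne)
    (f := fun p => (inner ℂ p.1 p.2 : ℂ).re)
    (Complex.continuous_re.comp (continuous_fst.inner continuous_snd)).continuousOn
  obtain ⟨f1, f2, f3⟩ := pos_of_mem_closure_superStates hd hD hconv hb hκ hf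
  obtain ⟨g1, g2, g3⟩ := pos_of_mem_closure_superStates hd hD hconv hb hκ hg
  refine ⟨_, (re_inner_pos (norm_ne_zero_iff.1 (g1 ▸ one_ne_zero)) f3 f2 g2).1,
    fun f' hf' g' hg' => ?_⟩
  exact hmin (mk_mem_prod (subset_closure hf') (subset_closure hg'))

end Compactness

/-! ### The principal eigenvalue -/

section Principal

lemma ae_re_nonneg {X : Type*} [MeasurableSpace X] {μ : Measure X} {f : Lp ℂ 2 μ}
    (hf : f ∈ posCone μ) : ∀ᵐ x ∂μ, 0 ≤ (f x).re := by
  filter_upwards [hf] with x hx using hx.1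

lemma re_inner_nonneg {X : Type*} [MeasurableSpace X] {μ : Measure X} {f g : Lp ℂ 2 μ}
    (hf : f ∈ posCone μ) (hg : ∀ᵐ x ∂μ, 0 ≤ (g x).re) : 0 ≤ (inner ℂ f g : ℂ).re := by
  have hi := L2.integrable_inner (𝕜 := ℂ) f g
  have he : (inner ℂ f g : ℂ).re = ∫ x, (inner ℂ (f x) (g x) : ℂ).re ∂μ := by
    rw [L2.inner_def]
    exact (Complex.reCLM.integral_comp_comm hi).symm
  rw [he]
  refine integral_nonneg_of_ae ?_
  filter_upwards [hf, hg] with x h1 h2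
  rw [RCLike.inner_apply, Complex.mul_re, Complex.conj_re, Complex.conj_im, h1.2]
  simpa using mul_nonneg h2 h1.1

variable {d : ℕ} {D : Set (Pt d)} {κmin κmax M : ℝ} {κ : Pt d → ℝ} {b : Pt d → Pt d}

lemma IsCoeff.form_sub_left (h : IsCoeff D κmin κmax M κ b) (u₁ u₂ v : H10 D) :
    form κ b (u₁ - u₂) v = form κ b u₁ v - form κ b u₂ v := by
  obtain ⟨T1, hT1⟩ := h.exists_mulκ
  obtain ⟨T2, hT2⟩ := h.exists_dot
  have e : H10.grad (u₁ - u₂) = H10.grad u₁ - H10.grad u₂ := rfl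
  simp only [form, formA_eq_inner hT1, formB_eq_inner hT2, e, map_sub, inner_sub_right]
  ring

lemma IsCoeff.form_smul_left (h : IsCoeff D κmin κmax M κ b) (c : ℂ) (u v : H10 D) :
    form κ b (c • u) v = c * form κ b u v := by
  obtain ⟨T1, hT1⟩ := h.exists_mulκ
  obtain ⟨T2, hT2⟩ := h.exists_dot
  have e : H10.grad (c • u) = c • H10.grad u := rfl
  simp only [form, formA_eq_inner hT1, formB_eq_inner hT2, e, map_smul, inner_smul_right]
  ring

lemma IsCoeff.neg (h : IsCoeff D κmin κmax M κ b) : IsCoeff D κmin κmax M κ (-b) where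
  pos := h.pos
  diff := h.diff
  nonneg := h.nonneg
  meas := h.meas.neg
  bound := by
    filter_upwards [h.bound] with x hx
    rwa [Pi.neg_apply, norm_neg]
  div_free φ hφ := by
    simp only [Pi.neg_apply, map_neg, integral_neg, h.div_free φ hφ, neg_zero]

lemma IsCoeff.form_conj (h : IsCoeff D κmin κmax M κ b) (u v : H10 D) :
    form κ b v u = (starRingEnd ℂ) (form κ (-b) u v) := by
  have e : formB (-b) u v = -formB b u v := by
    simp [formB, ← integral_neg, Finset.sum_neg_distrib]
  rw [form, form, map_add, ← formA_conj, e, map_neg, h.formB_skew v u]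

/-- `(μ, u)` is a normalised eigenpair of `-∇·(κ∇u) + b·∇u`. -/
def IsEig (κ : Pt d → ℝ) (b : Pt d → Pt d) (μ : ℂ) (u : H10 D) : Prop :=
  ‖H10.val u‖ = 1 ∧ ∀ v : H10 D, form κ b u v = μ * pairing u v

lemma IsEig.form_self {μ : ℂ} {u : H10 D} (hu : IsEig κ b μ u) : form κ b u u = μ := by
  rw [hu.2, pairing, inner_self_eq_norm_sq_to_K, hu.1]
  simp

lemma IsCoeff.re_form_self (h : IsCoeff D κmin κmax M κ b) (u : H10 D) :
    (form κ b u u).re = (formA κ u u).re := by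
  rw [form, Complex.add_re, h.re_formB_self, add_zero]

lemma IsEig.re_form_nonneg {lam : ℝ} (hlam : 0 ≤ lam) {u : H10 D} (hu : IsEig κ b (lam : ℂ) u)
    (hu0 : IsNonneg u) (v : H10 D) (hv : IsNonneg v) : 0 ≤ (form κ b u v).re := by
  rw [hu.2, Complex.re_ofReal_mul]
  exact mul_nonneg hlam (re_inner_nonneg hv (hu0.mono fun x hx => hx.1))

lemma IsEig.norm_grad_le (h : IsCoeff D κmin κmax M κ b) {lam : ℝ} {u : H10 D}
    (hu : IsEig κ b (lam : ℂ) u) {C : ℝ} (hC : lam ≤ C) : ‖H10.grad u‖ ≤ √(C / κmin) := by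
  have h1 := h.form_self_ge u
  rw [← h.re_form_self, hu.form_self, Complex.ofReal_re] at h1
  refine Real.le_sqrt_of_sq_le ?_
  rw [le_div_iff₀ h.pos]
  linarith

lemma IsCoeff.isNonneg_of_form_eq (h : IsCoeff D κmin κmax M κ b) (hd : 1 ≤ d) (hD : IsOpen D)
    (hb : Bornology.IsBounded D) {f : Lp ℂ 2 (volume.restrict D)}
    (hf : f ∈ posCone (volume.restrict D)) {u : H10 D}
    (hu : ∀ v : H10 D, form κ b u v = inner ℂ (H10.val v) f) : IsNonneg u := by
  have hre0 := h.re_nonneg hd hD hb (u := u) fun v hv => by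
    rw [hu]
    exact re_inner_nonneg hv (ae_re_nonneg hf)
  -- The source is real, so ±i u also meets the maximum principle, with a right-hand side of zero
  -- real part; the two signs kill the imaginary part.
  have him : ∀ s : ℝ, ∀ᵐ x ∂(volume.restrict D), 0 ≤ (((s : ℂ) * Complex.I) * H10.val u x).re :=
    fun s => by
    have h1 := h.re_nonneg hd hD hb (u := ((s : ℂ) * Complex.I) • u) fun v hv => by
      rw [h.form_smul_left, hu, ← inner_smul_right]
      refine re_inner_nonneg hv ?_
      filter_upwards [Lp.coeFn_smul ((s : ℂ) * Complex.I) f, hf] with x e1 e2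
      rw [e1, Pi.smul_apply, smul_eq_mul]
      simp [e2.2]
    filter_upwards [h1, Lp.coeFn_smul ((s : ℂ) * Complex.I) (H10.val u)] with x e1 e2
    have e5 : H10.val (((s : ℂ) * Complex.I) • u) x = ((s : ℂ) * Complex.I) * H10.val u x := e2
    rwa [e5] at e1
  filter_upwards [hre0, him 1, him (-1)] with x e2 e3 e4
  refine ⟨e2, ?_⟩
  simp at e3 e4
  linarith

/-- Comparison: solutions of the source problem dominate. -/
lemma IsCoeff.exists_dominating (h : IsCoeff D κmin κmax M κ b) (hd : 1 ≤ d) (hD : IsOpen D)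
    (hb : Bornology.IsBounded D) {μ : ℂ} {w w' : H10 D}
    (hw : ∀ v : H10 D, form κ b w v = μ * pairing w v)
    (hw' : H10.val w' =ᵐ[volume.restrict D] fun x => (‖H10.val w x‖ : ℂ)) :
    ∃ S : H10 D, (∀ v, form κ b S v = ‖μ‖ * pairing w' v) ∧
      H10.val S - H10.val w' ∈ posCone (volume.restrict D) := by
  obtain ⟨T, -, hT⟩ := h.exists_solution hd hD hb
  obtain ⟨S, -, hS⟩ := hT ((‖μ‖ : ℂ) • H10.val w')
  have hS' : ∀ v, form κ b S v = ‖μ‖ * pairing w' v := fun v => by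
    rw [hS, inner_smul_right, pairing]
  refine ⟨S, hS', ?_⟩
  -- For constant z, L(|z|S - z w) = |z||μ||w| - zμw has nonnegative real part. A countable dense
  -- set of z gives a common null set, after which z may be chosen pointwise as the conjugate of
  -- w(x), yielding |w| ≤ S.
  have hdom : ∀ z : ℂ, ∀ᵐ x ∂(volume.restrict D),
      0 ≤ ((‖z‖ : ℂ) * H10.val S x - z * H10.val w x).re := fun z => by
    have h1 := h.re_nonneg hd hD hb (u := (‖z‖ : ℂ) • S - z • w) fun v hv => by
      rw [h.form_sub_left, h.form_smul_left, h.form_smul_left, hS', hw, pairing, pairing,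
        ← mul_assoc, ← mul_assoc, ← inner_smul_right, ← inner_smul_right, ← inner_sub_right]
      refine re_inner_nonneg hv ?_
      filter_upwards [Lp.coeFn_sub (((‖z‖ : ℂ) * (‖μ‖ : ℂ)) • H10.val w') ((z * μ) • H10.val w),
        Lp.coeFn_smul ((‖z‖ : ℂ) * (‖μ‖ : ℂ)) (H10.val w'),
        Lp.coeFn_smul (z * μ) (H10.val w), hw'] with x e1 e2 e3 e4
      rw [e1, Pi.sub_apply, e2, e3, Pi.smul_apply, Pi.smul_apply, e4, smul_eq_mul, smul_eq_mul,
        ← Complex.ofReal_mul, ← Complex.ofReal_mul, Complex.sub_re, Complex.ofReal_re, sub_nonneg,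
        ← norm_mul, ← norm_mul]
      exact Complex.re_le_norm _
    filter_upwards [h1, Lp.coeFn_sub ((‖z‖ : ℂ) • H10.val S) (z • H10.val w),
      Lp.coeFn_smul (‖z‖ : ℂ) (H10.val S), Lp.coeFn_smul z (H10.val w)] with x e1 e2 e3 e4
    have e5 : H10.val ((‖z‖ : ℂ) • S - z • w) x = (‖z‖ : ℂ) * H10.val S x - z * H10.val w x := by
      refine e2.trans ?_
      rw [Pi.sub_apply, e3, e4]; rfl
    rwa [e5] at e1
  have hSn : IsNonneg S := h.isNonneg_of_form_eq hd hD hb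
    (isGenCone_posCone.smul ‖μ‖ (norm_nonneg _) _ (hw'.mono fun x hx => by
      rw [hx]; exact ⟨norm_nonneg _, Complex.ofReal_im _⟩)) hS
  filter_upwards [ae_all_iff.2 fun n => hdom (TopologicalSpace.denseSeq ℂ n), hSn,
    Lp.coeFn_sub (H10.val S) (H10.val w'), hw'] with x e1 ⟨e2, e7⟩ e5 e6
  have e8 : ∀ z : ℂ, 0 ≤ ((‖z‖ : ℂ) * H10.val S x - z * H10.val w x).re := by
    have hc : IsClosed {z : ℂ | 0 ≤ ((‖z‖ : ℂ) * H10.val S x - z * H10.val w x).re} :=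
      isClosed_le continuous_const (by fun_prop)
    intro z
    exact hc.closure_subset_iff.2 (by rintro _ ⟨n, rfl⟩; exact e1 n)
      ((TopologicalSpace.denseRange_denseSeq ℂ) z)
  rw [e5, Pi.sub_apply, e6]
  refine ⟨?_, by simp [e7]⟩
  rw [Complex.sub_re, Complex.ofReal_re, sub_nonneg]
  rcases eq_or_ne (H10.val w x) 0 with h0 | h0
  · rw [h0, norm_zero]; exact e2
  have h1 := e8 ((starRingEnd ℂ) (H10.val w x))
  rw [Complex.sub_re, Complex.re_ofReal_mul, RCLike.norm_conj, ← Complex.normSq_eq_conj_mul_self,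
    Complex.ofReal_re, Complex.normSq_eq_norm_sq, sub_nonneg, sq] at h1
  exact le_of_mul_le_mul_left h1 (norm_pos_iff.2 h0)

theorem IsCoeff.exists_isEig (h : IsCoeff D κmin κmax M κ b) (hd : 1 ≤ d) (hD : IsOpen D)
    (hb : Bornology.IsBounded D) {C : ℝ} (hC : 0 < C) {e : H10 D} (he : IsNonneg e)
    (he0 : H10.val e ≠ 0) (hbar : ∀ v : H10 D, IsNonneg v →
      (form κ b e v).re ≤ C * (inner ℂ (H10.val v) (H10.val e) : ℂ).re) :
    ∃ lam : ℝ, 0 < lam ∧ lam ≤ C ∧ ∃ u : H10 D, IsNonneg u ∧ IsEig κ b (lam : ℂ) u := by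
  obtain ⟨T, hTc, hT⟩ := h.exists_solution hd hD hb
  have hTp : PosOp (posCone (volume.restrict D)) T := fun f hf => by
    obtain ⟨u, hu1, hu2⟩ := hT f
    exact hu1 ▸ h.isNonneg_of_form_eq hd hD hb hf hu2
  -- The barrier L e ≤ C e says L(T e - e / C) ≥ 0, and the maximum principle applies.
  have hTe : T (H10.val e) - ((C⁻¹ : ℝ) : ℂ) • H10.val e ∈ posCone (volume.restrict D) := by
    obtain ⟨w, hw1, hw2⟩ := hT (H10.val e)
    have h1 := h.re_nonneg hd hD hb (u := w - ((C⁻¹ : ℝ) : ℂ) • e) fun v hv => by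
      rw [h.form_sub_left, h.form_smul_left, hw2, Complex.sub_re, Complex.re_ofReal_mul, sub_nonneg,
        inv_mul_le_iff₀ hC]
      exact hbar v hv
    have h2 : IsNonneg w := h.isNonneg_of_form_eq hd hD hb he hw2
    rw [← hw1]
    filter_upwards [h1, h2, he, Lp.coeFn_sub (H10.val w) (((C⁻¹ : ℝ) : ℂ) • H10.val e),
      Lp.coeFn_smul ((C⁻¹ : ℝ) : ℂ) (H10.val e)] with x e1 e2 e3 e4 e5
    refine ⟨e1, ?_⟩
    rw [e4, Pi.sub_apply, e5, Pi.smul_apply, smul_eq_mul, Complex.sub_im, Complex.im_ofReal_mul,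
      e2.2, e3.2]
    simp
  obtain ⟨r, hr, f, hf, hf1, hTf⟩ := krein_rutman isGenCone_posCone hTp hTc he he0 (inv_pos.2 hC) hTe
  have hr0 : 0 < r := (inv_pos.2 hC).trans_le hr
  have hrc : (r : ℂ) ≠ 0 := by exact_mod_cast hr0.ne'
  obtain ⟨w, hw1, hw2⟩ := hT f
  have hval : H10.val ((r : ℂ)⁻¹ • w) = f := by
    change (r : ℂ)⁻¹ • H10.val w = f
    rw [hw1, hTf, inv_smul_smul₀ hrc]
  refine ⟨r⁻¹, inv_pos.2 hr0, inv_le_of_inv_le₀ hC hr, (r : ℂ)⁻¹ • w, ?_, ?_, fun v => ?_⟩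
  · change H10.val ((r : ℂ)⁻¹ • w) ∈ posCone (volume.restrict D)
    rwa [hval]
  · rw [hval, hf1]
  · rw [h.form_smul_left, hw2, pairing, hval, Complex.ofReal_inv]

lemma IsCoeff.re_formA_eq (h : IsCoeff D κmin κmax M κ b) (u v : H10 D) :
    Integrable (fun x => κ x * (inner ℂ (H10.grad v x) (H10.grad u x) : ℂ).re)
        (volume.restrict D) ∧
      (formA κ u v).re = ∫ x in D, κ x * (inner ℂ (H10.grad v x) (H10.grad u x) : ℂ).re := by
  have h0 : IsCoeff D κmin κmax M κ 0 := ⟨h.pos, h.diff, h.nonneg, aestronglyMeasurable_const,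
    Eventually.of_forall fun x => by simpa using h.nonneg, fun φ hφ => by simp⟩
  have h1 := h0.integrable_formDensity u v
  have e1 : formDensity κ 0 u v =
      fun x => κ x * (inner ℂ (H10.grad v x) (H10.grad u x) : ℂ).re := by
    ext x; simp [formDensity]
  have e2 : form κ 0 u v = formA κ u v := by simp [form, formB]
  rwa [e1, e2] at h1

lemma IsEig.mem_superStates (h : IsCoeff D κmin κmax M κ b) {lam : ℝ} (hlam : 0 ≤ lam)
    {u : H10 D} (hu : IsEig κ b (lam : ℂ) u) (hu0 : IsNonneg u) {Λ : ℝ} (hΛ : ‖H10.grad u‖ ≤ Λ) :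
    H10.val u ∈ superStates D κmin κmax M Λ :=
  ⟨κ, b, u, h, hu0, hu.re_form_nonneg hlam hu0, hu.1, hΛ, rfl⟩

lemma IsEig.pos (h : IsCoeff D κmin κmax M κ b) (hd : 1 ≤ d) (hD : IsOpen D) (hconv : Convex ℝ D)
    (hb : Bornology.IsBounded D) {lam : ℝ} (hlam : 0 ≤ lam) {u : H10 D}
    (hu : IsEig κ b (lam : ℂ) u) (hu0 : IsNonneg u) :
    ∀ᵐ x ∂(volume.restrict D), 0 < (H10.val u x).re :=
  (pos_of_mem_closure_superStates hd hD hconv hb h.pos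
    (subset_closure (hu.mem_superStates h hlam hu0 le_rfl))).2.2

lemma IsCoeff.mul_pairing_dual (h : IsCoeff D κmin κmax M κ b) {lam : ℝ} {us : H10 D}
    (hus : IsEig κ (-b) (lam : ℂ) us) (S : H10 D) : form κ b S us = lam * pairing S us := by
  rw [h.form_conj, hus.2, map_mul, Complex.conj_ofReal, pairing, pairing, inner_conj_symm]

/-- An eigenvalue with a nonnegative eigenfunction and a nonnegative dual eigenfunction is the
strict minimum of the moduli of all eigenvalues. -/
theorem IsCoeff.le_norm_of_isEig (h : IsCoeff D κmin κmax M κ b) (hd : 1 ≤ d) (hD : IsOpen D)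
    (hconv : Convex ℝ D) (hb : Bornology.IsBounded D) {lam : ℝ} (hlam : 0 < lam) {us : H10 D}
    (hus : IsEig κ (-b) (lam : ℂ) us) (hus0 : IsNonneg us) {μ : ℂ} {w : H10 D}
    (hw : IsEig κ b μ w) : lam ≤ ‖μ‖ ∧ (‖μ‖ = lam → μ = lam) := by
  have hpos := hus.pos h.neg hd hD hconv hb hlam.le hus0
  obtain ⟨w', hw1, hw2⟩ := H10.exists_abs w
  have hwn : IsNonneg w' := by
    filter_upwards [hw1] with x hx
    rw [hx]; exact ⟨norm_nonneg _, Complex.ofReal_im _⟩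
  have hw'1 : ‖H10.val w'‖ = 1 := by
    refine Eq.trans ?_ hw.1
    refine le_antisymm (Lp.norm_le_norm_of_ae_le ?_) (Lp.norm_le_norm_of_ae_le ?_) <;>
    · filter_upwards [hw1] with x hx
      rw [hx]; simp
  obtain ⟨S, hS, hSw⟩ := h.exists_dominating hd hD hb hw.2 hw1
  have e1 := h.mul_pairing_dual hus S
  rw [hS] at e1
  have hp := (re_inner_pos (norm_ne_zero_iff.1 (hw'1 ▸ one_ne_zero)) hpos hus0 hwn).1
  have hq := re_inner_nonneg hus0 (ae_re_nonneg hSw)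
  -- Testing L S = |μ||w| with the dual eigenfunction: the excess S - |w| is nonnegative and the
  -- pairing of `us` with |w| is positive, so λ ≤ |μ|, with equality only if S = |w|.
  have e2 : ‖μ‖ * (inner ℂ (H10.val us) (H10.val w') : ℂ).re =
      lam * ((inner ℂ (H10.val us) (H10.val w') : ℂ).re +
        (inner ℂ (H10.val us) (H10.val S - H10.val w') : ℂ).re) := by
    have := congrArg Complex.re e1
    rw [Complex.re_ofReal_mul, Complex.re_ofReal_mul, pairing, pairing] at this
    rw [this, inner_sub_right, Complex.sub_re]
    ring
  refine ⟨?_, fun heq => ?_⟩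
  · by_contra! hlt
    have := mul_lt_mul_of_pos_right hlt hp
    have := mul_nonneg hlam.le hq
    linarith
  rw [heq] at e2 hS
  have hSw' : H10.val S = H10.val w' := by
    by_contra hne
    have := (re_inner_pos (sub_ne_zero.2 hne) hpos hus0 hSw).1
    have := mul_pos hlam this
    linarith
  have hww : pairing w' w' = 1 := by
    rw [pairing, inner_self_eq_norm_sq_to_K, hw'1]; simp
  have a1 : (formA κ S S).re = lam := by
    rw [← h.re_form_self, hS, pairing, hSw', ← pairing, hww]
    simp
  have a2 : (formA κ S w').re = lam := by
    -- S and w' agree as functions, but their gradients are not identified; the argument uses only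
    -- that the second slot of the drift form sees values alone.
    have e3 : formB b S w' = formB b S S := by rw [formB, formB, hSw']
    have e4 := congrArg Complex.re (hS w')
    rw [hww, form, e3, Complex.add_re, h.re_formB_self, add_zero] at e4
    simpa using e4
  have a3 : (formA κ w w).re = μ.re := by rw [← h.re_form_self, hw.form_self]
  obtain ⟨i1, j1⟩ := h.re_formA_eq S S
  obtain ⟨i2, j2⟩ := h.re_formA_eq S w'
  obtain ⟨i3, j3⟩ := h.re_formA_eq w w
  -- The diamagnetic bound |∇|w|| ≤ |∇w| and Young's inequality. Inserting the three energies gives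
  -- 2λ ≤ λ + Re μ, which together with |μ| = λ forces μ = λ.
  have key : 2 * (formA κ S w').re ≤ (formA κ S S).re + (formA κ w w).re := by
    rw [j1, j2, j3, ← integral_const_mul, ← integral_add i1 i3]
    refine integral_mono_ae (i2.const_mul 2) (i1.add i3) ?_
    filter_upwards [hw2, h.diff.bounds] with x e1 e2
    have hκ : 0 ≤ κ x := h.pos.le.trans e2.1
    change 2 * (κ x * _) ≤ κ x * _ + κ x * _
    have t1 : (inner ℂ (H10.grad w' x) (H10.grad S x) : ℂ).re ≤
        ‖H10.grad w x‖ * ‖H10.grad S x‖ :=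
      (re_inner_le_norm (𝕜 := ℂ) _ _).trans (mul_le_mul_of_nonneg_right e1 (norm_nonneg _))
    have t2 : (inner ℂ (H10.grad S x) (H10.grad S x) : ℂ).re = ‖H10.grad S x‖ ^ 2 :=
      inner_self_eq_norm_sq (𝕜 := ℂ) _
    have t3 : (inner ℂ (H10.grad w x) (H10.grad w x) : ℂ).re = ‖H10.grad w x‖ ^ 2 :=
      inner_self_eq_norm_sq (𝕜 := ℂ) _
    rw [t2, t3]
    nlinarith [mul_le_mul_of_nonneg_left t1 hκ,
      mul_nonneg hκ (sq_nonneg (‖H10.grad w x‖ - ‖H10.grad S x‖))]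
  have hre : lam ≤ μ.re := by linarith
  have hre' : μ.re = lam := le_antisymm ((Complex.re_le_norm μ).trans heq.le) hre
  have him : μ.im = 0 := by
    have := Complex.sq_norm μ
    rw [Complex.normSq_apply, heq, hre'] at this
    nlinarith
  exact Complex.ext hre' (by simpa using him)

theorem IsCoeff.eq_of_isEig (h : IsCoeff D κmin κmax M κ b) (hd : 1 ≤ d) (hD : IsOpen D)
    (hconv : Convex ℝ D) (hb : Bornology.IsBounded D) {lam lam' : ℝ} (hlam' : 0 < lam')
    {u us : H10 D} (hu : IsEig κ b (lam : ℂ) u) (hu0 : IsNonneg u)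
    (hus : IsEig κ (-b) (lam' : ℂ) us) (hus0 : IsNonneg us) : lam' = lam := by
  have hpos := hus.pos h.neg hd hD hconv hb hlam'.le hus0
  have hp := (re_inner_pos (norm_ne_zero_iff.1 (hu.1 ▸ one_ne_zero)) hpos hus0 hu0).1
  have e1 := h.mul_pairing_dual hus u
  rw [hu.2] at e1
  have e2 := congrArg Complex.re e1
  rw [Complex.re_ofReal_mul, Complex.re_ofReal_mul] at e2
  exact (mul_right_cancel₀ hp.ne' e2).symm

end Principal

/-! ### The homotopy problem and the eigenvalue estimate -/

section Homotopy

variable {d : ℕ} {D : Set (Pt d)} {κmin κmax amax : ℝ} {κ : Pt d → ℝ} {a : Pt d → Pt d} {t : ℝ}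

lemma form_smul_right (κ : Pt d → ℝ) (a : Pt d → Pt d) (t : ℝ) (u v : H10 D) :
    form κ (t • a) u v = formH κ a t u v := by
  have : formB (t • a) u v = (t : ℂ) * formB a u v := by
    rw [formB, formB, ← integral_const_mul]
    congr 1
    ext x
    simp only [Pi.smul_apply, PiLp.smul_apply, smul_eq_mul, Complex.ofReal_mul, Finset.mul_sum,
      Finset.sum_mul]
    exact Finset.sum_congr rfl fun i _ => by ring
  rw [form, this, formH]

lemma supNorm_le (ha : IsConvection D amax a) : supNorm D a ≤ max amax 0 := by
  have h := ENNReal.toReal_mono ENNReal.ofReal_ne_top ha.bound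
  rwa [ENNReal.toReal_ofReal'] at h

lemma ae_norm_le_supNorm (ha : IsConvection D amax a) :
    ∀ᵐ x ∂(volume.restrict D), ‖a x‖ ≤ supNorm D a := by
  have hfin : eLpNorm a ⊤ (volume.restrict D) ≠ ⊤ :=
    (ha.bound.trans_lt ENNReal.ofReal_lt_top).ne
  rw [supNorm]
  rw [eLpNorm_exponent_top] at hfin ⊢
  filter_upwards [ae_le_eLpNormEssSup (f := a) (μ := volume.restrict D)] with x hx
  rw [← toReal_enorm]
  exact ENNReal.toReal_mono hfin hx

lemma isCoeff_supNorm (hκmin : 0 < κmin) (hκ : IsDiffusion D κmin κmax κ)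
    (ha : IsConvection D amax a) : IsCoeff D κmin κmax (supNorm D a) κ a :=
  ⟨hκmin, hκ, ENNReal.toReal_nonneg, ha.meas, ae_norm_le_supNorm ha, ha.div_free⟩

lemma isCoeff_smul (hκmin : 0 < κmin) (hκ : IsDiffusion D κmin κmax κ)
    (ha : IsConvection D amax a) (ht : t ∈ Icc (0 : ℝ) 1) :
    IsCoeff D κmin κmax (max amax 0) κ (t • a) where
  pos := hκmin
  diff := hκ
  nonneg := le_max_right _ _
  meas := ha.meas.const_smul t
  bound := by
    filter_upwards [ae_norm_le_supNorm ha] with x hx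
    rw [Pi.smul_apply, norm_smul, Real.norm_of_nonneg ht.1]
    exact (mul_le_of_le_one_left (norm_nonneg _) ht.2).trans (hx.trans (supNorm_le ha))
  div_free φ hφ := by
    simp only [Pi.smul_apply, map_smul, smul_eq_mul]
    rw [integral_const_mul, ha.div_free φ hφ, mul_zero]

lemma isEig_smul_iff {μ : ℂ} {u : H10 D} : IsEig κ (t • a) μ u ↔ IsEigenpair κ a t μ u := by
  simp only [IsEig, IsEigenpair, form_smul_right]

lemma isEig_neg_smul_iff {M : ℝ} (h : IsCoeff D κmin κmax M κ (t • a)) {μ : ℂ} {u : H10 D} :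
    IsEig κ (-(t • a)) μ u ↔ IsDualEigenpair κ a t μ u := by
  refine and_congr_right fun _ => forall_congr' fun v => ?_
  rw [← form_smul_right, h.form_conj u v, ← (RingHom.injective (starRingEnd ℂ)).eq_iff, map_mul,
    pairing, inner_conj_symm, ← pairing]

/-- The principal eigenpair of the homotopy problem, with an upper bound that depends only on the
class of coefficients. -/
theorem exists_principal (hd : 1 ≤ d) (hD : IsOpen D) (hconv : Convex ℝ D)
    (hb : Bornology.IsBounded D) (hne : D.Nonempty) (κmin κmax amax : ℝ) (hκmin : 0 < κmin) :
    ∃ C : ℝ, ∀ κ a, IsDiffusion D κmin κmax κ → IsConvection D amax a → ∀ t ∈ Icc (0 : ℝ) 1,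
      ∃ lam : ℝ, 0 < lam ∧ lam ≤ C ∧
        (∀ μ : ℂ, IsSmallestEigenvalue D κ a t μ ↔ μ = (lam : ℂ)) ∧
        ∃ u us : H10 D, IsHomotopySolution κ a t (lam : ℂ) u us ∧ IsNonneg u ∧ IsNonneg us := by
  have := isFiniteMeasure_restrict hb
  obtain ⟨C, hC, e, he, he0, hbar⟩ := exists_barrier hD hne κmin κmax (max amax 0) hκmin
  refine ⟨C, fun κ a hκ ha t ht => ?_⟩
  have h := isCoeff_smul hκmin hκ ha ht
  obtain ⟨lam, hlam, hlamC, u, hu0, hu⟩ := h.exists_isEig hd hD hb hC he he0 (hbar _ _ h)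
  obtain ⟨lam', hlam', -, us, hus0, hus⟩ :=
    h.neg.exists_isEig hd hD hb hC he he0 (hbar _ _ h.neg)
  obtain rfl := h.eq_of_isEig hd hD hconv hb hlam' hu hu0 hus hus0
  have hmin : ∀ {μ : ℂ} {w : H10 D}, IsEigenpair κ a t μ w →
      lam' ≤ ‖μ‖ ∧ (‖μ‖ = lam' → μ = lam') := fun hw =>
    h.le_norm_of_isEig hd hD hconv hb hlam hus hus0 (isEig_smul_iff.2 hw)
  have hnorm : ‖(lam' : ℂ)‖ = lam' := by rw [Complex.norm_real, Real.norm_of_nonneg hlam.le]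
  have hsm : IsSmallestEigenvalue D κ a t (lam' : ℂ) :=
    ⟨⟨u, isEig_smul_iff.1 hu⟩, fun μ w hw => hnorm.le.trans (hmin hw).1⟩
  refine ⟨lam', hlam, hlamC, fun μ => ⟨fun ⟨⟨w, hw⟩, hμ⟩ => ?_, fun hμ => hμ ▸ hsm⟩, u, us,
    ⟨hsm, isEig_smul_iff.1 hu, ?_⟩, hu0, hus0⟩
  · exact (hmin hw).2 (le_antisymm ((hμ _ _ (isEig_smul_iff.1 hu)).trans hnorm.le) (hmin hw).1)
  · rw [Complex.conj_ofReal]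
    exact (isEig_neg_smul_iff h).1 hus

/-- Each primal equation is tested with the dual eigenfunction at the other parameter and each dual
equation with the primal one. In the differences the diffusion form cancels and the drift keeps the
factor 1 - t. -/
lemma eigenvalue_sub_mul_denom {lam1 lamt : ℂ} {u1 us1 ut ust : H10 D}
    (h1 : IsHomotopySolution κ a 1 lam1 u1 us1) (ht : IsHomotopySolution κ a t lamt ut ust) :
    (lam1 - lamt) * denom u1 us1 ut ust = ((1 - t : ℝ) : ℂ) * (formB a u1 ust + formB a ut us1) := by
  have e1 := h1.primal.2 ust
  have e2 := ht.dual.2 u1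
  have e3 := h1.dual.2 ut
  have e4 := ht.primal.2 us1
  rw [Complex.conj_conj] at e2 e3
  simp only [formH] at e1 e2 e3 e4
  rw [denom]
  push_cast at *
  linear_combination e2 - e1 + e4 - e3

lemma norm_sub_le_homotopyConst (hκmin : 0 < κmin) (hκ : IsDiffusion D κmin κmax κ)
    (ha : IsConvection D amax a) (ht : t ≤ 1) {lam1 lamt : ℂ} {u1 us1 ut ust : H10 D}
    (h1 : IsHomotopySolution κ a 1 lam1 u1 us1) (h2 : IsHomotopySolution κ a t lamt ut ust)
    (h0 : denom u1 us1 ut ust ≠ 0) :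
    ‖lam1 - lamt‖ ≤ homotopyConst a u1 us1 ut ust * (1 - t) := by
  have h := isCoeff_supNorm hκmin hκ ha
  have e := congrArg norm (eigenvalue_sub_mul_denom h1 h2)
  have b1 := h.norm_formB_le u1 ust
  have b2 := h.norm_formB_le us1 ut
  rw [h2.dual.1, mul_one] at b1
  rw [h2.primal.1, mul_one] at b2
  -- Skewness moves the derivative from u(t) to u*(1), so that only gradients at parameter 1 enter
  -- the constant.
  have b3 : ‖formB a ut us1‖ = ‖formB a us1 ut‖ := by
    rw [h.formB_skew ut us1, norm_neg, RCLike.norm_conj]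
  have b4 := norm_add_le (formB a u1 ust) (formB a ut us1)
  rw [norm_mul, norm_mul, Complex.norm_real, Real.norm_of_nonneg (sub_nonneg.2 ht)] at e
  rw [homotopyConst, div_mul_eq_mul_div, le_div_iff₀ (norm_pos_iff.2 h0), e, normV, normV,
    mul_comm]
  exact mul_le_mul_of_nonneg_right (by linarith) (sub_nonneg.2 ht)

end Homotopy

/-! ### Bounds uniform over the coefficient class -/

section Uniform

variable {d : ℕ} {D : Set (Pt d)}

/-- Normalised nonnegative eigenfunctions have energy and overlap bounds that depend only on the
class of coefficients. -/
theorem exists_uniform_bounds (hd : 1 ≤ d) (hD : IsOpen D) (hconv : Convex ℝ D)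
    (hb : Bornology.IsBounded D) (hne : D.Nonempty) (κmin κmax amax : ℝ) (hκmin : 0 < κmin) :
    ∃ Λ δ : ℝ, 0 < δ ∧ ∀ κ a, IsDiffusion D κmin κmax κ → IsConvection D amax a →
      ∀ t ∈ Icc (0 : ℝ) 1, ∀ (lam1 lamt : ℂ) (u1 us1 ut ust : H10 D),
        IsHomotopySolution κ a 1 lam1 u1 us1 → IsHomotopySolution κ a t lamt ut ust →
        IsNonneg u1 → IsNonneg us1 → IsNonneg ut → IsNonneg ust →
        normV u1 ≤ Λ ∧ normV us1 ≤ Λ ∧ δ ≤ (denom u1 us1 ut ust).re ∧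
          (denom u1 us1 ut ust).im = 0 := by
  obtain ⟨C, hC⟩ := exists_principal hd hD hconv hb hne κmin κmax amax hκmin
  obtain ⟨δ, hδ, hδ'⟩ := exists_pairing_ge hd hD hconv hb κmax (max amax 0) (√(C / κmin)) hκmin
  refine ⟨√(C / κmin), δ, hδ, fun κ a hκ ha t ht lam1 lamt u1 us1 ut ust h1 h2 n1 n2 n3 n4 => ?_⟩
  have key : ∀ s ∈ Icc (0 : ℝ) 1, ∀ (lam : ℂ) (u us : H10 D), IsHomotopySolution κ a s lam u us →
      IsNonneg u → IsNonneg us → normV u ≤ √(C / κmin) ∧ normV us ≤ √(C / κmin) ∧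
        H10.val u ∈ superStates D κmin κmax (max amax 0) (√(C / κmin)) ∧
        H10.val us ∈ superStates D κmin κmax (max amax 0) (√(C / κmin)) := by
    intro s hs lam u us hsol hu hus
    have h := isCoeff_smul hκmin hκ ha hs
    obtain ⟨r, hr, hrC, hr', -⟩ := hC κ a hκ ha s hs
    -- Any smallest eigenvalue is the principal one, so its bound C controls the energy of every
    -- solution, whichever eigenfunctions were chosen.
    obtain rfl := (hr' lam).1 hsol.smallest
    have e1 := isEig_smul_iff.2 hsol.primal
    have e2 := (isEig_neg_smul_iff h).2 hsol.dual
    rw [Complex.conj_ofReal] at e2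
    have g1 := e1.norm_grad_le h hrC
    have g2 := e2.norm_grad_le h.neg hrC
    exact ⟨g1, g2, e1.mem_superStates h hr.le hu g1, e2.mem_superStates h.neg hr.le hus g2⟩
  obtain ⟨a1, a2, a3, a4⟩ := key 1 (by simp) lam1 u1 us1 h1 n1 n2
  obtain ⟨-, -, b3, b4⟩ := key t ht lamt ut ust h2 n3 n4
  have im0 : ∀ {u v : H10 D}, IsNonneg u → IsNonneg v →
      H10.val v ∈ superStates D κmin κmax (max amax 0) (√(C / κmin)) →
      H10.val u ∈ superStates D κmin κmax (max amax 0) (√(C / κmin)) → (pairing u v).im = 0 := by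
    intro u v hu hv hv' hu'
    obtain ⟨-, -, p⟩ := pos_of_mem_closure_superStates hd hD hconv hb hκmin (subset_closure hv')
    obtain ⟨q, -, -⟩ := pos_of_mem_closure_superStates hd hD hconv hb hκmin (subset_closure hu')
    exact (re_inner_pos (norm_ne_zero_iff.1 (q ▸ one_ne_zero)) p hv hu).2
  refine ⟨a1, a2, ?_, ?_⟩
  · rw [denom, Complex.add_re, pairing, pairing]
    linarith [hδ' _ b4 _ a3, hδ' _ a4 _ b3]
  · rw [denom, Complex.add_im, im0 n1 n4 b4 a3, im0 n3 n2 a4 b3, add_zero]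

end Uniform

end ConvDiff

end

theorem mainTheorem6 {d : ℕ} (hd1 : 1 ≤ d) (hd3 : d ≤ 3)
    (D : Set (ConvDiff.Pt d)) (hD_open : IsOpen D) (hD_convex : Convex ℝ D)
    (hD_bdd : Bornology.IsBounded D) (hD_ne : D.Nonempty)
    {Ω : Type*} [MeasurableSpace Ω] (π : Measure Ω) [IsProbabilityMeasure π]
    (κmin κmax amax : ℝ) (hκmin : 0 < κmin)
    (κ : Ω → ConvDiff.Pt d → ℝ) (a : Ω → ConvDiff.Pt d → ConvDiff.Pt d)
    (hκ : ∀ᵐ ω ∂π, ConvDiff.IsDiffusion D κmin κmax (κ ω))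
    (ha : ∀ᵐ ω ∂π, ConvDiff.IsConvection D amax (a ω)) :
    -- fixed `ω`
    (∀ ω : Ω, ConvDiff.IsDiffusion D κmin κmax (κ ω) → ConvDiff.IsConvection D amax (a ω) →
      ∀ t ∈ Set.Icc (0 : ℝ) 1,
        -- the smallest eigenvalue is well defined, real and positive, and has nonnegative
        -- normalised primal and dual eigenfunctions
        (∃ lam : ℝ, 0 < lam ∧
          (∀ μ : ℂ, ConvDiff.IsSmallestEigenvalue D (κ ω) (a ω) t μ ↔ μ = (lam : ℂ)) ∧
          ∃ u us : ConvDiff.H10 D,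
            ConvDiff.IsHomotopySolution (κ ω) (a ω) t (lam : ℂ) u us ∧
            ConvDiff.IsNonneg u ∧ ConvDiff.IsNonneg us) ∧
        ∀ (lam1 lamt : ℂ) (u1 us1 ut ust : ConvDiff.H10 D),
          ConvDiff.IsHomotopySolution (κ ω) (a ω) 1 lam1 u1 us1 →
          ConvDiff.IsHomotopySolution (κ ω) (a ω) t lamt ut ust →
          -- the estimate, for normalised eigenfunctions of arbitrary phase
          (ConvDiff.denom u1 us1 ut ust ≠ 0 →
            ‖lam1 - lamt‖ ≤ ConvDiff.homotopyConst (a ω) u1 us1 ut ust * (1 - t)) ∧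
          -- the denominator is positive for nonnegative eigenfunctions
          (ConvDiff.IsNonneg u1 → ConvDiff.IsNonneg us1 →
            ConvDiff.IsNonneg ut → ConvDiff.IsNonneg ust →
            0 < (ConvDiff.denom u1 us1 ut ust).re ∧
              (ConvDiff.denom u1 us1 ut ust).im = 0)) ∧
    -- bound uniform in `ω`
    (∃ t₀ ∈ Set.Ico (0 : ℝ) 1, ∀ t ∈ Set.Icc t₀ 1, ∃ Ct : ℝ, ∀ᵐ ω ∂π,
      ∀ (lam1 lamt : ℂ) (u1 us1 ut ust : ConvDiff.H10 D),
        ConvDiff.IsHomotopySolution (κ ω) (a ω) 1 lam1 u1 us1 →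
        ConvDiff.IsHomotopySolution (κ ω) (a ω) t lamt ut ust →
        ConvDiff.IsNonneg u1 → ConvDiff.IsNonneg us1 →
        ConvDiff.IsNonneg ut → ConvDiff.IsNonneg ust →
        ConvDiff.homotopyConst (a ω) u1 us1 ut ust < Ct) := by

  obtain ⟨C, hC⟩ := ConvDiff.exists_principal hd1 hD_open hD_convex hD_bdd hD_ne κmin κmax amax hκmin
  obtain ⟨Λ, δ, hδ, hunif⟩ :=
    ConvDiff.exists_uniform_bounds hd1 hD_open hD_convex hD_bdd hD_ne κmin κmax amax hκmin
  -- The overlap bound δ holds for all t in [0, 1], so t₀ = 0 serves. The maximum with 0 covers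
  -- negative values of `amax`, and the final 1 makes the inequality strict.
  refine ⟨fun ω hκω haω t ht => ⟨?_, fun lam1 lamt u1 us1 ut ust h1 h2 => ⟨fun h0 => ?_,
    fun n1 n2 n3 n4 => ?_⟩⟩, 0, by simp, fun t ht => ⟨max amax 0 * (2 * Λ) / δ + 1, ?_⟩⟩
  · obtain ⟨lam, hlam, -, h⟩ := hC _ _ hκω haω t ht
    exact ⟨lam, hlam, h⟩
  · exact ConvDiff.norm_sub_le_homotopyConst hκmin hκω haω ht.2 h1 h2 h0
  · obtain ⟨-, -, h3, h4⟩ := hunif _ _ hκω haω t ht _ _ _ _ _ _ h1 h2 n1 n2 n3 n4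
    exact ⟨hδ.trans_le h3, h4⟩
  · filter_upwards [hκ, ha] with ω hκω haω lam1 lamt u1 us1 ut ust h1 h2 n1 n2 n3 n4
    obtain ⟨g1, g2, h3, -⟩ := hunif _ _ hκω haω t ht _ _ _ _ _ _ h1 h2 n1 n2 n3 n4
    refine lt_of_le_of_lt ?_ (lt_add_one _)
    have h5 : 0 ≤ ConvDiff.normV u1 + ConvDiff.normV us1 :=
      add_nonneg (norm_nonneg _) (norm_nonneg _)
    exact div_le_div₀ (mul_nonneg (le_max_right _ _) (by linarith))
      (mul_le_mul (ConvDiff.supNorm_le haω) (by linarith) h5 (le_max_right _ _)) hδ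
      (h3.trans (Complex.re_le_norm _))
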